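/- Let $\kappa>0$ and let $\Lambda=[-1/2,1/2)^2$ be the two-dimensional unit torus. For $k\in\mathbb Z^2$ put $\lambda_k=\kappa+2\pi^2|k|^2$ and $u_k(x)=e^{2\pi i k\cdot x}$ (the eigenvalues and eigenfunctions of $\kappa-\Delta/2$ on $\Lambda$). Let $X=(X_k)_{k\in\mathbb Z^2}$ be independent standard complex Gaussian random variables ($\mathbb E X_k=0$, $\mathbb E X_k^2=0$, $\mathbb E|X_k|^2=1$), with law $\mathbb P$. A cutoff is a function $\vartheta:\mathbb R^2\to[0,\infty)$ of rapid decay that is continuous at $0$ and satisfies $\vartheta(0)=1$. For a cutoff $\vartheta$ and $N>0$ let $$\phi_N=\sum_{k\in\mathbb Z^2}\frac{X_k}{\sqrt{\lambda_k}}\sqrt{\vartheta(k/N)}\,u_k .$$ Let $v:\mathbb R^2\to\mathbb R$ be even, smooth, compactly supported, with $\int v=1$ and with nonnegative Fourier transform, and for $\epsilon>0$ let $v^\epsilon(x)=\sum_{n\in\mathbb Z^2}\epsilon^{-2}v((x-n)/\epsilon)$. With ${:}\,\cdot\,{:}$ denoting Wick ordering with respect to $\mathbb P$, put $$V_N^\epsilon=\frac12\int_\Lambda\!\int_\Lambda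 v^\epsilon(x-\tilde x)\,{:}|\phi_N(x)|^2|\phi_N(\tilde x)|^2{:}\,dx\,d\tilde x,\qquad V_N=\frac12\int_\Lambda{:}|\phi_N(x)|^4{:}\,dx .$$ **Proposition 4.1.** As $N\to\infty$, $V^\epsilon_N$ (for every $\epsilon>0$) and $V_N$ converge in $L^2(\mathbb P)$ to random variables $V^\epsilon$ and $V$ that do not depend on the cutoff $\vartheta$. There are constants $c>0$ and $C>0$, depending only on $\kappa$ and $v$, such that for all $\epsilon>0$ and $t\ge1$ $$\mathbb P\bigl(e^{-V^\epsilon}>t\bigr)\le C\exp\bigl(-e^{c\sqrt{\log t}}\bigr),\qquad \mathbb P\bigl(e^{-V}>t\bigr)\le C\exp\bigl(-e^{c\sqrt{\log t}}\bigr).$$ In particular, the family $(e^{-V^\epsilon})_{\epsilon>0}$ is uniformly integrable. -/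

import Mathlib

open MeasureTheory ProbabilityTheory Filter Topology
open scoped FourierTransform ContDiff ComplexConjugate

noncomputable section

namespace Phi42

/-- The plane `ℝ²` with its Euclidean norm. -/
abbrev Plane : Type := EuclideanSpace ℝ (Fin 2)

/-- The index set `ℤ²` of the Fourier modes. -/
abbrev Lattice : Type := Fin 2 → ℤ

/-- The inclusion of `ℤ²` in `ℝ²`. -/
def toPlane (k : Lattice) : Plane := WithLp.toLp 2 (fun i => (k i : ℝ))

/-- The fundamental domain `[-1/2, 1/2)²` of the unit torus. -/
def torus : Set Plane := {x | ∀ i, x i ∈ Set.Ico (-(1 / 2) : ℝ) (1 / 2)}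

/-- The eigenvalue `κ + 2 π² |k|²` of `κ - Δ / 2` on the torus. -/
def eigenvalue (κ : ℝ) (k : Lattice) : ℝ := κ + 2 * Real.pi ^ 2 * ‖toPlane k‖ ^ 2

/-- The normalized eigenfunction `x ↦ exp (2 π i k · x)` of `κ - Δ / 2` on the torus. -/
def eigenfunction (k : Lattice) (x : Plane) : ℂ :=
  Complex.exp (2 * Real.pi * Complex.I * (inner ℝ (toPlane k) x : ℝ))

/-- The law of a standard complex Gaussian `Z`: the real and the imaginary part are independent
centred Gaussians of variance `1 / 2`, so that `E Z = 0`, `E Z² = 0` and `E |Z|² = 1`. -/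
def stdComplexGaussian : Measure ℂ :=
  ((gaussianReal 0 2⁻¹).prod (gaussianReal 0 2⁻¹)).map Complex.measurableEquivRealProd.symm

instance : IsProbabilityMeasure stdComplexGaussian :=
  Measure.isProbabilityMeasure_map Complex.measurableEquivRealProd.symm.measurable.aemeasurable

/-- The sample space; a sample point `X` is the family of the coefficients `X k`. -/
abbrev Sample : Type := Lattice → ℂ

/-- The probability measure: under `law` the coordinates `X k` are independent standard complex
Gaussians. -/
def law : Measure Sample := Measure.infinitePi (fun _ : Lattice => stdComplexGaussian)

/-- An admissible Fourier cutoff: nonnegative, equal to one and continuous at the origin, and of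
rapid decay. -/
structure IsCutoff (θ : Plane → ℝ) : Prop where
  nonneg : ∀ ξ, 0 ≤ θ ξ
  at_zero : θ 0 = 1
  continuousAt_zero : ContinuousAt θ 0
  decay : ∀ m : ℕ, ∃ C : ℝ, ∀ ξ, ‖ξ‖ ^ m * θ ξ ≤ C

/-- The regularized free field `φ_N (x) = ∑ₖ X_k λ_k^{-1/2} θ(k/N)^{1/2} u_k(x)`; the series
converges absolutely for almost every `X`. -/
def field (κ : ℝ) (θ : Plane → ℝ) (N : ℝ) (x : Plane) (X : Sample) : ℂ :=
  ∑' k : Lattice, X k / (√(eigenvalue κ k) : ℂ) * (√(θ (N⁻¹ • toPlane k)) : ℂ) * eigenfunction k x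

/-- The Wick-ordered monomial `:ξ₁ ⋯ ξₙ:` of a centred (complex) Gaussian vector, namely the sum
over all partial pairings `Π` of the index set of
`∏_{i unpaired} ξ_i * ∏_{{i, j} ∈ Π} (- E[ξ_i ξ_j])`.
A partial pairing is encoded by the involution `σ` that exchanges the members of each pair. -/
def wick {Ω : Type*} [MeasurableSpace Ω] (P : Measure Ω) {n : ℕ} (ξ : Fin n → Ω → ℂ) (s : Ω) : ℂ :=
  ∑ σ : Equiv.Perm (Fin n) with σ * σ = 1,
    (∏ i : Fin n with σ i = i, ξ i s) *
      ∏ i : Fin n with i < σ i, (-∫ s', ξ i s' * ξ (σ i) s' ∂P)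

/-- `:|φ_N(x)|² |φ_N(y)|²:`, a real quantity. -/
def wickSquares (κ : ℝ) (θ : Plane → ℝ) (N : ℝ) (x y : Plane) (X : Sample) : ℝ :=
  (wick law ![field κ θ N x, fun X => conj (field κ θ N x X),
    field κ θ N y, fun X => conj (field κ θ N y X)] X).re

/-- The admissible two-body potentials: even, smooth, compactly supported, of positive type
(the Fourier transform is nonnegative), with integral one. -/
structure IsPotential (v : Plane → ℝ) : Prop where
  even : ∀ x, v (-x) = v x
  smooth : ContDiff ℝ ∞ v
  compactSupport : HasCompactSupport v
  positiveType : ∀ ξ, ∃ r : ℝ, 0 ≤ r ∧ 𝓕 (fun x => (v x : ℂ)) ξ = (r : ℂ)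
  integral_eq_one : ∫ x, v x = 1

/-- The rescaled periodized potential `v^ε(x) = ∑ₙ ε⁻² v((x - n)/ε)`. -/
def rescaled (v : Plane → ℝ) (ε : ℝ) (x : Plane) : ℝ :=
  ∑' n : Lattice, (ε ^ 2)⁻¹ * v (ε⁻¹ • (x - toPlane n))

/-- The truncated nonlocal interaction
`V^ε_N = 1/2 ∫∫ v^ε(x - y) :|φ_N(x)|² |φ_N(y)|²: dx dy`. -/
def truncatedNonlocal (κ : ℝ) (v : Plane → ℝ) (ε : ℝ) (θ : Plane → ℝ) (N : ℝ) (X : Sample) : ℝ :=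
  1 / 2 * ∫ x in torus, ∫ y in torus, rescaled v ε (x - y) * wickSquares κ θ N x y X

/-- The truncated local interaction `V_N = 1/2 ∫ :|φ_N(x)|⁴: dx`. -/
def truncatedLocal (κ : ℝ) (θ : Plane → ℝ) (N : ℝ) (X : Sample) : ℝ :=
  1 / 2 * ∫ x in torus, wickSquares κ θ N x x X

/-- `V` is (a version of) the nonlocal interaction `V^ε`: the limit in `L²` of the truncated
interactions, whatever the cutoff. -/
def IsNonlocalInteraction (κ : ℝ) (v : Plane → ℝ) (ε : ℝ) (V : Sample → ℝ) : Prop :=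
  MemLp V 2 law ∧ ∀ θ, IsCutoff θ →
    Tendsto (fun N : ℝ => eLpNorm (fun X => truncatedNonlocal κ v ε θ N X - V X) 2 law)
      atTop (𝓝 0)

/-- `V` is (a version of) the local interaction `1/2 ∫ :|φ(x)|⁴: dx`: the limit in `L²` of the
truncated interactions, whatever the cutoff. -/
def IsLocalInteraction (κ : ℝ) (V : Sample → ℝ) : Prop :=
  MemLp V 2 law ∧ ∀ θ, IsCutoff θ →
    Tendsto (fun N : ℝ => eLpNorm (fun X => truncatedLocal κ θ N X - V X) 2 law)
      atTop (𝓝 0)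

end Phi42

end

noncomputable section

namespace Phi42

/-! ### The standard complex Gaussian -/

/-! The argument is Nelson's, with two-dimensional Fourier sums in place of kernels. After
integration over the torus, every truncated interaction is a series of degree-four Wick monomials
over quadruples of modes that conserve momentum, weighted by four amplitudes and by a multiplier
`w`: the Fourier transform of `v` at `ε k` for the nonlocal interaction, the constant one for the
local one (`truncatedNonlocal_eq`, `truncatedLocal_eq`). The only facts used about `w` are `0 ≤ w ≤
B`, `w 0 = 1` and `1 ≤ B`. All of them hold with `B = ∫ |v|`, whatever `ε`, hence the uniformity.

Moments of Wick polynomials come from a holomorphic trick. If `W` is an independent copy of `X`,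
then `(X + W)/√2` and `conj (X - W)/√2` are again independent standard families. A Wick monomial is
the mean over `W` of an ordinary monomial, in `X + W` where it has `X` and in `conj (X - W)` where
it has `conj X`; this is holomorphic in the new families. A power of a holomorphic homogeneous
polynomial is another one, so a second moment bound yields all even moments, and Jensen's inequality
transfers them to Wick polynomials (`integral_norm_pow_wickMonomial_le`).

Squared coefficients are products of inverse eigenvalues and are summable under momentum
conservation, with a small power to spare (`summable_majorant`). Dominated convergence then gives
`L²` limits independent of the cutoff, and the spare power gives the rate `n ^ (-1/4)` for the
squared norm of the error of the box cutoff `n`.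

Positivity gives the lower bound. Up to exchange terms, the box-truncated interaction is half a sum
of `w` times squared Fourier coefficients of `:|φ|²:`. Its zero mode absorbs the exchange terms at
the cost of a multiple of the squared variance, which is of order `(log n)²`
(`le_re_sum_coeff_mul_wickMonomial`, `boxVariance_le`). With `log n` of order `√L`, the event `V <
-L` forces the truncation error to be at least one. A moment of order a small power of `n` makes
that doubly exponentially unlikely (`exists_tail_bound`). The tail bounds the second moment of
`e^{-V}`, hence the uniform integrability. -/

instance : IsGaussian stdComplexGaussian := by
  have h : stdComplexGaussian = ((gaussianReal 0 2⁻¹).prod (gaussianReal 0 2⁻¹)).map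
      Complex.equivRealProdCLM.symm := rfl
  rw [h]
  infer_instance

/-- The radial density makes invariance under isometries and the Gamma integral for the moments of
`‖z‖` available. -/
lemma stdComplexGaussian_eq_withDensity :
    stdComplexGaussian =
      volume.withDensity (fun z : ℂ => ENNReal.ofReal (Real.pi⁻¹ * Real.exp (-‖z‖ ^ 2))) := by
  have hv : (2⁻¹ : NNReal) ≠ 0 := by norm_num
  unfold stdComplexGaussian
  rw [gaussianReal_of_var_ne_zero _ hv,
    prod_withDensity (measurable_gaussianPDF _ _) (measurable_gaussianPDF _ _)]
  ext s hs
  have hm : MeasurableSet (Complex.measurableEquivRealProd.symm ⁻¹' s) :=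
    Complex.measurableEquivRealProd.symm.measurable hs
  rw [Measure.map_apply Complex.measurableEquivRealProd.symm.measurable hs,
    withDensity_apply _ hm, withDensity_apply _ hs,
    ← (Complex.volume_preserving_equiv_real_prod.symm
      Complex.measurableEquivRealProd).setLIntegral_comp_preimage hs (by fun_prop)]
  refine lintegral_congr fun p => ?_
  rw [gaussianPDF, gaussianPDF, ← ENNReal.ofReal_mul (gaussianPDFReal_nonneg _ _ _)]
  congr 1
  have h1 : ‖Complex.measurableEquivRealProd.symm p‖ ^ 2 = p.1 ^ 2 + p.2 ^ 2 := by
    rw [← Complex.normSq_eq_norm_sq, Complex.normSq_apply]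
    simp [Complex.measurableEquivRealProd, sq]
  rw [h1]
  simp only [gaussianPDFReal, sub_zero]
  have h2 : (2 : ℝ) * ((2⁻¹ : NNReal) : ℝ) = 1 := by norm_num
  have h3 : 2 * Real.pi * ((2⁻¹ : NNReal) : ℝ) = Real.pi := by
    push_cast; ring
  rw [h2, h3, div_one, div_one, mul_mul_mul_comm, ← Real.exp_add, ← mul_inv,
    Real.mul_self_sqrt Real.pi_pos.le]
  congr 2
  ring

lemma stdComplexGaussian_map_isometry (e : ℂ ≃ₗᵢ[ℝ] ℂ) :
    stdComplexGaussian.map e = stdComplexGaussian := by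
  have he : Measurable e := e.continuous.measurable
  rw [stdComplexGaussian_eq_withDensity]
  ext s hs
  rw [Measure.map_apply he hs, withDensity_apply _ (he hs), withDensity_apply _ hs,
    ← e.measurePreserving.setLIntegral_comp_preimage hs (by fun_prop)]
  simp

lemma integral_stdComplexGaussian {E : Type*} [NormedAddCommGroup E] [NormedSpace ℝ E]
    (f : ℂ → E) : ∫ z, f z ∂stdComplexGaussian =
      ∫ z : ℂ, (Real.pi⁻¹ * Real.exp (-‖z‖ ^ 2)) • f z := by
  rw [stdComplexGaussian_eq_withDensity, integral_withDensity_eq_integral_toReal_smul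
    (by fun_prop) (by simp)]
  refine integral_congr_ae (ae_of_all _ fun z => ?_)
  simp only
  rw [ENNReal.toReal_ofReal (by positivity)]

lemma integral_norm_pow_stdComplexGaussian (a : ℕ) :
    ∫ z : ℂ, ‖z‖ ^ (2 * a) ∂stdComplexGaussian = a.factorial := by
  rw [integral_stdComplexGaussian]
  have h := Complex.integral_rpow_mul_exp_neg_rpow (p := 2) (q := 2 * a) (by norm_num)
    (by have : (0 : ℝ) ≤ a := Nat.cast_nonneg a
        linarith)
  have h2 : ((2 * a + 2) / 2 : ℝ) = a + 1 := by ring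
  rw [h2, Real.Gamma_nat_eq_factorial] at h
  have h3 : ∀ z : ℂ, (Real.pi⁻¹ * Real.exp (-‖z‖ ^ 2)) • ‖z‖ ^ (2 * a) =
      Real.pi⁻¹ * (‖z‖ ^ (2 * a : ℝ) * Real.exp (-‖z‖ ^ (2 : ℝ))) := by
    intro z
    rw [show (2 * a : ℝ) = ((2 * a : ℕ) : ℝ) by push_cast; ring, Real.rpow_natCast,
      Real.rpow_two, smul_eq_mul]
    ring
  simp_rw [h3]
  rw [integral_const_mul, h]
  field_simp

lemma memLp_id_stdComplexGaussian (p : ENNReal) (hp : p ≠ ⊤) :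
    MemLp (fun z : ℂ => z) p stdComplexGaussian :=
  IsGaussian.memLp_id stdComplexGaussian p hp

/-- The moments of a standard complex Gaussian. -/
lemma integral_pow_mul_conj_pow (a b : ℕ) :
    ∫ z : ℂ, z ^ a * conj z ^ b ∂stdComplexGaussian = if a = b then (a.factorial : ℂ) else 0 := by
  split_ifs with h
  · subst h
    rw [← Complex.ofReal_natCast, ← integral_norm_pow_stdComplexGaussian, ← integral_complex_ofReal]
    refine integral_congr_ae (ae_of_all _ fun z => ?_)
    simp only
    rw [← mul_pow, Complex.mul_conj, Complex.normSq_eq_norm_sq, pow_mul]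
    norm_cast
  -- Invariance of the law under rotation by `u` multiplies the integral by `u ^ a * conj u ^ b`.
  · have key : ∀ u : Circle, ∫ z : ℂ, z ^ a * conj z ^ b ∂stdComplexGaussian =
        ((u : ℂ) ^ a * conj (u : ℂ) ^ b) * ∫ z : ℂ, z ^ a * conj z ^ b ∂stdComplexGaussian := by
      intro u
      conv_lhs => rw [← stdComplexGaussian_map_isometry (rotation u)]
      rw [integral_map (rotation u).continuous.measurable.aemeasurable (by fun_prop),
        ← integral_const_mul]
      refine integral_congr_ae (ae_of_all _ fun z => ?_)
      simp only [rotation_apply, map_mul]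
      ring
    have key2 : ∀ t : ℝ, Complex.exp (((a : ℂ) - b) * t * Complex.I) *
        ∫ z : ℂ, z ^ a * conj z ^ b ∂stdComplexGaussian =
        ∫ z : ℂ, z ^ a * conj z ^ b ∂stdComplexGaussian := by
      intro t
      conv_rhs => rw [key (Circle.exp t)]
      congr 1
      rw [Circle.coe_exp, ← Complex.exp_conj, ← Complex.exp_nat_mul, ← Complex.exp_nat_mul,
        ← Complex.exp_add]
      congr 1
      simp
      ring
    have hab : ((a : ℝ) - b) ≠ 0 := by
      rw [sub_ne_zero]; exact_mod_cast h
    -- At this angle the factor is `-1`, so the integral equals its own negative.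
    have := key2 (Real.pi / (a - b))
    rw [show ((a : ℂ) - b) * ((Real.pi / (a - b) : ℝ) : ℂ) * Complex.I = Real.pi * Complex.I by
      have hab' : ((a : ℂ) - b) ≠ 0 := by exact_mod_cast hab
      push_cast
      field_simp, Complex.exp_pi_mul_I] at this
    have h2 : (2 : ℂ) * ∫ z : ℂ, z ^ a * conj z ^ b ∂stdComplexGaussian = 0 := by
      linear_combination -this
    simpa using h2

/-- The rotation by `π / 4` of a pair of complex numbers, followed by a conjugation. -/
def mixPair (p : ℂ × ℂ) : ℂ × ℂ :=
  ((√2 : ℂ)⁻¹ * (p.1 + p.2), (√2 : ℂ)⁻¹ * conj (p.1 - p.2))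

lemma measurable_mixPair : Measurable mixPair := by
  unfold mixPair
  fun_prop

lemma integral_id_stdComplexGaussian : ∫ z, z ∂stdComplexGaussian = 0 := by
  simpa using integral_pow_mul_conj_pow 1 0

/-- Two independent copies of a centred Gaussian are invariant under rotation, and `z ↦ -conj z` is
an isometry. The sign is there because the rotation produces `p.2 - p.1` in the second component. -/
lemma map_mixPair : (stdComplexGaussian.prod stdComplexGaussian).map mixPair =
    stdComplexGaussian.prod stdComplexGaussian := by
  have h1 := IsGaussian.map_rotation_eq_self (μ := stdComplexGaussian)
    (by simpa using integral_id_stdComplexGaussian) (Real.pi / 4)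
  have h2 : stdComplexGaussian.map (fun z => -conj z) = stdComplexGaussian :=
    stdComplexGaussian_map_isometry (Complex.conjLIE.trans (LinearIsometryEquiv.neg ℝ))
  have h3 : (stdComplexGaussian.prod stdComplexGaussian).map (Prod.map id (fun z => -conj z)) =
      stdComplexGaussian.prod stdComplexGaussian := by
    rw [← Measure.map_prod_map _ _ measurable_id (by fun_prop), Measure.map_id, h2]
  have h4 : mixPair = Prod.map id (fun z => -conj z) ∘
      (ContinuousLinearMap.rotation (Real.pi / 4) : ℂ × ℂ → ℂ × ℂ) := by
    have h5 : (√2 : ℂ)⁻¹ = √2 / 2 := by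
      have : (√2 : ℂ) * √2 = 2 := by
        norm_cast
        exact Real.mul_self_sqrt (by norm_num)
      have h0 : (√2 : ℂ) ≠ 0 := by
        intro h
        simp [h] at this
      field_simp
      rw [sq, this]
    funext p
    simp only [mixPair, ContinuousLinearMap.rotation_apply, Function.comp, Prod.map, id,
      Real.cos_pi_div_four, Real.sin_pi_div_four, h5, Complex.real_smul]
    ext1
    · push_cast; ring
    · simp only [map_sub, map_add, map_mul, Complex.conj_ofReal, Complex.ofReal_neg, map_neg]
      push_cast; ring
  rw [h4, ← Measure.map_map (by fun_prop) (by fun_prop), h1, h3]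

/-! ### Families of independent complex Gaussians -/

/-- The law of a family of independent standard complex Gaussians. -/
def gaussianFamily (ι : Type*) : Measure (ι → ℂ) :=
  Measure.infinitePi (fun _ : ι => stdComplexGaussian)

instance (ι : Type*) : IsProbabilityMeasure (gaussianFamily ι) := by
  unfold gaussianFamily; infer_instance

instance : IsProbabilityMeasure law := by
  unfold law; infer_instance

lemma law_eq_gaussianFamily : law = gaussianFamily Lattice := rfl

lemma integral_gaussianFamily_prod {ι : Type*} (T : Finset ι) (g : ι → ℂ → ℂ)
    (hg : ∀ i, Measurable (g i)) :
    ∫ Z, ∏ i ∈ T, g i (Z i) ∂gaussianFamily ι =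
      ∏ i ∈ T, ∫ z, g i z ∂stdComplexGaussian := by
  have h1 : (fun Z : ι → ℂ => ∏ i ∈ T, g i (Z i)) =
      fun Z => (fun y : T → ℂ => ∏ i : T, g i (y i)) (T.restrict Z) := by
    funext Z
    exact (Finset.prod_coe_sort T (fun i => g i (Z i))).symm
  rw [h1, gaussianFamily]
  refine (integral_restrict_infinitePi (fun _ : ι => stdComplexGaussian) (s := T)
    (f := fun y : T → ℂ => ∏ i : T, g i (y i))
    (Measurable.aestronglyMeasurable (by fun_prop))).trans ?_
  rw [integral_fintype_prod_eq_prod (fun i : T => g i)]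
  exact Finset.prod_coe_sort T (fun i => ∫ z, g i z ∂stdComplexGaussian)

/-- The multiplicity of the value `i` of `k`. -/
def multiplicity {J ι : Type*} [Fintype J] [DecidableEq ι] (k : J → ι) (i : ι) : ℕ :=
  (Finset.univ.filter fun j => k j = i).card

lemma prod_comp_eq {J ι : Type*} [Fintype J] [DecidableEq ι] (k : J → ι) (T : Finset ι)
    (hT : ∀ j, k j ∈ T) (f : ι → ℂ) : ∏ j, f (k j) = ∏ i ∈ T, f i ^ multiplicity k i := by
  rw [← Finset.prod_fiberwise_of_maps_to (s := Finset.univ) (t := T) (g := k)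
    (fun j _ => hT j)]
  refine Finset.prod_congr rfl fun i _ => ?_
  rw [multiplicity, Finset.prod_congr rfl (g := fun _ => f i), Finset.prod_const]
  intro j hj
  rw [(Finset.mem_filter.mp hj).2]

/-- Grouping equal modes factorizes the integral into one-variable moments, which vanish unless the
multiplicities on the two sides agree. -/
lemma integral_prod_mul_conj_prod_aux {J L ι : Type*} [Fintype J] [Fintype L] [DecidableEq ι]
    (k : J → ι) (l : L → ι) (T : Finset ι) (hk : ∀ j, k j ∈ T) (hl : ∀ j, l j ∈ T) :
    ∫ Z, (∏ j, Z (k j)) * conj (∏ j, Z (l j)) ∂gaussianFamily ι =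
      ∏ i ∈ T, if multiplicity k i = multiplicity l i then ((multiplicity k i).factorial : ℂ)
        else 0 := by
  simp_rw [← integral_pow_mul_conj_pow]
  rw [← integral_gaussianFamily_prod T
    (fun i z => z ^ multiplicity k i * conj z ^ multiplicity l i) (fun i => by fun_prop)]
  refine integral_congr_ae (ae_of_all _ fun Z => ?_)
  simp only
  rw [prod_comp_eq k T hk, prod_comp_eq l T hl, map_prod, ← Finset.prod_mul_distrib]
  simp only [map_pow]

/-- A nonzero integral needs equal multiplicities, and these add up to the two degrees. -/
lemma integral_prod_mul_conj_prod_of_ne {J L ι : Type*} [Fintype J] [Fintype L]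
    (k : J → ι) (l : L → ι) (h : Fintype.card J ≠ Fintype.card L) :
    ∫ Z, (∏ j, Z (k j)) * conj (∏ j, Z (l j)) ∂gaussianFamily ι = 0 := by
  classical
  have hk : ∀ j, k j ∈ Finset.univ.image k ∪ Finset.univ.image l := by simp
  have hl : ∀ j, l j ∈ Finset.univ.image k ∪ Finset.univ.image l := by simp
  rw [integral_prod_mul_conj_prod_aux k l _ hk hl]
  by_contra hne
  have h1 := Finset.prod_ne_zero_iff.mp hne
  apply h
  rw [← Finset.card_univ, ← Finset.card_univ,
    Finset.card_eq_sum_card_fiberwise (f := k) (fun j _ => hk j),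
    Finset.card_eq_sum_card_fiberwise (f := l) (fun j _ => hl j)]
  refine Finset.sum_congr rfl fun i hi => ?_
  by_contra h2
  exact h1 i hi (if_neg h2)

/-- Fibres of equal cardinality are matched by bijections, which glue to a permutation. -/
lemma exists_perm_of_multiplicity_eq {J ι : Type*} [Fintype J] [DecidableEq ι] (k l : J → ι)
    (h : ∀ i, multiplicity k i = multiplicity l i) : ∃ τ : Equiv.Perm J, k ∘ τ = l := by
  have e : ∀ i, {j // l j = i} ≃ {j // k j = i} := fun i => Fintype.equivOfCardEq (by
    rw [Fintype.card_subtype, Fintype.card_subtype]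
    exact (h i).symm)
  refine ⟨(Equiv.sigmaFiberEquiv l).symm.trans
    ((Equiv.sigmaCongrRight e).trans (Equiv.sigmaFiberEquiv k)), ?_⟩
  funext j
  exact (e (l j) ⟨j, rfl⟩).2

/-- The Wick formula for holomorphic monomials. -/
lemma integral_prod_mul_conj_prod {J ι : Type*} [Fintype J] [DecidableEq J] [DecidableEq ι]
    (k l : J → ι) :
    ∫ Z, (∏ j, Z (k j)) * conj (∏ j, Z (l j)) ∂gaussianFamily ι =
      ((Finset.univ.filter fun σ : Equiv.Perm J => k ∘ σ = l).card : ℂ) := by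
  have hk : ∀ j, k j ∈ Finset.univ.image k ∪ Finset.univ.image l := by simp
  have hl : ∀ j, l j ∈ Finset.univ.image k ∪ Finset.univ.image l := by simp
  by_cases h : ∃ τ : Equiv.Perm J, k ∘ τ = l
  · obtain ⟨τ, rfl⟩ := h
    have hm : ∀ i, multiplicity (k ∘ τ) i = multiplicity k i := fun i =>
      Finset.card_bij' (fun j _ => τ j) (fun j _ => τ.symm j) (by simp) (by simp) (by simp)
        (by simp)
    have hk' : ∀ j, k j ∈ Finset.univ.image k := by simp
    rw [integral_prod_mul_conj_prod_aux k (k ∘ τ) _ hk' (fun j => hk' (τ j))]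
    simp only [hm, if_true]
    -- The stabilizer of `k` permutes within its fibres, hence has `∏ (multiplicity)!` elements; the
    -- permutations counted form a coset of it.
    have h1 := DomMulAct.stabilizer_card' k
    simp only [Fintype.card_subtype] at h1
    have h2 : (Finset.univ.filter fun σ : Equiv.Perm J => k ∘ σ = k ∘ τ).card =
        (Finset.univ.filter fun σ : Equiv.Perm J => k ∘ σ = k).card := by
      refine Finset.card_bij' (fun σ _ => σ * τ⁻¹) (fun σ _ => σ * τ) ?_ ?_ (by simp) (by simp)
      · intro σ hσ
        simp only [Finset.mem_filter, Finset.mem_univ, true_and] at hσ ⊢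
        rw [Equiv.Perm.coe_mul, ← Function.comp_assoc, hσ]
        funext j
        simp
      · intro σ hσ
        simp only [Finset.mem_filter, Finset.mem_univ, true_and] at hσ ⊢
        rw [Equiv.Perm.coe_mul, ← Function.comp_assoc, hσ]
    rw [h2, h1]
    push_cast
    rfl
  · rw [integral_prod_mul_conj_prod_aux k l _ hk hl]
    have h0 : (Finset.univ.filter fun σ : Equiv.Perm J => k ∘ σ = l) = ∅ := by
      ext σ
      simpa using fun hσ => h ⟨σ, hσ⟩
    rw [h0, Finset.card_empty, Nat.cast_zero]
    by_contra hne
    have h1 := Finset.prod_ne_zero_iff.mp hne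
    refine h (exists_perm_of_multiplicity_eq k l fun i => ?_)
    by_cases hi : i ∈ Finset.univ.image k ∪ Finset.univ.image l
    · by_contra h2
      exact h1 i hi (if_neg h2)
    · have hik : ∀ j, k j ≠ i := fun j hj => hi (hj ▸ hk j)
      have hil : ∀ j, l j ≠ i := fun j hj => hi (hj ▸ hl j)
      simp [multiplicity, hik, hil]

/-! ### Random variables with moments of all orders -/

/-- `f` has moments of all orders. -/
def HasMoments {Ω : Type*} [MeasurableSpace Ω] (f : Ω → ℂ) (P : Measure Ω) : Prop :=
  ∀ p : ENNReal, p ≠ ⊤ → MemLp f p P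

namespace HasMoments

variable {Ω : Type*} [MeasurableSpace Ω] {P : Measure Ω} {f g : Ω → ℂ}

lemma const [IsFiniteMeasure P] (c : ℂ) : HasMoments (fun _ : Ω => c) P := fun _ _ => memLp_const c

lemma add (hf : HasMoments f P) (hg : HasMoments g P) : HasMoments (fun x => f x + g x) P :=
  fun p hp => (hf p hp).add (hg p hp)

lemma sub (hf : HasMoments f P) (hg : HasMoments g P) : HasMoments (fun x => f x - g x) P :=
  fun p hp => (hf p hp).sub (hg p hp)

/-- Hölder's inequality doubles the exponent, so only the class with moments of every order is
closed under products. -/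
lemma mul (hf : HasMoments f P) (hg : HasMoments g P) : HasMoments (fun x => f x * g x) P := by
  intro p hp
  have : ENNReal.HolderTriple (2 * p) (2 * p) p := ⟨by
    rw [ENNReal.mul_inv (by simp) (by simp), ← add_mul, ENNReal.inv_two_add_inv_two, one_mul]⟩
  have h2 : 2 * p ≠ ⊤ := ENNReal.mul_ne_top (by simp) hp
  exact (hg (2 * p) h2).mul (hf (2 * p) h2)

lemma star (hf : HasMoments f P) : HasMoments (fun x => conj (f x)) P := fun p hp =>
  (hf p hp).star

lemma prod [IsFiniteMeasure P] {J : Type*} (s : Finset J) {F : J → Ω → ℂ}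
    (hF : ∀ j, HasMoments (F j) P) : HasMoments (fun x => ∏ j ∈ s, F j x) P := by
  classical
  induction s using Finset.induction_on with
  | empty => simpa using const 1
  | insert a s ha ih => simpa [Finset.prod_insert ha] using (hF a).mul ih

lemma sum [IsFiniteMeasure P] {J : Type*} (s : Finset J) {F : J → Ω → ℂ}
    (hF : ∀ j, HasMoments (F j) P) : HasMoments (fun x => ∑ j ∈ s, F j x) P := by
  classical
  induction s using Finset.induction_on with
  | empty => simpa using const 0
  | insert a s ha ih => simpa [Finset.sum_insert ha] using (hF a).add ih

lemma integrable (hf : HasMoments f P) : Integrable f P := memLp_one_iff_integrable.mp (hf 1 (by simp))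

lemma integrable_norm_pow [IsFiniteMeasure P] (hf : HasMoments f P) (n : ℕ) :
    Integrable (fun x => ‖f x‖ ^ n) P := (hf n (by simp)).integrable_norm_pow'

lemma comp_measurePreserving {Ω' : Type*} [MeasurableSpace Ω'] {P' : Measure Ω'} {T : Ω' → Ω}
    (hf : HasMoments f P) (hT : MeasurePreserving T P' P) : HasMoments (fun x => f (T x)) P' :=
  fun p hp => (hf p hp).comp_measurePreserving hT

end HasMoments

lemma measurePreserving_eval_gaussianFamily {ι : Type*} (i : ι) :
    MeasurePreserving (fun Z : ι → ℂ => Z i) (gaussianFamily ι) stdComplexGaussian :=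
  measurePreserving_eval_infinitePi (fun _ : ι => stdComplexGaussian) i

lemma hasMoments_eval {ι : Type*} (i : ι) :
    HasMoments (fun Z : ι → ℂ => Z i) (gaussianFamily ι) :=
  HasMoments.comp_measurePreserving (f := fun z => z) (fun p hp => memLp_id_stdComplexGaussian p hp)
    (measurePreserving_eval_gaussianFamily i)

/-! ### Hypercontractivity for holomorphic polynomials -/

/-- Since `t` is injective, for fixed `σ` the relation `t a ∘ σ = t b` matches each `a` with at most
one `b` and conversely. By `2xy ≤ x² + y²` each of the `|J|!` permutations contributes at most `∑ c
a ^ 2`. -/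
lemma sum_sum_mul_card_le {J ι A : Type*} [Fintype J] [DecidableEq J] [DecidableEq ι] [Fintype A]
    (c : A → ℝ) (t : A → J → ι) (ht : Function.Injective t) :
    ∑ a, ∑ b, c a * c b *
        ((Finset.univ.filter fun σ : Equiv.Perm J => t a ∘ σ = t b).card : ℝ) ≤
      (Fintype.card J).factorial * ∑ a, c a ^ 2 := by
  have h1 : ∀ a b, c a * c b *
        ((Finset.univ.filter fun σ : Equiv.Perm J => t a ∘ σ = t b).card : ℝ) =
      ∑ σ : Equiv.Perm J, if t a ∘ σ = t b then c a * c b else 0 := by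
    intro a b
    rw [Finset.card_filter]
    push_cast
    rw [Finset.mul_sum]
    refine Finset.sum_congr rfl fun σ _ => ?_
    split_ifs <;> simp
  simp_rw [h1]
  have h2 : ∀ a, ∑ b, ∑ σ : Equiv.Perm J, (if t a ∘ σ = t b then c a * c b else 0) =
      ∑ σ : Equiv.Perm J, ∑ b, (if t a ∘ σ = t b then c a * c b else 0) :=
    fun a => Finset.sum_comm
  simp_rw [h2]
  rw [Finset.sum_comm]
  calc ∑ σ : Equiv.Perm J, ∑ a, ∑ b, (if t a ∘ σ = t b then c a * c b else 0)
      ≤ ∑ σ : Equiv.Perm J, ∑ a, c a ^ 2 := Finset.sum_le_sum fun σ _ => ?_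
    _ = _ := by
      rw [Finset.sum_const, Finset.card_univ, Fintype.card_perm, nsmul_eq_mul]
  have h3 : ∀ a b, (if t a ∘ σ = t b then c a * c b else 0) ≤
      2⁻¹ * (if t a ∘ σ = t b then c a ^ 2 else 0) +
        2⁻¹ * (if t a ∘ σ = t b then c b ^ 2 else 0) := by
    intro a b
    split_ifs
    · nlinarith [sq_nonneg (c a - c b)]
    · simp
  have hA : ∀ a, ∑ b, (if t a ∘ σ = t b then c a ^ 2 else 0) ≤ c a ^ 2 := by
    intro a
    by_cases h : ∃ b₀, t a ∘ σ = t b₀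
    · obtain ⟨b₀, hb₀⟩ := h
      rw [Finset.sum_eq_single b₀]
      · simp [hb₀]
      · intro b _ hb
        rw [if_neg]
        intro h
        exact hb (ht (h.symm.trans hb₀))
      · simp
    · rw [Finset.sum_eq_zero]
      · positivity
      · intro b _
        rw [if_neg fun hb => h ⟨b, hb⟩]
  have hB : ∀ b, ∑ a, (if t a ∘ σ = t b then c b ^ 2 else 0) ≤ c b ^ 2 := by
    intro b
    by_cases h : ∃ a₀, t a₀ ∘ σ = t b
    · obtain ⟨a₀, ha₀⟩ := h
      rw [Finset.sum_eq_single a₀]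
      · simp [ha₀]
      · intro a _ ha
        rw [if_neg]
        intro h
        refine ha (ht ?_)
        have := h.trans ha₀.symm
        funext j
        simpa using congrFun this (σ.symm j)
      · simp
    · rw [Finset.sum_eq_zero]
      · positivity
      · intro a _
        rw [if_neg fun ha => h ⟨a, ha⟩]
  calc ∑ a, ∑ b, (if t a ∘ σ = t b then c a * c b else 0)
      ≤ ∑ a, ∑ b, (2⁻¹ * (if t a ∘ σ = t b then c a ^ 2 else 0) +
        2⁻¹ * (if t a ∘ σ = t b then c b ^ 2 else 0)) :=
        Finset.sum_le_sum fun a _ => Finset.sum_le_sum fun b _ => h3 a b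
    _ = 2⁻¹ * ∑ a, ∑ b, (if t a ∘ σ = t b then c a ^ 2 else 0) +
        2⁻¹ * ∑ b, ∑ a, (if t a ∘ σ = t b then c b ^ 2 else 0) := by
      simp_rw [Finset.sum_add_distrib, ← Finset.mul_sum]
      congr 2
      exact Finset.sum_comm
    _ ≤ 2⁻¹ * ∑ a, c a ^ 2 + 2⁻¹ * ∑ b, c b ^ 2 := by
      gcongr with a _ b _
      · exact hA a
      · exact hB b
    _ = ∑ a, c a ^ 2 := by ring

lemma hasMoments_monomial {J ι : Type*} [Fintype J] (k : J → ι) :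
    HasMoments (fun Z : ι → ℂ => ∏ j, Z (k j)) (gaussianFamily ι) :=
  HasMoments.prod _ fun j => hasMoments_eval (k j)

lemma integral_norm_sq_holomorphic_le {J ι A : Type*} [Fintype J] [Fintype A]
    (c : A → ℂ) (t : A → J → ι) (ht : Function.Injective t) :
    ∫ Z, ‖∑ a, c a * ∏ j, Z (t a j)‖ ^ 2 ∂gaussianFamily ι ≤
      (Fintype.card J).factorial * ∑ a, ‖c a‖ ^ 2 := by
  classical
  have h1 : ∀ Z : ι → ℂ, ((‖∑ a, c a * ∏ j, Z (t a j)‖ ^ 2 : ℝ) : ℂ) =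
      ∑ a, ∑ b, c a * conj (c b) * ((∏ j, Z (t a j)) * conj (∏ j, Z (t b j))) := by
    intro Z
    rw [← Complex.normSq_eq_norm_sq, ← Complex.mul_conj, map_sum, Finset.sum_mul_sum]
    refine Finset.sum_congr rfl fun a _ => Finset.sum_congr rfl fun b _ => ?_
    rw [map_mul]
    ring
  have hint : ∀ a b, Integrable (fun Z : ι → ℂ =>
      c a * conj (c b) * ((∏ j, Z (t a j)) * conj (∏ j, Z (t b j)))) (gaussianFamily ι) :=
    fun a b => (((hasMoments_monomial (t a)).mul (hasMoments_monomial (t b)).star).integrable).const_mul _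
  have h2 : ((∫ Z, ‖∑ a, c a * ∏ j, Z (t a j)‖ ^ 2 ∂gaussianFamily ι : ℝ) : ℂ) =
      ∑ a, ∑ b, c a * conj (c b) *
        ((Finset.univ.filter fun σ : Equiv.Perm J => t a ∘ σ = t b).card : ℂ) := by
    rw [← integral_complex_ofReal]
    simp_rw [h1]
    rw [integral_finsetSum _ fun a _ => integrable_finsetSum _ fun b _ => hint a b]
    refine Finset.sum_congr rfl fun a _ => ?_
    rw [integral_finsetSum _ fun b _ => hint a b]
    refine Finset.sum_congr rfl fun b _ => ?_
    rw [integral_const_mul, integral_prod_mul_conj_prod]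
  refine le_trans ?_ (sum_sum_mul_card_le (fun a => ‖c a‖) t ht)
  calc _ ≤ ‖((∫ Z, ‖∑ a, c a * ∏ j, Z (t a j)‖ ^ 2 ∂gaussianFamily ι : ℝ) : ℂ)‖ := by
        rw [Complex.norm_real]
        exact le_abs_self _
    _ ≤ _ := by
      rw [h2]
      refine (norm_sum_le _ _).trans (Finset.sum_le_sum fun a _ =>
        (norm_sum_le _ _).trans (Finset.sum_le_sum fun b _ => le_of_eq ?_))
      simp

/-- Hypercontractivity for holomorphic homogeneous polynomials. -/
lemma integral_norm_pow_holomorphic_le {J ι A : Type*} [Fintype J] [Fintype A]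
    (c : A → ℂ) (t : A → J → ι) (ht : Function.Injective t) (m : ℕ) :
    ∫ Z, ‖∑ a, c a * ∏ j, Z (t a j)‖ ^ (2 * m) ∂gaussianFamily ι ≤
      (m * Fintype.card J).factorial * (∑ a, ‖c a‖ ^ 2) ^ m := by
  -- The `m`-th power is again holomorphic and homogeneous, of degree `m * |J|`, indexed by
  -- `m`-tuples, so its second moment is the `2m`-th moment sought.
  have h := integral_norm_sq_holomorphic_le (J := Fin m × J) (ι := ι) (A := Fin m → A)
    (fun p => ∏ i, c (p i)) (fun p ij => t (p ij.1) ij.2) (by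
      intro p q hpq
      funext i
      refine ht ?_
      funext j
      exact congrFun hpq (i, j))
  have h1 : ∀ Z : ι → ℂ, ∑ p : Fin m → A, (∏ i, c (p i)) * ∏ ij : Fin m × J, Z (t (p ij.1) ij.2) =
      (∑ a, c a * ∏ j, Z (t a j)) ^ m := by
    intro Z
    rw [Fintype.sum_pow]
    refine Finset.sum_congr rfl fun p _ => ?_
    rw [Finset.prod_mul_distrib, Fintype.prod_prod_type]
  have h2 : ∑ p : Fin m → A, ‖∏ i, c (p i)‖ ^ 2 = (∑ a, ‖c a‖ ^ 2) ^ m := by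
    rw [Fintype.sum_pow]
    refine Finset.sum_congr rfl fun p _ => ?_
    rw [norm_prod, Finset.prod_pow]
  simp only [h1, h2, norm_pow, Fintype.card_prod, Fintype.card_fin] at h
  simpa only [mul_comm 2 m, pow_mul] using h

/-! ### Rotating a pair of independent families -/

lemma map_sumElim_prod_gaussianFamily (ι : Type*) :
    ((gaussianFamily ι).prod (gaussianFamily ι)).map
      (fun p : (ι → ℂ) × (ι → ℂ) => (Sum.elim p.1 p.2 : ι ⊕ ι → ℂ)) = gaussianFamily (ι ⊕ ι) := by
  have hm : Measurable (fun p : (ι → ℂ) × (ι → ℂ) => (Sum.elim p.1 p.2 : ι ⊕ ι → ℂ)) := by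
    refine measurable_pi_lambda _ fun i => ?_
    cases i <;> simp only [Sum.elim_inl, Sum.elim_inr] <;> fun_prop
  refine Measure.eq_infinitePi _ fun s t ht => ?_
  rw [Measure.map_apply hm (.pi s.countable_toSet fun _ _ => ht _)]
  have h1 : (fun p : (ι → ℂ) × (ι → ℂ) => (Sum.elim p.1 p.2 : ι ⊕ ι → ℂ)) ⁻¹' (s : Set (ι ⊕ ι)).pi t =
      ((s.toLeft : Set ι).pi fun i => t (Sum.inl i)) ×ˢ
        ((s.toRight : Set ι).pi fun i => t (Sum.inr i)) := by
    ext p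
    simp [Set.mem_pi]
  rw [h1, Measure.prod_prod, gaussianFamily, Measure.infinitePi_pi _ (fun i _ => ht _),
    Measure.infinitePi_pi _ (fun i _ => ht _)]
  conv_rhs => rw [← Finset.toLeft_disjSum_toRight (u := s)]
  rw [Finset.prod_disjSum]

/-- The rotation acts on coordinate pairs, so a pair of families has to be read as a family of
pairs; the two laws are compared through `ι ⊕ ι`. -/
lemma map_sumElim_infinitePi_prod (ι : Type*) :
    (Measure.infinitePi (fun _ : ι => stdComplexGaussian.prod stdComplexGaussian)).map
      (fun q : ι → ℂ × ℂ => (Sum.elim (fun i => (q i).1) (fun i => (q i).2) : ι ⊕ ι → ℂ)) =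
      gaussianFamily (ι ⊕ ι) := by
  classical
  have hm : Measurable
      (fun q : ι → ℂ × ℂ => (Sum.elim (fun i => (q i).1) (fun i => (q i).2) : ι ⊕ ι → ℂ)) := by
    refine measurable_pi_lambda _ fun i => ?_
    cases i <;> simp only [Sum.elim_inl, Sum.elim_inr] <;> fun_prop
  refine Measure.eq_infinitePi _ fun s t ht => ?_
  rw [Measure.map_apply hm (.pi s.countable_toSet fun _ _ => ht _)]
  -- Filling with `Set.univ` off `s` lets a single finite index set serve both components.
  let u : ι → Set ℂ := fun i => if Sum.inl i ∈ s then t (Sum.inl i) else Set.univ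
  let v : ι → Set ℂ := fun i => if Sum.inr i ∈ s then t (Sum.inr i) else Set.univ
  have hu : ∀ i, MeasurableSet (u i) := fun i => by
    simp only [u]; split_ifs
    exacts [ht _, .univ]
  have hv : ∀ i, MeasurableSet (v i) := fun i => by
    simp only [v]; split_ifs
    exacts [ht _, .univ]
  have h1 : (fun q : ι → ℂ × ℂ =>
      (Sum.elim (fun i => (q i).1) (fun i => (q i).2) : ι ⊕ ι → ℂ)) ⁻¹' (s : Set (ι ⊕ ι)).pi t =
      ((s.toLeft ∪ s.toRight : Finset ι) : Set ι).pi fun i => u i ×ˢ v i := by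
    ext q
    simp only [Set.mem_preimage, Set.mem_pi, Finset.mem_coe, Sum.forall, Sum.elim_inl,
      Sum.elim_inr, Finset.mem_union, Finset.mem_toLeft, Finset.mem_toRight, Set.mem_prod, u, v]
    constructor
    · rintro ⟨h1, h2⟩ i -
      constructor <;> split_ifs with h <;> simp_all
    · intro h
      exact ⟨fun i hi => by simpa [hi] using (h i (Or.inl hi)).1,
        fun i hi => by simpa [hi] using (h i (Or.inr hi)).2⟩
  rw [h1, Measure.infinitePi_pi _ (fun i _ => (hu i).prod (hv i))]
  simp_rw [Measure.prod_prod]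
  rw [Finset.prod_mul_distrib]
  conv_rhs => rw [← Finset.toLeft_disjSum_toRight (u := s)]
  rw [Finset.prod_disjSum]
  congr 1
  · rw [← Finset.prod_subset (Finset.subset_union_left (s₁ := s.toLeft) (s₂ := s.toRight))]
    · exact Finset.prod_congr rfl fun i hi => by simp [u, Finset.mem_toLeft.mp hi]
    · intro i _ hi
      have : Sum.inl i ∉ s := by simpa using hi
      simp [u, this]
  · rw [← Finset.prod_subset (Finset.subset_union_right (s₁ := s.toLeft) (s₂ := s.toRight))]
    · exact Finset.prod_congr rfl fun i hi => by simp [v, Finset.mem_toRight.mp hi]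
    · intro i _ hi
      have : Sum.inr i ∉ s := by simpa using hi
      simp [v, this]

lemma map_unzip_infinitePi_prod (ι : Type*) :
    (Measure.infinitePi (fun _ : ι => stdComplexGaussian.prod stdComplexGaussian)).map
      (fun q : ι → ℂ × ℂ => ((fun i => (q i).1), (fun i => (q i).2))) =
      (gaussianFamily ι).prod (gaussianFamily ι) := by
  have hm : Measurable (fun p : (ι → ℂ) × (ι → ℂ) => (Sum.elim p.1 p.2 : ι ⊕ ι → ℂ)) := by
    refine measurable_pi_lambda _ fun i => ?_
    cases i <;> simp only [Sum.elim_inl, Sum.elim_inr] <;> fun_prop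
  have hm' : Measurable
      (fun q : ι → ℂ × ℂ => (Sum.elim (fun i => (q i).1) (fun i => (q i).2) : ι ⊕ ι → ℂ)) := by
    refine measurable_pi_lambda _ fun i => ?_
    cases i <;> simp only [Sum.elim_inl, Sum.elim_inr] <;> fun_prop
  have hu : Measurable (fun Z : ι ⊕ ι → ℂ => ((fun i => Z (Sum.inl i)), (fun i => Z (Sum.inr i)))) := by
    fun_prop
  have h := congrArg (Measure.map
    (fun Z : ι ⊕ ι → ℂ => ((fun i => Z (Sum.inl i)), (fun i => Z (Sum.inr i)))))
    ((map_sumElim_infinitePi_prod ι).trans (map_sumElim_prod_gaussianFamily ι).symm)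
  rw [Measure.map_map hu hm, Measure.map_map hu hm'] at h
  refine h.trans ?_
  convert! Measure.map_id

/-- The two families `(X + W) / √2` and `conj (X - W) / √2`. -/
def mixFamily {ι : Type*} (p : (ι → ℂ) × (ι → ℂ)) : ι ⊕ ι → ℂ :=
  Sum.elim (fun i => (mixPair (p.1 i, p.2 i)).1) (fun i => (mixPair (p.1 i, p.2 i)).2)

lemma measurePreserving_mixFamily (ι : Type*) :
    MeasurePreserving (mixFamily : (ι → ℂ) × (ι → ℂ) → ι ⊕ ι → ℂ)
      ((gaussianFamily ι).prod (gaussianFamily ι)) (gaussianFamily (ι ⊕ ι)) := by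
  have hp : Measurable mixPair := measurable_mixPair
  have hm : Measurable (mixFamily : (ι → ℂ) × (ι → ℂ) → ι ⊕ ι → ℂ) := by
    refine measurable_pi_lambda _ fun i => ?_
    cases i <;> simp only [mixFamily, Sum.elim_inl, Sum.elim_inr] <;> fun_prop
  have hm' : Measurable
      (fun q : ι → ℂ × ℂ => (Sum.elim (fun i => (q i).1) (fun i => (q i).2) : ι ⊕ ι → ℂ)) := by
    refine measurable_pi_lambda _ fun i => ?_
    cases i <;> simp only [Sum.elim_inl, Sum.elim_inr] <;> fun_prop
  refine ⟨hm, ?_⟩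
  rw [← map_unzip_infinitePi_prod, Measure.map_map hm (by fun_prop),
    ← map_sumElim_infinitePi_prod]
  conv_rhs => rw [← map_mixPair, ← Measure.infinitePi_map_pi _ (fun _ => hp)]
  rw [Measure.map_map hm' (by fun_prop)]
  rfl

/-! ### Wick monomials of degree four -/

/-- Quadruples of Fourier modes, the second and fourth of which are conjugated. -/
abbrev Quad : Type := (Lattice × Lattice) × (Lattice × Lattice)

/-- The Kronecker symbol. -/
def kron (k l : Lattice) : ℂ := if k = l then 1 else 0

/-- The Wick monomial `:X_{k₁} conj X_{k₂} X_{k₃} conj X_{k₄}:`. -/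
def wickMonomial (k : Quad) (X : Sample) : ℂ :=
  X k.1.1 * conj (X k.1.2) * (X k.2.1 * conj (X k.2.2))
    - kron k.1.1 k.1.2 * (X k.2.1 * conj (X k.2.2))
    - kron k.2.1 k.2.2 * (X k.1.1 * conj (X k.1.2))
    - kron k.1.1 k.2.2 * (X k.2.1 * conj (X k.1.2))
    - kron k.2.1 k.1.2 * (X k.1.1 * conj (X k.2.2))
    + kron k.1.1 k.1.2 * kron k.2.1 k.2.2 + kron k.1.1 k.2.2 * kron k.2.1 k.1.2

/-- The monomial in `X + W` and `conj (X - W)` of which the Wick monomial is the mean in `W`. -/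
def mixMonomial (k : Quad) (X W : Sample) : ℂ :=
  (X k.1.1 + W k.1.1) * conj (X k.1.2 - W k.1.2) *
    ((X k.2.1 + W k.2.1) * conj (X k.2.2 - W k.2.2))

lemma hasMoments_coord (k : Lattice) : HasMoments (fun X : Sample => X k) law := hasMoments_eval k

lemma integral_coord (a : Lattice) : ∫ W, W a ∂law = 0 := by
  rw [law_eq_gaussianFamily]
  simpa using integral_prod_mul_conj_prod_of_ne ![a] (![] : Fin 0 → Lattice) (by simp)

lemma integral_conj_coord (a : Lattice) : ∫ W, conj (W a) ∂law = 0 := by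
  rw [law_eq_gaussianFamily]
  simpa using integral_prod_mul_conj_prod_of_ne (![] : Fin 0 → Lattice) ![a] (by simp)

lemma integral_coord_mul (a b : Lattice) : ∫ W, W a * W b ∂law = 0 := by
  rw [law_eq_gaussianFamily]
  simpa using integral_prod_mul_conj_prod_of_ne ![a, b] (![] : Fin 0 → Lattice) (by simp)

lemma integral_conj_mul_conj (a b : Lattice) : ∫ W, conj (W a) * conj (W b) ∂law = 0 := by
  rw [law_eq_gaussianFamily]
  simpa using integral_prod_mul_conj_prod_of_ne (![] : Fin 0 → Lattice) ![a, b] (by simp)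

lemma integral_coord_mul_conj (a b : Lattice) : ∫ W, W a * conj (W b) ∂law = kron a b := by
  have h := integral_prod_mul_conj_prod ![a] ![b]
  simp only [Fin.prod_univ_one, Matrix.cons_val_zero] at h
  rw [law_eq_gaussianFamily, h, kron, Finset.card_filter, Finset.univ_unique, Finset.sum_singleton]
  by_cases hab : a = b
  · subst hab
    simp
  · rw [if_neg hab, if_neg]
    · simp
    · intro h
      exact hab (congrFun h 0)

lemma integral_cubic (a b c : Lattice) : ∫ W, W a * W b * conj (W c) ∂law = 0 := by
  rw [law_eq_gaussianFamily]
  simpa [Fin.prod_univ_succ] using integral_prod_mul_conj_prod_of_ne ![a, b] ![c] (by simp)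

lemma integral_cubic' (a b c : Lattice) : ∫ W, W a * (conj (W b) * conj (W c)) ∂law = 0 := by
  rw [law_eq_gaussianFamily]
  simpa [Fin.prod_univ_succ] using integral_prod_mul_conj_prod_of_ne ![a] ![b, c] (by simp)

lemma integral_quartic (a b c d : Lattice) :
    ∫ W, W a * W b * (conj (W c) * conj (W d)) ∂law =
      kron a c * kron b d + kron a d * kron b c := by
  have h := integral_prod_mul_conj_prod ![a, b] ![c, d]
  simp only [Fin.prod_univ_two, Matrix.cons_val_zero, Matrix.cons_val_one, map_mul] at h
  rw [law_eq_gaussianFamily, h, Finset.card_filter,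
    show (Finset.univ : Finset (Equiv.Perm (Fin 2))) = {1, Equiv.swap 0 1} by decide,
    Finset.sum_insert (by decide), Finset.sum_singleton]
  have h1 : ((![a, b] ∘ (1 : Equiv.Perm (Fin 2)) : Fin 2 → Lattice) = ![c, d]) ↔ a = c ∧ b = d := by
    simp [funext_iff, Fin.forall_fin_two]
  have h2 : ((![a, b] ∘ (Equiv.swap 0 1 : Equiv.Perm (Fin 2)) : Fin 2 → Lattice) = ![c, d]) ↔
      a = d ∧ b = c := by
    simp [funext_iff, Fin.forall_fin_two, and_comm]
  simp only [h1, h2, kron]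
  push_cast
  congr 1 <;> split_ifs <;> simp_all

-- A contraction of `W a` with `-conj (W b)` contributes `-kron a b`, which is the Wick subtraction;
-- the fourth moment gives the two double contractions with a plus sign, and all unbalanced moments
-- vanish.
set_option maxHeartbeats 1000000 in
lemma integral_mixMonomial (k : Quad) (X : Sample) :
    ∫ W, mixMonomial k X W ∂law = wickMonomial k X := by
  obtain ⟨⟨a, b⟩, c, d⟩ := k
  have ha := hasMoments_coord a
  have hb := (hasMoments_coord b).star
  have hc := hasMoments_coord c
  have hd := (hasMoments_coord d).star
  have h : ∀ W : Sample, mixMonomial ((a, b), c, d) X W =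
      X a * conj (X b) * (X c * conj (X d))
      + (conj (X b) * X c * conj (X d)) * W a
      - (X a * X c * conj (X d)) * conj (W b)
      + (X a * conj (X b) * conj (X d)) * W c
      - (X a * conj (X b) * X c) * conj (W d)
      - (X c * conj (X d)) * (W a * conj (W b))
      + (conj (X b) * conj (X d)) * (W a * W c)
      - (conj (X b) * X c) * (W a * conj (W d))
      - (X a * conj (X d)) * (W c * conj (W b))
      + (X a * X c) * (conj (W b) * conj (W d))
      - (X a * conj (X b)) * (W c * conj (W d))
      - conj (X d) * (W a * W c * conj (W b))
      + X c * (W a * (conj (W b) * conj (W d)))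
      - conj (X b) * (W a * W c * conj (W d))
      + X a * (W c * (conj (W b) * conj (W d)))
      + W a * W c * (conj (W b) * conj (W d)) := by
    intro W
    simp only [mixMonomial, map_sub]
    ring
  simp_rw [h]
  have I : ∀ {f : Sample → ℂ}, HasMoments f law → Integrable f law := fun h => h.integrable
  rw [integral_add, integral_add, integral_sub, integral_add, integral_sub, integral_sub,
    integral_add, integral_sub, integral_sub, integral_add, integral_sub, integral_sub,
    integral_add, integral_sub, integral_add]
  · simp only [integral_const_mul, integral_coord, integral_conj_coord, integral_coord_mul,
      integral_conj_mul_conj, integral_coord_mul_conj, integral_cubic, integral_cubic',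
      integral_quartic, integral_const, probReal_univ, wickMonomial, one_smul]
    ring
  all_goals
    refine I ?_
    with_reducible repeat' first
      | assumption
      | exact HasMoments.const _
      | apply HasMoments.add
      | apply HasMoments.sub
      | apply HasMoments.mul

lemma hasMoments_wickMonomial (k : Quad) : HasMoments (wickMonomial k) law := by
  have h1 := hasMoments_coord k.1.1
  have h2 := (hasMoments_coord k.1.2).star
  have h3 := hasMoments_coord k.2.1
  have h4 := (hasMoments_coord k.2.2).star
  unfold wickMonomial
  repeat' first
    | assumption
    | exact HasMoments.const _
    | apply HasMoments.add
    | apply HasMoments.sub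
    | apply HasMoments.mul

/-- The four factors of a quadruple, as an index of the mixed family. -/
def quadIndex (k : Quad) : Fin 4 → Lattice ⊕ Lattice :=
  ![Sum.inl k.1.1, Sum.inr k.1.2, Sum.inl k.2.1, Sum.inr k.2.2]

lemma quadIndex_injective : Function.Injective quadIndex := by
  rintro ⟨⟨a, b⟩, c, d⟩ ⟨⟨a', b'⟩, c', d'⟩ h
  have h0 := congrFun h 0
  have h1 := congrFun h 1
  have h2 := congrFun h 2
  have h3 := congrFun h 3
  simp only [quadIndex, Matrix.cons_val_zero, Matrix.cons_val_one, Matrix.cons_val,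
    Sum.inl.injEq, Sum.inr.injEq] at h0 h1 h2 h3
  rw [h0, h1, h2, h3]

lemma mixMonomial_eq (k : Quad) (p : Sample × Sample) :
    mixMonomial k p.1 p.2 = 4 * ∏ j, mixFamily p (quadIndex k j) := by
  have h2 : (√2 : ℂ) * √2 = 2 := by
    norm_cast
    exact Real.mul_self_sqrt (by norm_num)
  have h0 : (√2 : ℂ) ≠ 0 := by
    intro h
    simp [h] at h2
  have h3 : (√2 : ℂ)⁻¹ * (√2 : ℂ)⁻¹ = 2⁻¹ := by rw [← mul_inv, h2]
  simp only [Fin.prod_univ_four, mixFamily, quadIndex, mixPair, Matrix.cons_val_zero,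
    Matrix.cons_val_one, Matrix.cons_val, Sum.elim_inl, Sum.elim_inr, mixMonomial]
  linear_combination (-(4 * ((√2 : ℂ)⁻¹ * (√2 : ℂ)⁻¹ + 2⁻¹))) * ((p.1 k.1.1 + p.2 k.1.1) *
    conj (p.1 k.1.2 - p.2 k.1.2) * ((p.1 k.2.1 + p.2 k.2.1) * conj (p.1 k.2.2 - p.2 k.2.2))) * h3

lemma hasMoments_mixMonomial (k : Quad) :
    HasMoments (fun p : Sample × Sample => mixMonomial k p.1 p.2) (law.prod law) := by
  simp_rw [mixMonomial_eq]
  exact (HasMoments.const 4).mul ((hasMoments_monomial (quadIndex k)).comp_measurePreserving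
    (measurePreserving_mixFamily Lattice))

/-- In the normalized families this is a holomorphic polynomial of degree four; the four factors
`√2` give `4`, hence `16 ^ m`. -/
lemma integral_norm_pow_mixMonomial_le (s : Finset Quad) (c : Quad → ℂ) (m : ℕ) :
    ∫ p, ‖∑ k ∈ s, c k * mixMonomial k p.1 p.2‖ ^ (2 * m) ∂(law.prod law) ≤
      16 ^ m * (4 * m).factorial * (∑ k ∈ s, ‖c k‖ ^ 2) ^ m := by
  have h := integral_norm_pow_holomorphic_le (J := Fin 4) (A := s) (fun k => c k)
    (fun k => quadIndex k) (quadIndex_injective.comp Subtype.val_injective) m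
  rw [← (measurePreserving_mixFamily Lattice).map_eq, integral_map
    (measurePreserving_mixFamily Lattice).measurable.aemeasurable
    (Measurable.aestronglyMeasurable (by fun_prop))] at h
  have h1 : ∀ p : Sample × Sample, ‖∑ k ∈ s, c k * mixMonomial k p.1 p.2‖ ^ (2 * m) =
      16 ^ m * ‖∑ k : s, c k * ∏ j, mixFamily p (quadIndex k j)‖ ^ (2 * m) := by
    intro p
    rw [Finset.sum_coe_sort s (fun k => c k * ∏ j, mixFamily p (quadIndex k j))]
    have : ∑ k ∈ s, c k * mixMonomial k p.1 p.2 =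
        4 * ∑ k ∈ s, c k * ∏ j, mixFamily p (quadIndex k j) := by
      rw [Finset.mul_sum]
      exact Finset.sum_congr rfl fun k _ => by rw [mixMonomial_eq]; ring
    rw [this, norm_mul, mul_pow, pow_mul ‖(4 : ℂ)‖]
    norm_num
  simp_rw [h1]
  rw [integral_const_mul, mul_assoc]
  refine mul_le_mul_of_nonneg_left ?_ (by positivity)
  refine h.trans_eq ?_
  rw [Finset.sum_coe_sort s (fun k => ‖c k‖ ^ 2), Fintype.card_fin, mul_comm m 4]

/-- Hypercontractivity for Wick polynomials of degree four. -/
lemma integral_norm_pow_wickMonomial_le (s : Finset Quad) (c : Quad → ℂ) (m : ℕ) :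
    ∫ X, ‖∑ k ∈ s, c k * wickMonomial k X‖ ^ (2 * m) ∂law ≤
      16 ^ m * (4 * m).factorial * (∑ k ∈ s, ‖c k‖ ^ 2) ^ m := by
  refine le_trans ?_ (integral_norm_pow_mixMonomial_le s c m)
  have hmom : HasMoments (fun p : Sample × Sample => ∑ k ∈ s, c k * mixMonomial k p.1 p.2)
      (law.prod law) := HasMoments.sum s fun k => (HasMoments.const _).mul (hasMoments_mixMonomial k)
  have hint : Integrable (fun p : Sample × Sample =>
      ‖∑ k ∈ s, c k * mixMonomial k p.1 p.2‖ ^ (2 * m)) (law.prod law) :=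
    hmom.integrable_norm_pow (2 * m)
  rw [integral_prod _ hint]
  have hw : HasMoments (fun X : Sample => ∑ k ∈ s, c k * wickMonomial k X) law :=
    HasMoments.sum s fun k => (HasMoments.const _).mul (hasMoments_wickMonomial k)
  refine integral_mono_ae (hw.integrable_norm_pow (2 * m)) hint.integral_prod_left ?_
  filter_upwards [hint.prod_right_ae] with X hX
  have hI : ∀ k, Integrable (fun W => mixMonomial k X W) law := by
    intro k
    have h1 := hasMoments_coord k.1.1
    have h2 := (hasMoments_coord k.1.2).star
    have h3 := hasMoments_coord k.2.1
    have h4 := (hasMoments_coord k.2.2).star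
    refine HasMoments.integrable ?_
    simp only [mixMonomial, map_sub]
    repeat' first
      | assumption
      | exact HasMoments.const _
      | apply HasMoments.add
      | apply HasMoments.sub
      | apply HasMoments.mul
  have h1 : ∑ k ∈ s, c k * wickMonomial k X = ∫ W, ∑ k ∈ s, c k * mixMonomial k X W ∂law := by
    rw [integral_finsetSum _ fun k _ => (hI k).const_mul _]
    exact Finset.sum_congr rfl fun k _ => by rw [integral_const_mul, integral_mixMonomial]
  have hS : Integrable (fun W => ∑ k ∈ s, c k * mixMonomial k X W) law :=
    integrable_finsetSum _ fun k _ => (hI k).const_mul _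
  rw [h1]
  -- Jensen's inequality for the mean over `W`, for almost every `X`.
  calc ‖∫ W, ∑ k ∈ s, c k * mixMonomial k X W ∂law‖ ^ (2 * m)
      ≤ (∫ W, ‖∑ k ∈ s, c k * mixMonomial k X W‖ ∂law) ^ (2 * m) := by
        gcongr
        exact norm_integral_le_integral_norm _
    _ ≤ ∫ W, ‖∑ k ∈ s, c k * mixMonomial k X W‖ ^ (2 * m) ∂law :=
        (convexOn_pow (𝕜 := ℝ) (2 * m)).map_integral_le (continuous_pow _).continuousOn isClosed_Ici
          (ae_of_all _ fun W => norm_nonneg _) hS.norm hX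

/-! ### Square summable series of Wick monomials -/

/-- The Wick monomial as an element of `L²`. -/
def wickLp (k : Quad) : Lp ℂ 2 law := (hasMoments_wickMonomial k 2 (by simp)).toLp _

/-- The series `∑ₖ c k :X_{k₁} conj X_{k₂} X_{k₃} conj X_{k₄}:` in `L²`. -/
def wickSeries (c : Quad → ℂ) : Lp ℂ 2 law := ∑' k, c k • wickLp k

lemma coeFn_sum_wickLp (s : Finset Quad) (c : Quad → ℂ) :
    ⇑(∑ k ∈ s, c k • wickLp k) =ᵐ[law] fun X => ∑ k ∈ s, c k * wickMonomial k X := by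
  have h2 : ∀ᵐ X ∂law, ∀ k : Quad, (c k • wickLp k : Lp ℂ 2 law) X = c k * wickMonomial k X := by
    rw [ae_all_iff]
    intro k
    filter_upwards [Lp.coeFn_smul (c k) (wickLp k),
      (hasMoments_wickMonomial k 2 (by simp)).coeFn_toLp] with X h1 h2
    rw [h1, Pi.smul_apply, wickLp, h2, smul_eq_mul]
  filter_upwards [Lp.coeFn_finsetSum s (fun k => c k • wickLp k), h2] with X h1 h2
  rw [h1, Finset.sum_apply]
  exact Finset.sum_congr rfl fun k _ => h2 k

lemma norm_sq_Lp_two (f : Lp ℂ 2 law) : ‖f‖ ^ 2 = ∫ X, ‖f X‖ ^ 2 ∂law := by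
  have h := inner_self_eq_norm_sq_to_K (𝕜 := ℂ) f
  rw [L2.inner_def] at h
  have h1 : ∀ X, inner ℂ (f X) (f X) = ((‖f X‖ ^ 2 : ℝ) : ℂ) := fun X => by
    rw [inner_self_eq_norm_sq_to_K]
    norm_cast
  simp_rw [h1] at h
  rw [integral_complex_ofReal] at h
  apply Complex.ofReal_injective
  rw [h]
  simp

/-- The moment bound with `m = 1`: `384 = 16 * 4!`. -/
lemma norm_sq_sum_wickLp_le (s : Finset Quad) (c : Quad → ℂ) :
    ‖∑ k ∈ s, c k • wickLp k‖ ^ 2 ≤ 384 * ∑ k ∈ s, ‖c k‖ ^ 2 := by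
  rw [norm_sq_Lp_two, integral_congr_ae (g := fun X => ‖∑ k ∈ s, c k * wickMonomial k X‖ ^ 2)
    ((coeFn_sum_wickLp s c).mono fun X hX => by simp only [hX])]
  have h := integral_norm_pow_wickMonomial_le s c 1
  simp only [mul_one, pow_one] at h
  refine h.trans_eq ?_
  norm_num [Nat.factorial]

lemma summable_wickLp {c : Quad → ℂ} (hc : Summable fun k => ‖c k‖ ^ 2) :
    Summable fun k => c k • wickLp k := by
  rw [summable_iff_vanishing_norm]
  intro ε hε
  obtain ⟨s, hs⟩ := summable_iff_vanishing_norm.mp hc (ε ^ 2 / 384) (by positivity)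
  refine ⟨s, fun t ht => ?_⟩
  have h1 := hs t ht
  rw [Real.norm_of_nonneg (by positivity)] at h1
  have h2 := norm_sq_sum_wickLp_le t c
  refine lt_of_pow_lt_pow_left₀ 2 hε.le (h2.trans_lt ?_)
  rw [lt_div_iff₀ (by norm_num)] at h1
  linarith

lemma norm_sq_wickSeries_le {c : Quad → ℂ} (hc : Summable fun k => ‖c k‖ ^ 2) :
    ‖wickSeries c‖ ^ 2 ≤ 384 * ∑' k, ‖c k‖ ^ 2 := by
  have h1 := (summable_wickLp hc).hasSum
  refine le_of_tendsto (((continuous_norm.tendsto _).comp h1).pow 2) (Eventually.of_forall fun s => ?_)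
  refine (norm_sq_sum_wickLp_le s c).trans ?_
  gcongr
  exact hc.sum_le_tsum s fun k _ => by positivity

lemma summable_norm_sq_sub {c c' : Quad → ℂ} (hc : Summable fun k => ‖c k‖ ^ 2)
    (hc' : Summable fun k => ‖c' k‖ ^ 2) : Summable fun k => ‖c k - c' k‖ ^ 2 := by
  refine Summable.of_nonneg_of_le (fun k => by positivity) (fun k => ?_)
    ((hc.mul_left 2).add (hc'.mul_left 2))
  have := norm_sub_le (c k) (c' k)
  have h0 := norm_nonneg (c k - c' k)
  nlinarith [sq_nonneg (‖c k‖ - ‖c' k‖)]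

lemma wickSeries_sub {c c' : Quad → ℂ} (hc : Summable fun k => ‖c k‖ ^ 2)
    (hc' : Summable fun k => ‖c' k‖ ^ 2) :
    wickSeries (fun k => c k - c' k) = wickSeries c - wickSeries c' := by
  unfold wickSeries
  rw [← (summable_wickLp hc).tsum_sub (summable_wickLp hc')]
  simp_rw [sub_smul]

/-- Convergence in `L²` gives almost sure convergence along a sequence of partial sums. That is
enough to identify the limit pointwise and to apply Fatou's lemma. -/
lemma exists_seq_tendsto_wickSeries {c : Quad → ℂ} (hc : Summable fun k => ‖c k‖ ^ 2) :
    ∃ s : ℕ → Finset Quad, Tendsto s atTop atTop ∧ ∀ᵐ X ∂law,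
      Tendsto (fun n => ∑ k ∈ s n, c k * wickMonomial k X) atTop (𝓝 (wickSeries c X)) := by
  have h : Tendsto (fun s : Finset Quad => ∑ k ∈ s, c k • wickLp k) atTop (𝓝 (wickSeries c)) :=
    (summable_wickLp hc).hasSum
  obtain ⟨s, hs, hX⟩ := (tendstoInMeasure_of_tendsto_Lp h).exists_seq_tendsto_ae'
  refine ⟨s, hs, ?_⟩
  filter_upwards [hX, ae_all_iff.mpr fun n => coeFn_sum_wickLp (s n) c] with X h1 h2
  exact h1.congr h2

lemma wickSeries_ae_eq_of_hasSum {c : Quad → ℂ} (hc : Summable fun k => ‖c k‖ ^ 2)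
    {g : Sample → ℂ} (hg : ∀ᵐ X ∂law, HasSum (fun k => c k * wickMonomial k X) (g X)) :
    wickSeries c =ᵐ[law] g := by
  obtain ⟨s, hs, h⟩ := exists_seq_tendsto_wickSeries hc
  filter_upwards [h, hg] with X h1 h2
  exact tendsto_nhds_unique h1 (h2.comp hs)

lemma lintegral_wickSeries_le {c : Quad → ℂ} (hc : Summable fun k => ‖c k‖ ^ 2) (m : ℕ) :
    ∫⁻ X, ‖wickSeries c X‖ₑ ^ (2 * m) ∂law ≤
      ENNReal.ofReal (16 ^ m * (4 * m).factorial * (∑' k, ‖c k‖ ^ 2) ^ m) := by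
  obtain ⟨s, hs, h⟩ := exists_seq_tendsto_wickSeries hc
  have hmom : ∀ n, HasMoments (fun X => ∑ k ∈ s n, c k * wickMonomial k X) law := fun n =>
    HasMoments.sum _ fun k => (HasMoments.const _).mul (hasMoments_wickMonomial k)
  calc ∫⁻ X, ‖wickSeries c X‖ₑ ^ (2 * m) ∂law
      = ∫⁻ X, liminf (fun n => ‖∑ k ∈ s n, c k * wickMonomial k X‖ₑ ^ (2 * m)) atTop ∂law := by
        refine lintegral_congr_ae (h.mono fun X hX => ?_)
        exact (((ENNReal.continuous_pow (2 * m)).tendsto _).comp hX.enorm).liminf_eq.symm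
    _ ≤ liminf (fun n => ∫⁻ X, ‖∑ k ∈ s n, c k * wickMonomial k X‖ₑ ^ (2 * m) ∂law) atTop :=
        lintegral_liminf_le' fun n => ((hmom n).integrable.1.enorm).pow_const _
    _ ≤ _ := by
      refine liminf_le_of_le ⟨0, by simp⟩ fun b hb => ?_
      obtain ⟨n, hn⟩ := hb.exists
      refine hn.trans ?_
      have h1 : ∀ X, ‖∑ k ∈ s n, c k * wickMonomial k X‖ₑ ^ (2 * m) =
          ENNReal.ofReal (‖∑ k ∈ s n, c k * wickMonomial k X‖ ^ (2 * m)) := fun X => by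
        rw [ENNReal.ofReal_pow (norm_nonneg _), ofReal_norm]
      simp_rw [h1]
      rw [← ofReal_integral_eq_lintegral_ofReal ((hmom n).integrable_norm_pow _)
        (ae_of_all _ fun X => by positivity)]
      refine ENNReal.ofReal_le_ofReal ((integral_norm_pow_wickMonomial_le _ _ _).trans ?_)
      gcongr
      exact hc.sum_le_tsum _ fun k _ => by positivity

/-- Markov's inequality for the moment of order `2m`; `m` is left free and is optimized in
`exists_tail_bound`. -/
lemma measure_one_le_norm_wickSeries_le {c : Quad → ℂ} (hc : Summable fun k => ‖c k‖ ^ 2)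
    (m : ℕ) : law.real {X | 1 ≤ ‖wickSeries c X‖} ≤
      16 ^ m * (4 * m).factorial * (∑' k, ‖c k‖ ^ 2) ^ m := by
  have h0 : (0 : ℝ) ≤ 16 ^ m * (4 * m).factorial * (∑' k, ‖c k‖ ^ 2) ^ m := by
    have : 0 ≤ ∑' k, ‖c k‖ ^ 2 := tsum_nonneg fun k => by positivity
    positivity
  refine ENNReal.toReal_le_of_le_ofReal h0 (le_trans ?_ (lintegral_wickSeries_le hc m))
  have h := mul_meas_ge_le_lintegral₀ (μ := law) (f := fun X => ‖wickSeries c X‖ₑ ^ (2 * m))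
    ((Lp.aestronglyMeasurable _).enorm.pow_const _) 1
  rw [one_mul] at h
  refine le_trans (measure_mono fun X hX => ?_) h
  have h1 : (1 : ENNReal) ≤ ‖wickSeries c X‖ₑ := by
    rw [← ofReal_norm, ENNReal.one_le_ofReal]
    exact hX
  exact one_le_pow₀ h1

/-! ### Integrals of series -/

lemma ae_summable_norm_of_summable_integral {α ι : Type*} [MeasurableSpace α] {μ : Measure α}
    [Countable ι] {F : ι → α → ℂ} (hF : ∀ i, Integrable (F i) μ)
    (hs : Summable fun i => ∫ a, ‖F i a‖ ∂μ) : ∀ᵐ a ∂μ, Summable fun i => ‖F i a‖ := by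
  have h1 : ∫⁻ a, ∑' i, ‖F i a‖ₑ ∂μ ≠ ⊤ := by
    rw [lintegral_tsum fun i => (hF i).1.enorm]
    have h2 : ∀ i, ∫⁻ a, ‖F i a‖ₑ ∂μ = ENNReal.ofReal (∫ a, ‖F i a‖ ∂μ) := fun i =>
      (ofReal_integral_norm_eq_lintegral_enorm (hF i)).symm
    simp_rw [h2]
    exact hs.tsum_ofReal_ne_top
  filter_upwards [ae_lt_top' (AEMeasurable.tsum fun i => (hF i).1.enorm) h1] with a ha
  have h3 : ∀ i, ‖F i a‖ₑ = ENNReal.ofNNReal ‖F i a‖₊ := fun i => rfl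
  simp_rw [h3] at ha
  exact NNReal.summable_coe.mpr (ENNReal.tsum_coe_ne_top_iff_summable.mp ha.ne)

lemma integrable_tsum_of_summable_integral {α ι : Type*} [MeasurableSpace α] {μ : Measure α}
    [Countable ι] {F : ι → α → ℂ} (hF : ∀ i, Integrable (F i) μ)
    (hs : Summable fun i => ∫ a, ‖F i a‖ ∂μ) : Integrable (fun a => ∑' i, F i a) μ := by
  have hae := ae_summable_norm_of_summable_integral hF hs
  obtain ⟨s, hs'⟩ := exists_seq_tendsto (atTop : Filter (Finset ι))
  refine ⟨aestronglyMeasurable_of_tendsto_ae (atTop : Filter ℕ)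
    (f := fun n a => ∑ i ∈ s n, F i a)
    (fun n => (integrable_finsetSum _ fun i _ => hF i).1) ?_, ?_⟩
  · filter_upwards [hae] with a ha
    exact ha.of_norm.hasSum.comp hs'
  · refine (lintegral_mono_ae (g := fun a => ∑' i, ‖F i a‖ₑ) ?_).trans_lt ?_
    · filter_upwards [hae] with a ha
      exact enorm_tsum_le_tsum_enorm
    · rw [lintegral_tsum fun i => (hF i).1.enorm]
      have h2 : ∀ i, ∫⁻ a, ‖F i a‖ₑ ∂μ = ENNReal.ofReal (∫ a, ‖F i a‖ ∂μ) := fun i =>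
        (ofReal_integral_norm_eq_lintegral_enorm (hF i)).symm
      simp_rw [h2]
      exact hs.tsum_ofReal_lt_top

/-- Integration of an absolutely convergent series of bounded functions against an integrable
weight. -/
lemma integral_mul_tsum {α ι : Type*} [MeasurableSpace α] {μ : Measure α} [Countable ι]
    {h : α → ℂ} (hh : Integrable h μ) {C : ι → ℂ} (hC : Summable fun i => ‖C i‖) {g : ι → α → ℂ}
    (hg : ∀ i, AEStronglyMeasurable (g i) μ) (hg1 : ∀ i a, ‖g i a‖ ≤ 1) :
    Integrable (fun a => h a * ∑' i, C i * g i a) μ ∧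
      ∫ a, h a * ∑' i, C i * g i a ∂μ = ∑' i, C i * ∫ a, h a * g i a ∂μ := by
  have h1 : ∀ i, Integrable (fun a => h a * g i a) μ := fun i =>
    hh.mul_bdd (c := 1) (hg i) (ae_of_all _ (hg1 i))
  have h2 : ∀ i, Integrable (fun a => C i * (h a * g i a)) μ := fun i => (h1 i).const_mul _
  have h3 : Summable fun i => ∫ a, ‖C i * (h a * g i a)‖ ∂μ := by
    refine Summable.of_nonneg_of_le (fun i => integral_nonneg fun a => norm_nonneg _) (fun i => ?_)
      (hC.mul_right (∫ a, ‖h a‖ ∂μ))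
    simp_rw [norm_mul]
    rw [integral_const_mul]
    refine mul_le_mul_of_nonneg_left ?_ (norm_nonneg _)
    refine integral_mono (by simpa using (h1 i).norm) hh.norm fun a => ?_
    exact mul_le_of_le_one_right (norm_nonneg _) (hg1 i a)
  have h4 : ∀ a, h a * ∑' i, C i * g i a = ∑' i, C i * (h a * g i a) := fun a => by
    rw [← tsum_mul_left]
    exact tsum_congr fun i => by ring
  simp_rw [h4]
  refine ⟨integrable_tsum_of_summable_integral h2 h3, ?_⟩
  rw [← integral_tsum_of_summable_integral_norm h2 h3]
  exact tsum_congr fun i => integral_const_mul _ _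

/-! ### Fourier analysis on the torus -/

lemma toPlane_neg (k : Lattice) : toPlane (-k) = -toPlane k := by
  ext i; simp [toPlane]

lemma toPlane_zero : toPlane 0 = 0 := by
  ext i; simp [toPlane]

lemma eigenfunction_eq (k : Lattice) (x : Plane) :
    eigenfunction k x = Complex.exp (2 * Real.pi * Complex.I * (k 0 * x 0 + k 1 * x 1)) := by
  unfold eigenfunction
  congr 2
  simp [toPlane, PiLp.inner_apply, Fin.sum_univ_two, mul_comm]

lemma eigenfunction_add_left (k l : Lattice) (x : Plane) :
    eigenfunction (k + l) x = eigenfunction k x * eigenfunction l x := by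
  rw [eigenfunction_eq, eigenfunction_eq, eigenfunction_eq, ← Complex.exp_add]
  congr 1
  simp
  ring

lemma conj_eigenfunction (k : Lattice) (x : Plane) :
    conj (eigenfunction k x) = eigenfunction (-k) x := by
  rw [eigenfunction_eq, eigenfunction_eq, ← Complex.exp_conj]
  congr 1
  simp [map_ofNat]
  ring

lemma eigenfunction_sub_left (k l : Lattice) (x : Plane) :
    eigenfunction (k - l) x = eigenfunction k x * conj (eigenfunction l x) := by
  rw [sub_eq_add_neg, eigenfunction_add_left, conj_eigenfunction]

lemma eigenfunction_add_right (k : Lattice) (x y : Plane) :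
    eigenfunction k (x + y) = eigenfunction k x * eigenfunction k y := by
  rw [eigenfunction_eq, eigenfunction_eq, eigenfunction_eq, ← Complex.exp_add]
  congr 1
  simp
  ring

lemma eigenfunction_toPlane (k n : Lattice) : eigenfunction k (toPlane n) = 1 := by
  rw [eigenfunction_eq, Complex.exp_eq_one_iff]
  refine ⟨k 0 * n 0 + k 1 * n 1, ?_⟩
  simp [toPlane]
  ring

lemma norm_eigenfunction (k : Lattice) (x : Plane) : ‖eigenfunction k x‖ = 1 := by
  rw [eigenfunction_eq, Complex.norm_exp]
  simp

lemma eigenfunction_zero (x : Plane) : eigenfunction 0 x = 1 := by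
  rw [eigenfunction_eq]; simp

lemma continuous_eigenfunction (k : Lattice) : Continuous (eigenfunction k) := by
  unfold eigenfunction
  fun_prop

lemma measurableSet_torus : MeasurableSet torus := by
  have : torus = ⋂ i : Fin 2, (fun x : Plane => x i) ⁻¹' Set.Ico (-(1 / 2) : ℝ) (1 / 2) := by
    ext x; simp [torus]
  rw [this]
  exact MeasurableSet.iInter fun i =>
    (EuclideanSpace.proj (𝕜 := ℝ) i).continuous.measurable measurableSet_Ico

lemma integral_torus_prod (f : Fin 2 → ℝ → ℂ) :
    ∫ x in torus, ∏ i, f i (x i) = ∏ i, ∫ t in Set.Ico (-(1 / 2) : ℝ) (1 / 2), f i t := by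
  have h := (PiLp.volume_preserving_toLp (Fin 2)).setIntegral_preimage_emb
    (MeasurableEquiv.toLp 2 (Fin 2 → ℝ)).measurableEmbedding
    (fun x : Plane => ∏ i, f i (x i)) torus
  rw [← h]
  have h1 : (WithLp.toLp 2 ⁻¹' torus : Set (Fin 2 → ℝ)) =
      Set.univ.pi fun _ => Set.Ico (-(1 / 2) : ℝ) (1 / 2) := by
    ext x; simp [torus, Set.mem_pi]
  rw [h1, volume_pi, Measure.restrict_pi_pi]
  exact integral_fintype_prod_eq_prod (μ := fun _ : Fin 2 =>
    volume.restrict (Set.Ico (-(1 / 2) : ℝ) (1 / 2))) f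

lemma integral_exp_unit_interval (n : ℤ) :
    ∫ t in Set.Ico (-(1 / 2) : ℝ) (1 / 2), Complex.exp (2 * Real.pi * Complex.I * n * t) =
      if n = 0 then 1 else 0 := by
  rw [integral_Ico_eq_integral_Ioc, ← intervalIntegral.integral_of_le (by norm_num)]
  split_ifs with hn
  · subst hn
    simp
    norm_num
  · have hc : (2 * Real.pi * Complex.I * n : ℂ) ≠ 0 := by
      have : (n : ℂ) ≠ 0 := by exact_mod_cast hn
      exact mul_ne_zero Complex.two_pi_I_ne_zero this
    rw [integral_exp_mul_complex hc]
    have : Complex.exp (2 * Real.pi * Complex.I * n * ((1 / 2 : ℝ) : ℂ)) =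
        Complex.exp (2 * Real.pi * Complex.I * n * ((-(1 / 2) : ℝ) : ℂ)) := by
      rw [Complex.exp_eq_exp_iff_exists_int]
      refine ⟨n, ?_⟩
      push_cast
      ring
    rw [this, sub_self, zero_div]

lemma integral_torus_eigenfunction (k : Lattice) :
    ∫ x in torus, eigenfunction k x = if k = 0 then 1 else 0 := by
  have h := integral_torus_prod fun i t => Complex.exp (2 * Real.pi * Complex.I * (k i) * t)
  simp_rw [integral_exp_unit_interval, Fin.prod_univ_two] at h
  have h1 : ∀ x : Plane, eigenfunction k x =
      Complex.exp (2 * Real.pi * Complex.I * (k 0) * (x 0)) *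
        Complex.exp (2 * Real.pi * Complex.I * (k 1) * (x 1)) := fun x => by
    rw [eigenfunction_eq, ← Complex.exp_add]
    congr 1
    ring
  simp_rw [h1]
  rw [h]
  have h2 : k = 0 ↔ k 0 = 0 ∧ k 1 = 0 := by
    simp [funext_iff, Fin.forall_fin_two]
  rw [if_congr h2 rfl rfl]
  by_cases h3 : k 0 = 0 <;> by_cases h4 : k 1 = 0 <;> simp [h3, h4]

lemma volume_torus : volume torus = 1 := by
  rw [← (PiLp.volume_preserving_toLp (Fin 2)).measure_preimage
    measurableSet_torus.nullMeasurableSet]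
  have h1 : (WithLp.toLp 2 ⁻¹' torus : Set (Fin 2 → ℝ)) =
      Set.univ.pi fun _ => Set.Ico (-(1 / 2) : ℝ) (1 / 2) := by
    ext x; simp [torus, Set.mem_pi]
  rw [h1, Real.volume_pi_Ico]
  norm_num

instance : IsFiniteMeasure (volume.restrict torus) :=
  ⟨by rw [Measure.restrict_apply_univ, volume_torus]; exact ENNReal.one_lt_top⟩

/-! ### Unfolding -/

/-- The translates of the torus by lattice points. -/
def torusTranslate (n : Lattice) : Set Plane := (fun x => x + toPlane (-n)) ⁻¹' torus

lemma iUnion_torusTranslate : ⋃ n, torusTranslate n = Set.univ := by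
  refine Set.eq_univ_of_forall fun x => Set.mem_iUnion.mpr ⟨fun i => ⌊x i + 1 / 2⌋, fun i => ?_⟩
  have h1 := Int.floor_le (x i + 1 / 2)
  have h2 := Int.lt_floor_add_one (x i + 1 / 2)
  simp only [toPlane, PiLp.add_apply, Pi.neg_apply, Int.cast_neg, Set.mem_Ico]
  constructor <;> linarith

lemma pairwise_disjoint_torusTranslate : Pairwise (Function.onFun Disjoint torusTranslate) := by
  intro n m hnm
  rw [Function.onFun, Set.disjoint_left]
  intro x hx hy
  apply hnm
  funext i
  have h1 := hx i
  have h2 := hy i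
  simp only [toPlane, PiLp.add_apply, Pi.neg_apply, Int.cast_neg, Set.mem_Ico] at h1 h2
  have h3 : ((n i - m i : ℤ) : ℝ) < 1 := by push_cast; linarith
  have h4 : (-1 : ℝ) < ((n i - m i : ℤ) : ℝ) := by push_cast; linarith
  have h5 : n i - m i < 1 := by exact_mod_cast h3
  have h6 : -1 < n i - m i := by exact_mod_cast h4
  omega

lemma setIntegral_torusTranslate {E : Type*} [NormedAddCommGroup E] [NormedSpace ℝ E]
    (F : Plane → E) (n : Lattice) :
    ∫ y in torusTranslate n, F y = ∫ y in torus, F (y + toPlane n) := by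
  have h := (measurePreserving_add_right volume (toPlane (-n))).setIntegral_preimage_emb
    (measurableEmbedding_addRight _) (fun y => F (y + toPlane n)) torus
  rw [← h]
  refine integral_congr_ae (ae_of_all _ fun y => ?_)
  simp [toPlane_neg]

/-- The lattice translates of the half-open torus tile the plane. -/
lemma hasSum_integral_torus {E : Type*} [NormedAddCommGroup E] [NormedSpace ℝ E]
    {F : Plane → E} (hF : Integrable F) :
    HasSum (fun n => ∫ y in torus, F (y + toPlane n)) (∫ y, F y) := by
  have h := hasSum_integral_iUnion (f := F) (μ := volume)
    (fun n => (measurable_add_const (toPlane (-n))) measurableSet_torus)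
    pairwise_disjoint_torusTranslate hF.integrableOn
  change HasSum (fun n => ∫ y in torusTranslate n, F y) (∫ y in ⋃ n, torusTranslate n, F y) at h
  rw [iUnion_torusTranslate, setIntegral_univ] at h
  simpa only [setIntegral_torusTranslate] using h

lemma integral_torus_tsum {F : Plane → ℂ} (hF : Integrable F) :
    IntegrableOn (fun y => ∑' n, F (y + toPlane n)) torus ∧
      ∫ y in torus, ∑' n, F (y + toPlane n) = ∫ y, F y := by
  have h1 : ∀ n, IntegrableOn (fun y => F (y + toPlane n)) torus := fun n =>
    (hF.comp_add_right _).integrableOn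
  have h2 : Summable fun n => ∫ y in torus, ‖F (y + toPlane n)‖ :=
    (hasSum_integral_torus hF.norm).summable
  refine ⟨integrable_tsum_of_summable_integral h1 h2, ?_⟩
  rw [← integral_tsum_of_summable_integral_norm h1 h2]
  exact (hasSum_integral_torus hF).tsum_eq

/-! ### The rescaled potential -/

lemma IsPotential.integrable {v : Plane → ℝ} (hv : IsPotential v) : Integrable v :=
  hv.smooth.continuous.integrable_of_hasCompactSupport hv.compactSupport

lemma IsPotential.integrable_rescale {v : Plane → ℝ} (hv : IsPotential v) {ε : ℝ} (hε : 0 < ε)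
    (x : Plane) (k : Lattice) : Integrable (fun y : Plane =>
      ((((ε ^ 2)⁻¹ * v (ε⁻¹ • (x - y)) : ℝ) : ℂ) * eigenfunction k y)) := by
  have h1 : Integrable (fun y : Plane => v (ε⁻¹ • (x - y))) := by
    have h2 : Integrable (fun y : Plane => v (ε⁻¹ • y)) :=
      (integrable_comp_smul_iff volume v (inv_ne_zero hε.ne')).mpr hv.integrable
    exact h2.comp_sub_left x
  exact ((h1.const_mul _).ofReal (𝕜 := ℂ)).mul_bdd (c := 1) (continuous_eigenfunction k).aestronglyMeasurable
    (ae_of_all _ fun y => (norm_eigenfunction k y).le)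

lemma rescaled_sub_mul_eigenfunction (v : Plane → ℝ) (ε : ℝ) (x y : Plane) (k : Lattice) :
    (rescaled v ε (x - y) : ℂ) * eigenfunction k y =
      ∑' n, (((ε ^ 2)⁻¹ * v (ε⁻¹ • (x - (y + toPlane n))) : ℝ) : ℂ) *
        eigenfunction k (y + toPlane n) := by
  simp_rw [eigenfunction_add_right, eigenfunction_toPlane, mul_one]
  rw [tsum_mul_right, rescaled, Complex.ofReal_tsum]
  simp_rw [sub_sub]

lemma integrableOn_rescaled {v : Plane → ℝ} (hv : IsPotential v) {ε : ℝ} (hε : 0 < ε)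
    (x : Plane) : IntegrableOn (fun y => (rescaled v ε (x - y) : ℂ)) torus := by
  refine (integral_torus_tsum (hv.integrable_rescale hε x 0)).1.congr (ae_of_all _ fun y => ?_)
  simp only
  rw [← rescaled_sub_mul_eigenfunction, eigenfunction_zero, mul_one]

/-- Eigenfunctions are periodic, so the periodized convolution unfolds to an integral over the
plane. The substitution `y = x - ε w` has Jacobian `ε²`, which cancels the prefactor of `v^ε`. -/
lemma integral_rescaled_mul_eigenfunction {v : Plane → ℝ} (hv : IsPotential v) {ε : ℝ}
    (hε : 0 < ε) (x : Plane) (k : Lattice) :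
    ∫ y in torus, (rescaled v ε (x - y) : ℂ) * eigenfunction k y =
      eigenfunction k x * 𝓕 (fun x => (v x : ℂ)) (ε • toPlane k) := by
  simp_rw [rescaled_sub_mul_eigenfunction]
  rw [(integral_torus_tsum (hv.integrable_rescale hε x k)).2]
  have h1 : ∀ y : Plane, (((ε ^ 2)⁻¹ * v (ε⁻¹ • (x - y)) : ℝ) : ℂ) * eigenfunction k y =
      (fun z : Plane => (((ε ^ 2)⁻¹ * v (ε⁻¹ • z) : ℝ) : ℂ) * eigenfunction k (x - z)) (x - y) := by
    intro y
    simp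
  have h2 : ∀ z : Plane, (((ε ^ 2)⁻¹ * v (ε⁻¹ • z) : ℝ) : ℂ) * eigenfunction k (x - z) =
      (fun w : Plane => (((ε ^ 2)⁻¹ * v w : ℝ) : ℂ) * eigenfunction k (x - ε • w)) (ε⁻¹ • z) := by
    intro z
    simp only
    rw [smul_inv_smul₀ hε.ne']
  simp_rw [h1]
  rw [integral_sub_left_eq_self (fun z : Plane =>
    (((ε ^ 2)⁻¹ * v (ε⁻¹ • z) : ℝ) : ℂ) * eigenfunction k (x - z)) volume x]
  simp_rw [h2]
  rw [Measure.integral_comp_inv_smul volume (fun w : Plane =>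
    (((ε ^ 2)⁻¹ * v w : ℝ) : ℂ) * eigenfunction k (x - ε • w)) ε, Real.fourier_eq',
    ← integral_const_mul, ← integral_smul]
  refine integral_congr_ae (ae_of_all _ fun w => ?_)
  have h3 : eigenfunction k (x - ε • w) = eigenfunction k x *
      Complex.exp (((-2 * Real.pi * inner ℝ w (ε • toPlane k) : ℝ) : ℂ) * Complex.I) := by
    rw [sub_eq_add_neg, eigenfunction_add_right]
    congr 1
    unfold eigenfunction
    congr 1
    rw [inner_neg_right, inner_smul_right, inner_smul_right, real_inner_comm]
    push_cast
    ring
  simp only [finrank_euclideanSpace_fin]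
  rw [h3, abs_of_pos (by positivity), Complex.real_smul, smul_eq_mul]
  have : (ε : ℂ) ≠ 0 := by exact_mod_cast hε.ne'
  push_cast
  field_simp

/-- The Fourier multiplier of convolution with the rescaled potential. -/
def multiplier (v : Plane → ℝ) (ε : ℝ) (k : Lattice) : ℝ :=
  (𝓕 (fun x => (v x : ℂ)) (ε • toPlane k)).re

lemma IsPotential.multiplier_nonneg {v : Plane → ℝ} (hv : IsPotential v) (ε : ℝ) (k : Lattice) :
    0 ≤ multiplier v ε k := by
  obtain ⟨r, hr, h⟩ := hv.positiveType (ε • toPlane k)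
  simpa [multiplier, h] using hr

lemma IsPotential.ofReal_multiplier {v : Plane → ℝ} (hv : IsPotential v) (ε : ℝ) (k : Lattice) :
    (multiplier v ε k : ℂ) = 𝓕 (fun x => (v x : ℂ)) (ε • toPlane k) := by
  obtain ⟨r, hr, h⟩ := hv.positiveType (ε • toPlane k)
  simp [multiplier, h]

lemma IsPotential.multiplier_zero {v : Plane → ℝ} (hv : IsPotential v) (ε : ℝ) :
    multiplier v ε 0 = 1 := by
  rw [multiplier, toPlane_zero, smul_zero, Real.fourier_eq']
  simp [integral_complex_ofReal, hv.integral_eq_one]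

/-- The bound does not involve `ε`: this is the source of the uniformity of the tail estimate. -/
lemma multiplier_le (v : Plane → ℝ) (ε : ℝ) (k : Lattice) : multiplier v ε k ≤ ∫ x, |v x| := by
  refine (Complex.re_le_norm _).trans ?_
  rw [Real.fourier_eq']
  refine (norm_integral_le_integral_norm _).trans_eq ?_
  refine integral_congr_ae (ae_of_all _ fun x => ?_)
  simp only
  rw [norm_smul, Complex.norm_exp_ofReal_mul_I, one_mul, Complex.norm_real, Real.norm_eq_abs]

/-! ### Wick ordering of four factors -/

lemma filter_involutive_perm_four :
    (Finset.univ.filter fun σ : Equiv.Perm (Fin 4) => σ * σ = 1) =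
      {1, Equiv.swap 0 1, Equiv.swap 0 2, Equiv.swap 0 3, Equiv.swap 1 2, Equiv.swap 1 3,
        Equiv.swap 2 3, Equiv.swap 0 1 * Equiv.swap 2 3, Equiv.swap 0 2 * Equiv.swap 1 3,
        Equiv.swap 0 3 * Equiv.swap 1 2} := by
  decide

/-- Ten partial pairings of four factors: the empty one, six single pairs and three perfect
pairings. -/
lemma wick_four {Ω : Type*} [MeasurableSpace Ω] (P : Measure Ω) (ξ : Fin 4 → Ω → ℂ) (s : Ω) :
    wick P ξ s = ξ 0 s * ξ 1 s * (ξ 2 s * ξ 3 s)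
      - (∫ t, ξ 0 t * ξ 1 t ∂P) * (ξ 2 s * ξ 3 s) - (∫ t, ξ 0 t * ξ 2 t ∂P) * (ξ 1 s * ξ 3 s)
      - (∫ t, ξ 0 t * ξ 3 t ∂P) * (ξ 1 s * ξ 2 s) - (∫ t, ξ 1 t * ξ 2 t ∂P) * (ξ 0 s * ξ 3 s)
      - (∫ t, ξ 1 t * ξ 3 t ∂P) * (ξ 0 s * ξ 2 s) - (∫ t, ξ 2 t * ξ 3 t ∂P) * (ξ 0 s * ξ 1 s)
      + (∫ t, ξ 0 t * ξ 1 t ∂P) * (∫ t, ξ 2 t * ξ 3 t ∂P)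
      + (∫ t, ξ 0 t * ξ 2 t ∂P) * (∫ t, ξ 1 t * ξ 3 t ∂P)
      + (∫ t, ξ 0 t * ξ 3 t ∂P) * (∫ t, ξ 1 t * ξ 2 t ∂P) := by
  have term : ∀ (σ : Equiv.Perm (Fin 4)) (A B : Finset (Fin 4)),
      (Finset.univ.filter fun i => σ i = i) = A → (Finset.univ.filter fun i => i < σ i) = B →
      (∏ i : Fin 4 with σ i = i, ξ i s) * ∏ i : Fin 4 with i < σ i, (-∫ t, ξ i t * ξ (σ i) t ∂P) =
      (∏ i ∈ A, ξ i s) * ∏ i ∈ B, (-∫ t, ξ i t * ξ (σ i) t ∂P) := by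
    rintro σ A B rfl rfl
    rfl
  unfold wick
  rw [filter_involutive_perm_four, Finset.sum_insert (by decide), Finset.sum_insert (by decide),
    Finset.sum_insert (by decide), Finset.sum_insert (by decide), Finset.sum_insert (by decide),
    Finset.sum_insert (by decide), Finset.sum_insert (by decide), Finset.sum_insert (by decide),
    Finset.sum_insert (by decide), Finset.sum_singleton]
  rw [term 1 {0, 1, 2, 3} ∅ (by decide) (by decide),
    term (Equiv.swap 0 1) {2, 3} {0} (by decide) (by decide),
    term (Equiv.swap 0 2) {1, 3} {0} (by decide) (by decide),
    term (Equiv.swap 0 3) {1, 2} {0} (by decide) (by decide),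
    term (Equiv.swap 1 2) {0, 3} {1} (by decide) (by decide),
    term (Equiv.swap 1 3) {0, 2} {1} (by decide) (by decide),
    term (Equiv.swap 2 3) {0, 1} {2} (by decide) (by decide),
    term (Equiv.swap 0 1 * Equiv.swap 2 3) ∅ {0, 2} (by decide) (by decide),
    term (Equiv.swap 0 2 * Equiv.swap 1 3) ∅ {0, 1} (by decide) (by decide),
    term (Equiv.swap 0 3 * Equiv.swap 1 2) ∅ {0, 1} (by decide) (by decide)]
  have e1 : (Equiv.swap 0 1 * Equiv.swap 2 3 : Equiv.Perm (Fin 4)) 0 = 1 := by decide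
  have e2 : (Equiv.swap 0 1 * Equiv.swap 2 3 : Equiv.Perm (Fin 4)) 2 = 3 := by decide
  have e3 : (Equiv.swap 0 2 * Equiv.swap 1 3 : Equiv.Perm (Fin 4)) 0 = 2 := by decide
  have e4 : (Equiv.swap 0 2 * Equiv.swap 1 3 : Equiv.Perm (Fin 4)) 1 = 3 := by decide
  have e5 : (Equiv.swap 0 3 * Equiv.swap 1 2 : Equiv.Perm (Fin 4)) 0 = 3 := by decide
  have e6 : (Equiv.swap 0 3 * Equiv.swap 1 2 : Equiv.Perm (Fin 4)) 1 = 2 := by decide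
  have p4 : ∏ i ∈ ({0, 1, 2, 3} : Finset (Fin 4)), ξ i s = ξ 0 s * ξ 1 s * (ξ 2 s * ξ 3 s) := by
    rw [show ({0, 1, 2, 3} : Finset (Fin 4)) = Finset.univ by decide, Fin.prod_univ_four]
    ring
  have p2 : ∀ (i j : Fin 4) (f : Fin 4 → ℂ), i ≠ j → ∏ l ∈ ({i, j} : Finset (Fin 4)), f l = f i * f j :=
    fun i j f h => Finset.prod_pair h
  rw [p4]
  simp only [p2 _ _ _ (show (2 : Fin 4) ≠ 3 by decide), p2 _ _ _ (show (1 : Fin 4) ≠ 3 by decide),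
    p2 _ _ _ (show (1 : Fin 4) ≠ 2 by decide), p2 _ _ _ (show (0 : Fin 4) ≠ 3 by decide),
    p2 _ _ _ (show (0 : Fin 4) ≠ 2 by decide), p2 _ _ _ (show (0 : Fin 4) ≠ 1 by decide),
    Finset.prod_singleton, Finset.prod_empty, e1, e2, e3, e4, e5, e6, Equiv.swap_apply_left]
  ring

/-! ### Double and quadruple series -/

/-- The products `f k * g l`. -/
def fullPair (f g : Lattice → ℂ) (p : Lattice × Lattice) : ℂ := f p.1 * g p.2

/-- The products `f k * g l` on the diagonal. -/
def diagPair (f g : Lattice → ℂ) (p : Lattice × Lattice) : ℂ := kron p.1 p.2 * (f p.1 * g p.2)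

lemma hasSum_fullPair {f g : Lattice → ℂ} (hf : Summable fun k => ‖f k‖)
    (hg : Summable fun k => ‖g k‖) :
    (Summable fun p => ‖fullPair f g p‖) ∧ HasSum (fullPair f g) ((∑' k, f k) * ∑' k, g k) := by
  refine ⟨(hf.mul_norm hg), ?_⟩
  rw [tsum_mul_tsum_of_summable_norm hf hg]
  exact (hf.mul_norm hg).of_norm.hasSum

lemma hasSum_diagPair {f g : Lattice → ℂ} (hf : Summable fun k => ‖f k‖)
    (hg : Summable fun k => ‖g k‖) :
    (Summable fun p => ‖diagPair f g p‖) ∧ HasSum (diagPair f g) (∑' k, f k * g k) := by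
  have h1 : Summable fun p => ‖diagPair f g p‖ := by
    refine Summable.of_nonneg_of_le (fun p => norm_nonneg _) (fun p => ?_) (hasSum_fullPair hf hg).1
    rw [diagPair, norm_mul]
    refine mul_le_of_le_one_left (norm_nonneg _) ?_
    unfold kron
    split_ifs <;> simp
  refine ⟨h1, ?_⟩
  have h2 := h1.of_norm.hasSum
  rwa [h1.of_norm.tsum_prod, tsum_congr fun k => ?_] at h2
  rw [tsum_eq_single k]
  · simp [diagPair, kron]
  · intro l hl
    simp [diagPair, kron, hl.symm]

lemma hasSum_quad {f g : Lattice × Lattice → ℂ} {A B : ℂ}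
    (hf : (Summable fun p => ‖f p‖) ∧ HasSum f A) (hg : (Summable fun p => ‖g p‖) ∧ HasSum g B) :
    (Summable fun k : Quad => ‖f k.1 * g k.2‖) ∧ HasSum (fun k : Quad => f k.1 * g k.2) (A * B) := by
  refine ⟨hf.1.mul_norm hg.1, ?_⟩
  rw [← hf.2.tsum_eq, ← hg.2.tsum_eq, tsum_mul_tsum_of_summable_norm hf.1 hg.1]
  exact (hf.1.mul_norm hg.1).of_norm.hasSum

/-- Exchange of the second and the fourth mode. -/
def exchange : Quad ≃ Quad where
  toFun k := ((k.1.1, k.2.2), (k.2.1, k.1.2))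
  invFun k := ((k.1.1, k.2.2), (k.2.1, k.1.2))
  left_inv _ := rfl
  right_inv _ := rfl

lemma hasSum_quad_exchange {f g : Lattice × Lattice → ℂ} {A B : ℂ}
    (hf : (Summable fun p => ‖f p‖) ∧ HasSum f A) (hg : (Summable fun p => ‖g p‖) ∧ HasSum g B) :
    (Summable fun k : Quad => ‖f (k.1.1, k.2.2) * g (k.2.1, k.1.2)‖) ∧
      HasSum (fun k : Quad => f (k.1.1, k.2.2) * g (k.2.1, k.1.2)) (A * B) :=
  ⟨exchange.summable_iff.mpr (hasSum_quad hf hg).1, exchange.hasSum_iff.mpr (hasSum_quad hf hg).2⟩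

/-- The expansion of a Wick product of four linear combinations of the modes. -/
lemma hasSum_wickMonomial {f f' g g' : Lattice → ℂ} {X : Sample}
    (hf : Summable fun k => ‖f k‖) (hf' : Summable fun k => ‖f' k‖)
    (hg : Summable fun k => ‖g k‖) (hg' : Summable fun k => ‖g' k‖)
    (hfX : Summable fun k => ‖f k * X k‖) (hfX' : Summable fun k => ‖f' k * conj (X k)‖)
    (hgX : Summable fun k => ‖g k * X k‖) (hgX' : Summable fun k => ‖g' k * conj (X k)‖) :
    (Summable fun k : Quad =>
      ‖f k.1.1 * f' k.1.2 * (g k.2.1 * g' k.2.2) * wickMonomial k X‖) ∧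
    HasSum (fun k : Quad => f k.1.1 * f' k.1.2 * (g k.2.1 * g' k.2.2) * wickMonomial k X)
      ((∑' k, f k * X k) * (∑' k, f' k * conj (X k)) *
          ((∑' k, g k * X k) * (∑' k, g' k * conj (X k)))
        - (∑' k, f k * f' k) * ((∑' k, g k * X k) * (∑' k, g' k * conj (X k)))
        - (∑' k, f k * X k) * (∑' k, f' k * conj (X k)) * (∑' k, g k * g' k)
        - (∑' k, f k * g' k) * ((∑' k, g k * X k) * (∑' k, f' k * conj (X k)))
        - (∑' k, f k * X k) * (∑' k, g' k * conj (X k)) * (∑' k, g k * f' k)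
        + (∑' k, f k * f' k) * (∑' k, g k * g' k)
        + (∑' k, f k * g' k) * (∑' k, g k * f' k)) := by
  have t1 := hasSum_quad (hasSum_fullPair hfX hfX') (hasSum_fullPair hgX hgX')
  have t2 := hasSum_quad (hasSum_diagPair hf hf') (hasSum_fullPair hgX hgX')
  have t3 := hasSum_quad (hasSum_fullPair hfX hfX') (hasSum_diagPair hg hg')
  -- The fourth, fifth and seventh terms contract the first mode with the fourth or the third with
  -- the second, so they factorize only after the exchange of the second and the fourth mode.
  have t4 := hasSum_quad_exchange (hasSum_diagPair hf hg') (hasSum_fullPair hgX hfX')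
  have t5 := hasSum_quad_exchange (hasSum_fullPair hfX hgX') (hasSum_diagPair hg hf')
  have t6 := hasSum_quad (hasSum_diagPair hf hf') (hasSum_diagPair hg hg')
  have t7 := hasSum_quad_exchange (hasSum_diagPair hf hg') (hasSum_diagPair hg hf')
  have e : ∀ k : Quad, f k.1.1 * f' k.1.2 * (g k.2.1 * g' k.2.2) * wickMonomial k X =
      fullPair (fun k => f k * X k) (fun k => f' k * conj (X k)) k.1 *
          fullPair (fun k => g k * X k) (fun k => g' k * conj (X k)) k.2
        - diagPair f f' k.1 * fullPair (fun k => g k * X k) (fun k => g' k * conj (X k)) k.2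
        - fullPair (fun k => f k * X k) (fun k => f' k * conj (X k)) k.1 * diagPair g g' k.2
        - diagPair f g' (k.1.1, k.2.2) *
            fullPair (fun k => g k * X k) (fun k => f' k * conj (X k)) (k.2.1, k.1.2)
        - fullPair (fun k => f k * X k) (fun k => g' k * conj (X k)) (k.1.1, k.2.2) *
            diagPair g f' (k.2.1, k.1.2)
        + diagPair f f' k.1 * diagPair g g' k.2
        + diagPair f g' (k.1.1, k.2.2) * diagPair g f' (k.2.1, k.1.2) := by
    intro k
    simp only [fullPair, diagPair, wickMonomial]
    ring
  constructor
  · refine Summable.of_nonneg_of_le (fun k => norm_nonneg _) (fun k => ?_)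
      ((((((t1.1.add t2.1).add t3.1).add t4.1).add t5.1).add t6.1).add t7.1)
    rw [e k]
    refine (norm_add_le _ _).trans (add_le_add ((norm_add_le _ _).trans (add_le_add
      ((norm_sub_le _ _).trans (add_le_add ((norm_sub_le _ _).trans (add_le_add
      ((norm_sub_le _ _).trans (add_le_add (norm_sub_le _ _) le_rfl)) le_rfl)) le_rfl))
      le_rfl)) le_rfl)
  · simp_rw [e]
    exact (((((t1.2.sub t2.2).sub t3.2).sub t4.2).sub t5.2).add t6.2).add t7.2

/-! ### Covariances of absolutely convergent series -/

lemma integral_norm_sq_coord (k : Lattice) : ∫ X, ‖X k‖ ^ 2 ∂law = 1 := by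
  have h := (measurePreserving_eval_gaussianFamily k).map_eq
  have h2 := integral_norm_pow_stdComplexGaussian 1
  rw [← h, integral_map (measurable_pi_apply k).aemeasurable
    (Measurable.aestronglyMeasurable (by fun_prop))] at h2
  rw [law_eq_gaussianFamily]
  simpa using h2

lemma integral_norm_coord_mul_le (k l : Lattice) : ∫ X, ‖X k‖ * ‖X l‖ ∂law ≤ 1 := by
  have hi : ∀ k : Lattice, Integrable (fun X : Sample => ‖X k‖ ^ 2) law := fun k =>
    (hasMoments_coord k).integrable_norm_pow 2
  calc ∫ X, ‖X k‖ * ‖X l‖ ∂law ≤ ∫ X, (2⁻¹ * ‖X k‖ ^ 2 + 2⁻¹ * ‖X l‖ ^ 2) ∂law := by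
        refine integral_mono_of_nonneg (ae_of_all _ fun X => by positivity)
          (((hi k).const_mul _).add ((hi l).const_mul _)) (ae_of_all _ fun X => ?_)
        simp only
        nlinarith [sq_nonneg (‖X k‖ - ‖X l‖)]
    _ = 1 := by
        rw [integral_add ((hi k).const_mul _) ((hi l).const_mul _), integral_const_mul,
          integral_const_mul, integral_norm_sq_coord, integral_norm_sq_coord]
        norm_num

lemma integral_norm_coord_le (k : Lattice) : ∫ X, ‖X k‖ ∂law ≤ 1 := by
  have hi : Integrable (fun X : Sample => ‖X k‖ ^ 2) law :=
    (hasMoments_coord k).integrable_norm_pow 2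
  calc ∫ X, ‖X k‖ ∂law ≤ ∫ X, (2⁻¹ + 2⁻¹ * ‖X k‖ ^ 2) ∂law := by
        refine integral_mono_of_nonneg (ae_of_all _ fun X => by positivity)
          ((integrable_const _).add (hi.const_mul _)) (ae_of_all _ fun X => ?_)
        simp only
        nlinarith [sq_nonneg (‖X k‖ - 1)]
    _ = 1 := by
        rw [integral_add (integrable_const _) (hi.const_mul _), integral_const_mul, integral_norm_sq_coord]
        norm_num

lemma ae_summable_mul_coord {f : Lattice → ℂ} (hf : Summable fun k => ‖f k‖) :
    ∀ᵐ X ∂law, Summable fun k => ‖f k * X k‖ := by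
  have hi : ∀ k, Integrable (fun X : Sample => f k * X k) law :=
    fun k => (hasMoments_coord k).integrable.const_mul (f k)
  refine ae_summable_norm_of_summable_integral hi ?_
  refine Summable.of_nonneg_of_le (fun k => integral_nonneg fun X => norm_nonneg _) (fun k => ?_) hf
  simp_rw [norm_mul]
  rw [integral_const_mul]
  exact mul_le_of_le_one_right (norm_nonneg _) (integral_norm_coord_le k)

/-- `P` and `R` stand for the coordinates or their conjugates, so that all covariances come from a
single exchange of sum and integral. -/
lemma integral_tsum_mul_tsum {f g : Lattice → ℂ} (hf : Summable fun k => ‖f k‖)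
    (hg : Summable fun k => ‖g k‖) {P R : Lattice → Sample → ℂ}
    (hP : ∀ k, HasMoments (P k) law) (hR : ∀ k, HasMoments (R k) law)
    (hP1 : ∀ k X, ‖P k X‖ = ‖X k‖) (hR1 : ∀ k X, ‖R k X‖ = ‖X k‖) :
    ∫ X, (∑' k, f k * P k X) * (∑' k, g k * R k X) ∂law =
      ∑' p : Lattice × Lattice, f p.1 * g p.2 * ∫ X, P p.1 X * R p.2 X ∂law := by
  have h1 : ∀ᵐ X ∂law, (∑' k, f k * P k X) * (∑' k, g k * R k X) =
      ∑' p : Lattice × Lattice, f p.1 * g p.2 * (P p.1 X * R p.2 X) := by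
    filter_upwards [ae_summable_mul_coord hf, ae_summable_mul_coord hg] with X h1 h2
    have h1' : Summable fun k => ‖f k * P k X‖ := by
      simpa only [norm_mul, hP1] using h1
    have h2' : Summable fun k => ‖g k * R k X‖ := by
      simpa only [norm_mul, hR1] using h2
    rw [tsum_mul_tsum_of_summable_norm h1' h2']
    exact tsum_congr fun p => by ring
  rw [integral_congr_ae h1, ← integral_tsum_of_summable_integral_norm]
  · exact tsum_congr fun p => integral_const_mul _ _
  · exact fun p => ((hP p.1).mul (hR p.2)).integrable.const_mul _
  · refine Summable.of_nonneg_of_le (fun p => integral_nonneg fun X => norm_nonneg _) (fun p => ?_)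
      (hf.mul_norm hg)
    simp_rw [norm_mul, hP1, hR1]
    rw [integral_const_mul]
    exact mul_le_of_le_one_right (by positivity) (integral_norm_coord_mul_le _ _)

lemma covariance_mul_conj {f g : Lattice → ℂ} (hf : Summable fun k => ‖f k‖)
    (hg : Summable fun k => ‖g k‖) :
    ∫ X, (∑' k, f k * X k) * (∑' k, g k * conj (X k)) ∂law = ∑' k, f k * g k := by
  rw [integral_tsum_mul_tsum hf hg (P := fun k X => X k) (R := fun k X => conj (X k))
    (fun k => hasMoments_coord k) (fun k => (hasMoments_coord k).star) (fun k X => rfl)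
    (fun k X => RCLike.norm_conj _), ← (hasSum_diagPair hf hg).2.tsum_eq]
  refine tsum_congr fun p => ?_
  rw [integral_coord_mul_conj, diagPair]
  ring

lemma covariance_conj_mul {f g : Lattice → ℂ} (hf : Summable fun k => ‖f k‖)
    (hg : Summable fun k => ‖g k‖) :
    ∫ X, (∑' k, f k * conj (X k)) * (∑' k, g k * X k) ∂law = ∑' k, g k * f k := by
  rw [← covariance_mul_conj hg hf]
  exact integral_congr_ae (ae_of_all _ fun X => mul_comm _ _)

lemma covariance_mul {f g : Lattice → ℂ} (hf : Summable fun k => ‖f k‖)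
    (hg : Summable fun k => ‖g k‖) :
    ∫ X, (∑' k, f k * X k) * (∑' k, g k * X k) ∂law = 0 := by
  rw [integral_tsum_mul_tsum hf hg (P := fun k X => X k) (R := fun k X => X k)
    (fun k => hasMoments_coord k) (fun k => (hasMoments_coord k)) (fun k X => rfl) (fun k X => rfl)]
  simp [integral_coord_mul]

lemma covariance_conj_mul_conj {f g : Lattice → ℂ} (hf : Summable fun k => ‖f k‖)
    (hg : Summable fun k => ‖g k‖) :
    ∫ X, (∑' k, f k * conj (X k)) * (∑' k, g k * conj (X k)) ∂law = 0 := by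
  rw [integral_tsum_mul_tsum hf hg (P := fun k X => conj (X k)) (R := fun k X => conj (X k))
    (fun k => (hasMoments_coord k).star) (fun k => (hasMoments_coord k).star)
    (fun k X => RCLike.norm_conj _) (fun k X => RCLike.norm_conj _)]
  simp [integral_conj_mul_conj]

/-! ### The regularized field -/

/-- The amplitude of the `k`-th mode of the regularized field. -/
def amplitude (κ : ℝ) (θ : Plane → ℝ) (N : ℝ) (k : Lattice) : ℝ :=
  √(θ (N⁻¹ • toPlane k)) / √(eigenvalue κ k)

lemma field_eq (κ : ℝ) (θ : Plane → ℝ) (N : ℝ) (x : Plane) (X : Sample) :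
    field κ θ N x X = ∑' k, (amplitude κ θ N k * eigenfunction k x) * X k := by
  unfold field amplitude
  refine tsum_congr fun k => ?_
  push_cast
  ring

lemma conj_field_eq (κ : ℝ) (θ : Plane → ℝ) (N : ℝ) (x : Plane) (X : Sample) :
    conj (field κ θ N x X) =
      ∑' k, (amplitude κ θ N k * conj (eigenfunction k x)) * conj (X k) := by
  rw [field_eq, Complex.conj_tsum]
  refine tsum_congr fun k => ?_
  simp only [map_mul, Complex.conj_ofReal]

lemma norm_le_norm_toPlane (k : Lattice) : ‖k‖ ≤ ‖toPlane k‖ := by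
  rw [pi_norm_le_iff_of_nonneg (norm_nonneg _)]
  intro i
  have h := PiLp.norm_apply_le (toPlane k) i
  rw [Int.norm_eq_abs]
  exact h

lemma le_eigenvalue {κ : ℝ} (k : Lattice) : κ ≤ eigenvalue κ k := by
  have : 0 ≤ 2 * Real.pi ^ 2 * ‖toPlane k‖ ^ 2 := by positivity
  unfold eigenvalue
  linarith

lemma eigenvalue_pos {κ : ℝ} (hκ : 0 < κ) (k : Lattice) : 0 < eigenvalue κ k :=
  hκ.trans_le (le_eigenvalue k)

lemma norm_sq_le_eigenvalue {κ : ℝ} (hκ : 0 < κ) (k : Lattice) : ‖k‖ ^ 2 ≤ eigenvalue κ k := by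
  have h1 : ‖k‖ ^ 2 ≤ ‖toPlane k‖ ^ 2 := by
    gcongr
    exact norm_le_norm_toPlane k
  have h2 : (1 : ℝ) ≤ 2 * Real.pi ^ 2 := by nlinarith [Real.pi_gt_three]
  unfold eigenvalue
  nlinarith [sq_nonneg ‖toPlane k‖]

lemma amplitude_nonneg (κ : ℝ) (θ : Plane → ℝ) (N : ℝ) (k : Lattice) : 0 ≤ amplitude κ θ N k := by
  unfold amplitude; positivity

lemma summable_norm_lattice_rpow {r : ℝ} (hr : 2 < r) :
    Summable fun k : Lattice => ‖k‖ ^ (-r) :=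
  EisensteinSeries.summable_one_div_norm_rpow hr

lemma summable_amplitude {κ : ℝ} (hκ : 0 < κ) {θ : Plane → ℝ} (hθ : IsCutoff θ) {N : ℝ}
    (hN : 0 < N) : Summable (amplitude κ θ N) := by
  -- Order six leaves order three after the square root, and three exceeds the dimension.
  obtain ⟨C, hC⟩ := hθ.decay 6
  have hs := (summable_norm_lattice_rpow (r := 3) (by norm_num)).mul_left (√C * N ^ 3 / √κ)
  -- The real power `0 ^ (-3)` is `0`, so the zero mode needs a majorant of its own.
  have hd : Summable fun k : Lattice => if k = 0 then amplitude κ θ N 0 else 0 :=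
    summable_of_ne_finset_zero (s := {0}) fun k hk => by
      rw [if_neg (by simpa using hk)]
  refine Summable.of_nonneg_of_le (amplitude_nonneg κ θ N) (fun k => ?_) (hs.add hd)
  by_cases hk : k = 0
  · subst hk
    rw [if_pos rfl]
    have : 0 ≤ √C * N ^ 3 / √κ * ‖(0 : Lattice)‖ ^ (-3 : ℝ) := by positivity
    linarith
  · rw [if_neg hk, add_zero]
    have hk' : 0 < ‖k‖ := norm_pos_iff.mpr hk
    have hp : 0 < ‖toPlane k‖ := hk'.trans_le (norm_le_norm_toPlane k)
    have h1 := hC (N⁻¹ • toPlane k)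
    rw [norm_smul, Real.norm_of_nonneg (by positivity)] at h1
    have h2 : θ (N⁻¹ • toPlane k) ≤ C * N ^ 6 / ‖toPlane k‖ ^ 6 := by
      rw [le_div_iff₀ (by positivity)]
      have : (N⁻¹ * ‖toPlane k‖) ^ 6 * θ (N⁻¹ • toPlane k) * N ^ 6 ≤ C * N ^ 6 := by gcongr
      refine le_trans (le_of_eq ?_) this
      field_simp
    have hC0 : 0 ≤ C := by
      have := hθ.nonneg (N⁻¹ • toPlane k)
      refine le_trans ?_ h1
      positivity
    have h3 : √(θ (N⁻¹ • toPlane k)) ≤ √C * N ^ 3 / ‖toPlane k‖ ^ 3 := by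
      refine (Real.sqrt_le_sqrt h2).trans (le_of_eq ?_)
      rw [show C * N ^ 6 / ‖toPlane k‖ ^ 6 = C * (N ^ 3 / ‖toPlane k‖ ^ 3) ^ 2 by
        field_simp, Real.sqrt_mul hC0, Real.sqrt_sq (by positivity)]
      ring
    have h4 : ‖k‖ ^ (-3 : ℝ) = (‖k‖ ^ 3)⁻¹ := by
      rw [Real.rpow_neg hk'.le]
      norm_cast
    rw [h4, amplitude]
    calc √(θ (N⁻¹ • toPlane k)) / √(eigenvalue κ k)
        ≤ (√C * N ^ 3 / ‖toPlane k‖ ^ 3) / √κ := by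
          gcongr
          exact le_eigenvalue k
      _ ≤ (√C * N ^ 3 / ‖k‖ ^ 3) / √κ := by
          gcongr
          exact norm_le_norm_toPlane k
      _ = _ := by field_simp

/-- The product of the four amplitudes of a quadruple of modes. -/
def amplitudeProd (a : Lattice → ℝ) (k : Quad) : ℝ := a k.1.1 * a k.1.2 * (a k.2.1 * a k.2.2)

/-- The Wick product of the field, in Fourier series. -/
lemma wickSquares_eq {κ : ℝ} {θ : Plane → ℝ} {N : ℝ} (ha : Summable (amplitude κ θ N))
    {X : Sample} (hX : Summable fun k => ‖(amplitude κ θ N k : ℂ) * X k‖) :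
    (Summable fun k : Quad => ‖(amplitudeProd (amplitude κ θ N) k : ℂ) * wickMonomial k X‖) ∧
    ∀ x y, wickSquares κ θ N x y X = (∑' k : Quad,
      (amplitudeProd (amplitude κ θ N) k : ℂ) * wickMonomial k X *
        (eigenfunction (k.1.1 - k.1.2) x * eigenfunction (k.2.1 - k.2.2) y)).re := by
  have hn : ∀ (k : Lattice) (x : Plane),
      ‖(amplitude κ θ N k : ℂ) * eigenfunction k x‖ = amplitude κ θ N k := fun k x => by
    rw [norm_mul, norm_eigenfunction, mul_one, Complex.norm_real,
      Real.norm_of_nonneg (amplitude_nonneg κ θ N k)]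
  have hn' : ∀ (k : Lattice) (x : Plane),
      ‖(amplitude κ θ N k : ℂ) * conj (eigenfunction k x)‖ = amplitude κ θ N k := fun k x => by
    rw [norm_mul, RCLike.norm_conj, norm_eigenfunction, mul_one, Complex.norm_real,
      Real.norm_of_nonneg (amplitude_nonneg κ θ N k)]
  have hX' : Summable fun k => amplitude κ θ N k * ‖X k‖ := by
    refine hX.congr fun k => ?_
    rw [norm_mul, Complex.norm_real, Real.norm_of_nonneg (amplitude_nonneg κ θ N k)]
  have s1 : ∀ x, Summable fun k => ‖(amplitude κ θ N k : ℂ) * eigenfunction k x‖ := fun x => by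
    simpa only [hn] using ha
  have s2 : ∀ x, Summable fun k => ‖(amplitude κ θ N k : ℂ) * conj (eigenfunction k x)‖ :=
    fun x => by simpa only [hn'] using ha
  have s3 : ∀ x, Summable fun k => ‖(amplitude κ θ N k : ℂ) * eigenfunction k x * X k‖ :=
    fun x => by simpa only [norm_mul _ (X _), hn] using hX'
  have s4 : ∀ x, Summable fun k =>
      ‖(amplitude κ θ N k : ℂ) * conj (eigenfunction k x) * conj (X k)‖ :=
    fun x => by simpa only [norm_mul _ (conj (X _)), hn', RCLike.norm_conj] using hX'
  have key := fun x y => hasSum_wickMonomial (s1 x) (s2 x) (s1 y) (s2 y) (s3 x) (s4 x) (s3 y) (s4 y)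
  constructor
  · refine (key 0 0).1.congr fun k => ?_
    have e : ∀ k, eigenfunction k 0 = 1 := fun k => by rw [eigenfunction_eq]; simp
    simp only [e, amplitudeProd, map_one, mul_one]
    push_cast
    rfl
  · intro x y
    unfold wickSquares
    congr 1
    rw [wick_four]
    simp only [Matrix.cons_val_zero, Matrix.cons_val_one, Matrix.cons_val]
    simp only [conj_field_eq κ θ N x, conj_field_eq κ θ N y]
    simp only [field_eq κ θ N x, field_eq κ θ N y]
    -- Only pairings of a field with a conjugate field survive.
    rw [covariance_mul_conj (s1 x) (s2 x), covariance_mul (s1 x) (s1 y),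
      covariance_mul_conj (s1 x) (s2 y), covariance_conj_mul (s2 x) (s1 y),
      covariance_conj_mul_conj (s2 x) (s2 y), covariance_mul_conj (s1 y) (s2 y)]
    have h := (key x y).2.tsum_eq
    have e : ∀ k : Quad, (amplitudeProd (amplitude κ θ N) k : ℂ) * wickMonomial k X *
        (eigenfunction (k.1.1 - k.1.2) x * eigenfunction (k.2.1 - k.2.2) y) =
      (amplitude κ θ N k.1.1 : ℂ) * eigenfunction k.1.1 x *
        ((amplitude κ θ N k.1.2 : ℂ) * conj (eigenfunction k.1.2 x)) *
        ((amplitude κ θ N k.2.1 : ℂ) * eigenfunction k.2.1 y *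
        ((amplitude κ θ N k.2.2 : ℂ) * conj (eigenfunction k.2.2 y))) * wickMonomial k X := by
      intro k
      rw [eigenfunction_sub_left, eigenfunction_sub_left, amplitudeProd]
      push_cast
      ring
    rw [tsum_congr e, h]
    ring

/-! ### The truncated interactions in Fourier series -/

/-- The coefficient of a Wick monomial in the interaction with multiplier `w` and amplitudes `a`. -/
def interactionCoeff (w a : Lattice → ℝ) (k : Quad) : ℝ :=
  if k.1.1 - k.1.2 + (k.2.1 - k.2.2) = 0 then
    1 / 2 * w (k.2.1 - k.2.2) * amplitudeProd a k else 0

lemma re_integral_torus {f : Plane → ℂ} (hf : IntegrableOn f torus) :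
    ∫ x in torus, (f x).re = (∫ x in torus, f x).re :=
  Complex.reCLM.integral_comp_comm hf

lemma torus_integral_series {C : Quad → ℂ} (hC : Summable fun k => ‖C k‖) :
    IntegrableOn (fun x => ∑' k : Quad, C k * eigenfunction (k.1.1 - k.1.2 + (k.2.1 - k.2.2)) x)
      torus ∧
    ∫ x in torus, ∑' k : Quad, C k * eigenfunction (k.1.1 - k.1.2 + (k.2.1 - k.2.2)) x =
      ∑' k : Quad, C k * if k.1.1 - k.1.2 + (k.2.1 - k.2.2) = 0 then 1 else 0 := by
  have h := integral_mul_tsum (μ := volume.restrict torus) (h := fun _ => 1) (integrable_const 1) hC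
    (g := fun k x => eigenfunction (k.1.1 - k.1.2 + (k.2.1 - k.2.2)) x)
    (fun k => (continuous_eigenfunction _).aestronglyMeasurable)
    (fun k x => (norm_eigenfunction _ x).le)
  simp only [one_mul, integral_torus_eigenfunction] at h
  exact h

lemma truncatedLocal_eq {κ : ℝ} {θ : Plane → ℝ} {N : ℝ} (ha : Summable (amplitude κ θ N))
    {X : Sample} (hX : Summable fun k => ‖(amplitude κ θ N k : ℂ) * X k‖) :
    truncatedLocal κ θ N X = (∑' k : Quad,
      (interactionCoeff (fun _ => 1) (amplitude κ θ N) k : ℂ) * wickMonomial k X).re := by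
  obtain ⟨h1, h2⟩ := wickSquares_eq ha hX
  unfold truncatedLocal
  simp_rw [h2, ← eigenfunction_add_left]
  obtain ⟨h3, h4⟩ := torus_integral_series h1
  rw [re_integral_torus h3, h4, ← Complex.re_ofReal_mul, ← tsum_mul_left]
  congr 1
  refine tsum_congr fun k => ?_
  unfold interactionCoeff
  split_ifs
  · push_cast; ring
  · simp

/-- The integral over `y` produces the multiplier at the momentum of the second pair; the integral
over `x` then enforces momentum conservation. -/
lemma truncatedNonlocal_eq {κ : ℝ} {v : Plane → ℝ} (hv : IsPotential v) {ε : ℝ} (hε : 0 < ε)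
    {θ : Plane → ℝ} {N : ℝ} (ha : Summable (amplitude κ θ N))
    {X : Sample} (hX : Summable fun k => ‖(amplitude κ θ N k : ℂ) * X k‖) :
    truncatedNonlocal κ v ε θ N X = (∑' k : Quad,
      (interactionCoeff (multiplier v ε) (amplitude κ θ N) k : ℂ) * wickMonomial k X).re := by
  obtain ⟨h1, h2⟩ := wickSquares_eq ha hX
  set C : Quad → ℂ := fun k => (amplitudeProd (amplitude κ θ N) k : ℂ) * wickMonomial k X with hC
  have inner : ∀ x, ∫ y in torus, rescaled v ε (x - y) * wickSquares κ θ N x y X =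
      (∑' k : Quad, (C k * multiplier v ε (k.2.1 - k.2.2)) *
        eigenfunction (k.1.1 - k.1.2 + (k.2.1 - k.2.2)) x).re := by
    intro x
    have h3 : Summable fun k : Quad => ‖C k * eigenfunction (k.1.1 - k.1.2) x‖ := by
      simpa only [norm_mul _ (eigenfunction _ x), norm_eigenfunction, mul_one] using h1
    obtain ⟨h4, h5⟩ := integral_mul_tsum (integrableOn_rescaled hv hε x) h3
      (g := fun k y => eigenfunction (k.2.1 - k.2.2) y)
      (fun k => (continuous_eigenfunction _).aestronglyMeasurable)
      (fun k y => (norm_eigenfunction _ y).le)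
    have e : ∀ y, rescaled v ε (x - y) * wickSquares κ θ N x y X =
        ((rescaled v ε (x - y) : ℂ) * ∑' k : Quad, C k * eigenfunction (k.1.1 - k.1.2) x *
          eigenfunction (k.2.1 - k.2.2) y).re := fun y => by
      rw [Complex.re_ofReal_mul, h2]
      simp only [hC, mul_assoc]
    simp_rw [e]
    rw [re_integral_torus h4, h5]
    congr 1
    refine tsum_congr fun k => ?_
    rw [integral_rescaled_mul_eigenfunction hv hε, ← hv.ofReal_multiplier, eigenfunction_add_left]
    ring
  have h6 : Summable fun k : Quad => ‖C k * multiplier v ε (k.2.1 - k.2.2)‖ := by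
    refine Summable.of_nonneg_of_le (fun k => norm_nonneg _) (fun k => ?_)
      (h1.mul_right (∫ x, |v x|))
    rw [norm_mul, Complex.norm_real, Real.norm_of_nonneg (hv.multiplier_nonneg _ _)]
    gcongr
    exact multiplier_le _ _ _
  obtain ⟨h7, h8⟩ := torus_integral_series h6
  unfold truncatedNonlocal
  simp_rw [inner]
  rw [re_integral_torus h7, h8, ← Complex.re_ofReal_mul, ← tsum_mul_left]
  congr 1
  refine tsum_congr fun k => ?_
  unfold interactionCoeff
  split_ifs
  · rw [hC]; push_cast; ring
  · simp

/-- For a bounded multiplier the series of the interaction converges absolutely. -/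
lemma summable_interaction {κ : ℝ} {θ : Plane → ℝ} {N : ℝ} (ha : Summable (amplitude κ θ N))
    {X : Sample} (hX : Summable fun k => ‖(amplitude κ θ N k : ℂ) * X k‖)
    {w : Lattice → ℝ} {B : ℝ} (hw : ∀ k, |w k| ≤ B) :
    Summable fun k : Quad =>
      ‖(interactionCoeff w (amplitude κ θ N) k : ℂ) * wickMonomial k X‖ := by
  obtain ⟨h1, -⟩ := wickSquares_eq ha hX
  refine Summable.of_nonneg_of_le (fun k => norm_nonneg _) (fun k => ?_) (h1.mul_left (1 / 2 * B))
  have hB : 0 ≤ B := (abs_nonneg _).trans (hw 0)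
  unfold interactionCoeff
  split_ifs
  · rw [norm_mul, norm_mul, Complex.norm_real, Complex.norm_real, norm_mul, norm_mul, ← mul_assoc]
    gcongr
    · norm_num
    · exact hw _
  · simp only [Complex.ofReal_zero, zero_mul, norm_zero]
    positivity

/-! ### Convergence of the momentum sums -/

lemma summable_eigenvalue_rpow {κ : ℝ} (hκ : 0 < κ) :
    Summable fun k : Lattice => eigenvalue κ k ^ (-(7 / 6) : ℝ) := by
  have hs := summable_norm_lattice_rpow (r := 7 / 3) (by norm_num)
  have hd : Summable fun k : Lattice => if k = 0 then eigenvalue κ 0 ^ (-(7 / 6) : ℝ) else 0 :=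
    summable_of_ne_finset_zero (s := {0}) fun _ hk => by
      rw [if_neg (by simpa using hk)]
  refine Summable.of_nonneg_of_le (fun k => Real.rpow_nonneg (eigenvalue_pos hκ k).le _)
    (fun k => ?_) (hs.add hd)
  by_cases hk : k = 0
  · subst hk
    rw [if_pos rfl]
    exact le_add_of_nonneg_left (by positivity)
  · rw [if_neg hk, add_zero]
    have hk' : 0 < ‖k‖ := norm_pos_iff.mpr hk
    calc eigenvalue κ k ^ (-(7 / 6) : ℝ) ≤ (‖k‖ ^ 2) ^ (-(7 / 6) : ℝ) :=
          Real.rpow_le_rpow_of_nonpos (by positivity) (norm_sq_le_eigenvalue hκ k) (by norm_num)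
      _ = ‖k‖ ^ (-(7 / 3) : ℝ) := by
          rw [← Real.rpow_natCast, ← Real.rpow_mul hk'.le]
          norm_num

/-- Momentum conservation. -/
def Conserves (k : Quad) : Prop := k.1.1 - k.1.2 + (k.2.1 - k.2.2) = 0

instance (k : Quad) : Decidable (Conserves k) := by unfold Conserves; infer_instance

lemma summable_triple {g : Lattice → ℝ} (hg0 : ∀ k, 0 ≤ g k) (hg : Summable g) :
    Summable fun p : (Lattice × Lattice) × Lattice => g p.1.1 * g p.1.2 * g p.2 :=
  (hg.mul_of_nonneg hg hg0 hg0).mul_of_nonneg hg (fun _ => mul_nonneg (hg0 _) (hg0 _)) hg0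

/-- Conservation determines one mode from the other three, so `φ` parametrizes the quadruples by a
free triple of modes. -/
lemma summable_conserving_of_injective {g : Lattice → ℝ} (hg0 : ∀ k, 0 ≤ g k) (hg : Summable g)
    {φ : (Lattice × Lattice) × Lattice → Quad} (hφ : Function.Injective φ)
    (hφ' : ∀ k, Conserves k → k ∈ Set.range φ) {F : Quad → ℝ}
    (hF : ∀ p, F (φ p) = g p.1.1 * g p.1.2 * g p.2) :
    Summable fun k => if Conserves k then F k else 0 := by
  rw [← hφ.summable_iff]
  · refine Summable.of_nonneg_of_le (fun p => ?_) (fun p => ?_) (summable_triple hg0 hg)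
    · simp only [Function.comp]
      split_ifs
      · rw [hF]
        exact mul_nonneg (mul_nonneg (hg0 _) (hg0 _)) (hg0 _)
      · exact le_rfl
    · simp only [Function.comp]
      split_ifs
      · rw [hF]
      · exact mul_nonneg (mul_nonneg (hg0 _) (hg0 _)) (hg0 _)
  · intro k hk
    rw [if_neg fun h => hk (hφ' k h)]

lemma four_mul_le (a b c d : ℝ) :
    a * b * (c * d) ≤ 1 / 4 * (a ^ 4 + b ^ 4 + c ^ 4 + d ^ 4) := by
  nlinarith [sq_nonneg (a * b - c * d), sq_nonneg (a ^ 2 - b ^ 2), sq_nonneg (c ^ 2 - d ^ 2)]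

/-- The product of the four cubes is the product of the four triple products that omit one mode
each. By the arithmetic-geometric inequality it is at most a quarter of the sum of their fourth
powers, and each of these is a free triple sum. -/
lemma summable_conserving {h : Lattice → ℝ} (h0 : ∀ k, 0 ≤ h k) (hs : Summable fun k => h k ^ 4) :
    Summable fun k : Quad => if Conserves k then amplitudeProd (fun k => h k ^ 3) k else 0 := by
  have hg0 : ∀ k, 0 ≤ h k ^ 4 := fun k => by positivity
  have s1 := summable_conserving_of_injective hg0 hs
    (φ := fun p => ((p.1.1, p.1.2), (p.2, p.1.1 - p.1.2 + p.2)))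
    (by rintro ⟨⟨a, b⟩, c⟩ ⟨⟨a', b'⟩, c'⟩ h; simp only [Prod.mk.injEq] at h ⊢; tauto)
    (by
      rintro ⟨⟨a, b⟩, c, d⟩ h
      refine ⟨((a, b), c), ?_⟩
      simp only [Conserves, Prod.mk.injEq, true_and] at h ⊢
      rw [← sub_eq_zero, ← h]; abel)
    (F := fun k => h k.1.1 ^ 4 * h k.1.2 ^ 4 * h k.2.1 ^ 4) (fun p => rfl)
  have s2 := summable_conserving_of_injective hg0 hs
    (φ := fun p => ((p.1.1, p.1.2), (p.2 - p.1.1 + p.1.2, p.2)))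
    (by rintro ⟨⟨a, b⟩, c⟩ ⟨⟨a', b'⟩, c'⟩ h; simp only [Prod.mk.injEq] at h ⊢; tauto)
    (by
      rintro ⟨⟨a, b⟩, c, d⟩ h
      refine ⟨((a, b), d), ?_⟩
      simp only [Conserves, Prod.mk.injEq, true_and, and_true] at h ⊢
      rw [eq_comm, ← sub_eq_zero, ← h]; abel)
    (F := fun k => h k.1.1 ^ 4 * h k.1.2 ^ 4 * h k.2.2 ^ 4) (fun p => rfl)
  have s3 := summable_conserving_of_injective hg0 hs
    (φ := fun p => ((p.1.1, p.1.1 + p.1.2 - p.2), (p.1.2, p.2)))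
    (by rintro ⟨⟨a, b⟩, c⟩ ⟨⟨a', b'⟩, c'⟩ h; simp only [Prod.mk.injEq] at h ⊢; tauto)
    (by
      rintro ⟨⟨a, b⟩, c, d⟩ h
      refine ⟨((a, c), d), ?_⟩
      simp only [Conserves, Prod.mk.injEq, true_and, and_true] at h ⊢
      rw [← sub_eq_zero, ← h]; abel)
    (F := fun k => h k.1.1 ^ 4 * h k.2.1 ^ 4 * h k.2.2 ^ 4) (fun p => rfl)
  have s4 := summable_conserving_of_injective hg0 hs
    (φ := fun p => ((p.1.1 + p.2 - p.1.2, p.1.1), (p.1.2, p.2)))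
    (by rintro ⟨⟨a, b⟩, c⟩ ⟨⟨a', b'⟩, c'⟩ h; simp only [Prod.mk.injEq] at h ⊢; tauto)
    (by
      rintro ⟨⟨a, b⟩, c, d⟩ h
      refine ⟨((b, c), d), ?_⟩
      simp only [Conserves, Prod.mk.injEq, and_true] at h ⊢
      rw [eq_comm, ← sub_eq_zero, ← h]; abel)
    (F := fun k => h k.1.2 ^ 4 * h k.2.1 ^ 4 * h k.2.2 ^ 4) (fun p => rfl)
  refine Summable.of_nonneg_of_le (fun k => ?_) (fun k => ?_)
    ((((s1.add s2).add s3).add s4).mul_left (1 / 4))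
  · split_ifs
    · have := h0 k.1.1
      have := h0 k.1.2
      have := h0 k.2.1
      have := h0 k.2.2
      unfold amplitudeProd
      positivity
    · exact le_rfl
  · split_ifs
    · refine le_trans (le_of_eq ?_) ((four_mul_le (h k.1.1 * h k.1.2 * h k.2.1)
        (h k.1.1 * h k.1.2 * h k.2.2) (h k.1.1 * h k.2.1 * h k.2.2)
        (h k.1.2 * h k.2.1 * h k.2.2)).trans (le_of_eq ?_))
      · unfold amplitudeProd; ring
      · ring
    · simp

/-! ### The limiting amplitudes and their box cutoff -/

/-- The amplitude `λ_k^{-1/2}` of the free field. -/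
def freeAmplitude (κ : ℝ) (k : Lattice) : ℝ := (√(eigenvalue κ k))⁻¹

lemma freeAmplitude_nonneg (κ : ℝ) (k : Lattice) : 0 ≤ freeAmplitude κ k := by
  unfold freeAmplitude; positivity

lemma freeAmplitude_sq {κ : ℝ} (hκ : 0 < κ) (k : Lattice) :
    freeAmplitude κ k ^ 2 = (eigenvalue κ k)⁻¹ := by
  rw [freeAmplitude, inv_pow, Real.sq_sqrt (eigenvalue_pos hκ k).le]

/-- The majorant `∏ λ_k^{-7/8}` of the squared coefficients. -/
def majorant (κ : ℝ) (k : Quad) : ℝ :=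
  if Conserves k then amplitudeProd (fun k => eigenvalue κ k ^ (-(7 / 8) : ℝ)) k else 0

lemma summable_majorant {κ : ℝ} (hκ : 0 < κ) : Summable (majorant κ) := by
  -- The cube is the power `-7/8` of the majorant; the fourth power is `-7/6`, summable because `2 *
  -- 7/6 > 2`.
  have h := summable_conserving (h := fun k => eigenvalue κ k ^ (-(7 / 24) : ℝ))
    (fun k => Real.rpow_nonneg (eigenvalue_pos hκ k).le _) (by
      refine (summable_eigenvalue_rpow hκ).congr fun k => ?_
      rw [← Real.rpow_natCast, ← Real.rpow_mul (eigenvalue_pos hκ k).le]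
      norm_num)
  refine h.congr fun k => ?_
  unfold majorant
  have e : ∀ k : Lattice, (eigenvalue κ k ^ (-(7 / 24) : ℝ)) ^ 3 = eigenvalue κ k ^ (-(7 / 8) : ℝ) :=
    fun k => by
      rw [← Real.rpow_natCast, ← Real.rpow_mul (eigenvalue_pos hκ k).le]
      norm_num
  simp only [e]

lemma majorant_nonneg {κ : ℝ} (hκ : 0 < κ) (k : Quad) : 0 ≤ majorant κ k := by
  have h := fun k => Real.rpow_nonneg (eigenvalue_pos hκ k).le (-(7 / 8) : ℝ)
  unfold majorant
  split_ifs
  · exact mul_nonneg (mul_nonneg (h _) (h _)) (mul_nonneg (h _) (h _))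
  · exact le_rfl

lemma inv_eigenvalue_eq {κ : ℝ} (hκ : 0 < κ) (k : Lattice) :
    (eigenvalue κ k)⁻¹ = eigenvalue κ k ^ (-(7 / 8) : ℝ) * eigenvalue κ k ^ (-(1 / 8) : ℝ) := by
  rw [← Real.rpow_add (eigenvalue_pos hκ k), ← Real.rpow_neg_one]
  norm_num

lemma eigenvalue_rpow_le {κ : ℝ} (hκ : 0 < κ) (k : Lattice) :
    eigenvalue κ k ^ (-(1 / 8) : ℝ) ≤ κ ^ (-(1 / 8) : ℝ) :=
  Real.rpow_le_rpow_of_nonpos hκ (le_eigenvalue k) (by norm_num)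

/-- Each mode carries one inverse eigenvalue, split as `-1 = -7/8 - 1/8`: the first power ensures
summability, the second is kept for the rate of convergence. -/
lemma interactionCoeff_sq_eq {κ : ℝ} (hκ : 0 < κ) (w : Lattice → ℝ) (k : Quad) :
    interactionCoeff w (freeAmplitude κ) k ^ 2 = 1 / 4 * w (k.2.1 - k.2.2) ^ 2 * (majorant κ k *
      amplitudeProd (fun k => eigenvalue κ k ^ (-(1 / 8) : ℝ)) k) := by
  by_cases hk : Conserves k
  · have h : amplitudeProd (freeAmplitude κ) k ^ 2 = amplitudeProd (fun k => (eigenvalue κ k)⁻¹) k := by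
      simp only [amplitudeProd, mul_pow, freeAmplitude_sq hκ]
    rw [interactionCoeff, majorant, if_pos (show k.1.1 - k.1.2 + (k.2.1 - k.2.2) = 0 from hk), if_pos hk,
      mul_pow, h]
    simp only [amplitudeProd, inv_eigenvalue_eq hκ]
    ring
  · rw [interactionCoeff, majorant, if_neg (show ¬ k.1.1 - k.1.2 + (k.2.1 - k.2.2) = 0 from hk),
      if_neg hk]
    ring

lemma interactionCoeff_sq_le {κ : ℝ} (hκ : 0 < κ) {w : Lattice → ℝ} {B : ℝ} (hw : ∀ k, |w k| ≤ B)
    (k : Quad) : interactionCoeff w (freeAmplitude κ) k ^ 2 ≤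
      1 / 4 * B ^ 2 * (κ ^ (-(1 / 8) : ℝ)) ^ 4 * majorant κ k := by
  rw [interactionCoeff_sq_eq hκ]
  have h0 := fun k => Real.rpow_nonneg (eigenvalue_pos hκ k).le (-(1 / 8) : ℝ)
  have h1 := majorant_nonneg hκ k
  have h2 : w (k.2.1 - k.2.2) ^ 2 ≤ B ^ 2 := sq_le_sq' (abs_le.mp (hw _)).1 (abs_le.mp (hw _)).2
  have hk0 : 0 ≤ κ ^ (-(1 / 8) : ℝ) := by positivity
  have h3 : amplitudeProd (fun k => eigenvalue κ k ^ (-(1 / 8) : ℝ)) k ≤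
      κ ^ (-(1 / 8) : ℝ) * κ ^ (-(1 / 8) : ℝ) * (κ ^ (-(1 / 8) : ℝ) * κ ^ (-(1 / 8) : ℝ)) := by
    unfold amplitudeProd
    gcongr <;> first | exact eigenvalue_rpow_le hκ _ | exact h0 _ | exact mul_nonneg (h0 _) (h0 _)
  calc _ ≤ 1 / 4 * B ^ 2 * (majorant κ k * (κ ^ (-(1 / 8) : ℝ) * κ ^ (-(1 / 8) : ℝ) *
        (κ ^ (-(1 / 8) : ℝ) * κ ^ (-(1 / 8) : ℝ)))) := by
        gcongr
        exact mul_nonneg h1 (mul_nonneg (mul_nonneg (h0 _) (h0 _)) (mul_nonneg (h0 _) (h0 _)))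
    _ = _ := by ring

lemma summable_interactionCoeff_sq {κ : ℝ} (hκ : 0 < κ) {w : Lattice → ℝ} {B : ℝ}
    (hw : ∀ k, |w k| ≤ B) :
    Summable fun k => interactionCoeff w (freeAmplitude κ) k ^ 2 :=
  Summable.of_nonneg_of_le (fun _ => sq_nonneg _) (interactionCoeff_sq_le hκ hw)
    ((summable_majorant hκ).mul_left _)

/-- The box of modes of size at most `n`. -/
def modeBox (n : ℕ) : Finset Lattice := Fintype.piFinset fun _ => Finset.Icc (-(n : ℤ)) n

lemma mem_modeBox {n : ℕ} {k : Lattice} : k ∈ modeBox n ↔ ‖k‖ ≤ n := by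
  rw [modeBox, Fintype.mem_piFinset, pi_norm_le_iff_of_nonneg (by positivity)]
  refine forall_congr' fun i => ?_
  rw [Finset.mem_Icc, Int.norm_eq_abs, abs_le]
  constructor
  · rintro ⟨h1, h2⟩
    exact ⟨by exact_mod_cast h1, by exact_mod_cast h2⟩
  · rintro ⟨h1, h2⟩
    exact ⟨by exact_mod_cast h1, by exact_mod_cast h2⟩

/-- The amplitudes of the free field cut off to a box. -/
def boxAmplitude (κ : ℝ) (n : ℕ) (k : Lattice) : ℝ :=
  if k ∈ modeBox n then freeAmplitude κ k else 0

/-- The constant in the rate of convergence of the box cutoff. -/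
def rateConst (κ B : ℝ) : ℝ :=
  1 / 4 * B ^ 2 * (κ ^ (-(1 / 8) : ℝ)) ^ 3 * ∑' k, majorant κ k

lemma rateConst_nonneg {κ : ℝ} (hκ : 0 < κ) (B : ℝ) : 0 ≤ rateConst κ B := by
  have : 0 ≤ ∑' k, majorant κ k := tsum_nonneg (majorant_nonneg hκ)
  unfold rateConst
  positivity

/-- The difference vanishes unless some mode leaves the box. The eigenvalue of that mode is at least
`n²`, so its spare power `-1/8` is at most `n ^ (-1/4)`; the other three are bounded by powers of
`κ`. -/
lemma coeff_box_sub_sq_le {κ : ℝ} (hκ : 0 < κ) {w : Lattice → ℝ} {B : ℝ} (hw : ∀ k, |w k| ≤ B)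
    {n : ℕ} (hn : 1 ≤ n) (k : Quad) :
    (interactionCoeff w (freeAmplitude κ) k - interactionCoeff w (boxAmplitude κ n) k) ^ 2 ≤
      1 / 4 * B ^ 2 * (κ ^ (-(1 / 8) : ℝ)) ^ 3 * (n : ℝ) ^ (-(1 / 4) : ℝ) * majorant κ k := by
  have h0 := fun k => Real.rpow_nonneg (eigenvalue_pos hκ k).le (-(1 / 8) : ℝ)
  have h1 := majorant_nonneg hκ k
  have hn' : (1 : ℝ) ≤ n := by exact_mod_cast hn
  by_cases hk : k.1.1 ∈ modeBox n ∧ k.1.2 ∈ modeBox n ∧ k.2.1 ∈ modeBox n ∧ k.2.2 ∈ modeBox n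
  · have : interactionCoeff w (freeAmplitude κ) k = interactionCoeff w (boxAmplitude κ n) k := by
      simp [interactionCoeff, amplitudeProd, boxAmplitude, hk]
    rw [this, sub_self, zero_pow two_ne_zero]
    positivity
  · have e : interactionCoeff w (boxAmplitude κ n) k = 0 := by
      have : amplitudeProd (boxAmplitude κ n) k = 0 := by
        simp only [amplitudeProd, boxAmplitude, mul_eq_zero, ite_eq_right_iff]
        tauto
      simp [interactionCoeff, this]
    rw [e, sub_zero, interactionCoeff_sq_eq hκ]
    have h2 : w (k.2.1 - k.2.2) ^ 2 ≤ B ^ 2 := sq_le_sq' (abs_le.mp (hw _)).1 (abs_le.mp (hw _)).2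
    have hout : ∀ l : Lattice, l ∉ modeBox n →
        eigenvalue κ l ^ (-(1 / 8) : ℝ) ≤ (n : ℝ) ^ (-(1 / 4) : ℝ) := by
      intro l hl
      rw [mem_modeBox, not_le] at hl
      have h3 : ((n : ℝ) ^ 2) ≤ eigenvalue κ l :=
        le_trans (by gcongr) (norm_sq_le_eigenvalue hκ l)
      calc eigenvalue κ l ^ (-(1 / 8) : ℝ) ≤ ((n : ℝ) ^ 2) ^ (-(1 / 8) : ℝ) :=
            Real.rpow_le_rpow_of_nonpos (by positivity) h3 (by norm_num)
        _ = (n : ℝ) ^ (-(1 / 4) : ℝ) := by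
            rw [← Real.rpow_natCast, ← Real.rpow_mul (by positivity)]
            norm_num
    set K := κ ^ (-(1 / 8) : ℝ) with hK
    have hK0 : 0 ≤ K := by positivity
    have hR0 : 0 ≤ (n : ℝ) ^ (-(1 / 4) : ℝ) := by positivity
    have hin := fun l => eigenvalue_rpow_le hκ l
    have h4 : amplitudeProd (fun k => eigenvalue κ k ^ (-(1 / 8) : ℝ)) k ≤
        K ^ 3 * (n : ℝ) ^ (-(1 / 4) : ℝ) := by
      simp only [amplitudeProd]
      have four : ∀ {a b c d a' b' c' d' : ℝ}, 0 ≤ a → 0 ≤ b → 0 ≤ c → 0 ≤ d → a ≤ a' → b ≤ b' →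
          c ≤ c' → d ≤ d' → a * b * (c * d) ≤ a' * b' * (c' * d') := by
        intro a b c d a' b' c' d' ha hb hc hd h1 h2 h3 h4
        exact mul_le_mul (mul_le_mul h1 h2 hb (ha.trans h1)) (mul_le_mul h3 h4 hd (hc.trans h3))
          (mul_nonneg hc hd) (mul_nonneg (ha.trans h1) (hb.trans h2))
      have hcase : k.1.1 ∉ modeBox n ∨ k.1.2 ∉ modeBox n ∨ k.2.1 ∉ modeBox n ∨ k.2.2 ∉ modeBox n := by
        tauto
      rcases hcase with h | h | h | h
      · exact (four (h0 _) (h0 _) (h0 _) (h0 _) (hout _ h) (hin _) (hin _) (hin _)).trans_eq (by ring)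
      · exact (four (h0 _) (h0 _) (h0 _) (h0 _) (hin _) (hout _ h) (hin _) (hin _)).trans_eq (by ring)
      · exact (four (h0 _) (h0 _) (h0 _) (h0 _) (hin _) (hin _) (hout _ h) (hin _)).trans_eq (by ring)
      · exact (four (h0 _) (h0 _) (h0 _) (h0 _) (hin _) (hin _) (hin _) (hout _ h)).trans_eq (by ring)
    calc _ ≤ 1 / 4 * B ^ 2 * (majorant κ k * (K ^ 3 * (n : ℝ) ^ (-(1 / 4) : ℝ))) := by
          gcongr
          exact mul_nonneg h1 (mul_nonneg (mul_nonneg (h0 _) (h0 _)) (mul_nonneg (h0 _) (h0 _)))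
      _ = _ := by ring

lemma tsum_coeff_box_sub_sq_le {κ : ℝ} (hκ : 0 < κ) {w : Lattice → ℝ} {B : ℝ}
    (hw : ∀ k, |w k| ≤ B) {n : ℕ} (hn : 1 ≤ n) :
    (Summable fun k =>
      (interactionCoeff w (freeAmplitude κ) k - interactionCoeff w (boxAmplitude κ n) k) ^ 2) ∧
    ∑' k, (interactionCoeff w (freeAmplitude κ) k - interactionCoeff w (boxAmplitude κ n) k) ^ 2 ≤
      rateConst κ B * (n : ℝ) ^ (-(1 / 4) : ℝ) := by
  have hs := (summable_majorant hκ).mul_left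
    (1 / 4 * B ^ 2 * (κ ^ (-(1 / 8) : ℝ)) ^ 3 * (n : ℝ) ^ (-(1 / 4) : ℝ))
  have h1 : Summable fun k =>
      (interactionCoeff w (freeAmplitude κ) k - interactionCoeff w (boxAmplitude κ n) k) ^ 2 :=
    Summable.of_nonneg_of_le (fun k => sq_nonneg _) (coeff_box_sub_sq_le hκ hw hn) hs
  refine ⟨h1, (h1.tsum_le_tsum (coeff_box_sub_sq_le hκ hw hn) hs).trans_eq ?_⟩
  rw [tsum_mul_left, rateConst]
  ring

/-! ### Logarithmic growth of the variance -/

/-- The variance of the field with box cutoff. -/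
def boxVariance (κ : ℝ) (n : ℕ) : ℝ := ∑ k ∈ modeBox n, freeAmplitude κ k ^ 2

lemma card_modeBox (n : ℕ) : (modeBox n).card = (2 * n + 1) ^ 2 := by
  rw [modeBox, Fintype.card_piFinset]
  simp only [Int.card_Icc, Finset.prod_const, Finset.card_univ, Fintype.card_fin]
  congr 1
  omega

lemma modeBox_subset (n : ℕ) : modeBox n ⊆ modeBox (n + 1) := by
  intro k hk
  rw [mem_modeBox] at hk ⊢
  push_cast
  linarith

/-- The shell of sup norm `n + 1` has `8 (n + 1)` modes, each of squared amplitude at most `(n +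
1)⁻²`. -/
lemma boxVariance_succ_le {κ : ℝ} (hκ : 0 < κ) (n : ℕ) :
    boxVariance κ (n + 1) ≤ boxVariance κ n + 8 * ((n : ℝ) + 1)⁻¹ := by
  unfold boxVariance
  rw [← Finset.sum_sdiff (modeBox_subset n), add_comm]
  gcongr
  have h1 : ∀ k ∈ modeBox (n + 1) \ modeBox n, freeAmplitude κ k ^ 2 ≤ (((n : ℝ) + 1) ^ 2)⁻¹ := by
    intro k hk
    rw [Finset.mem_sdiff, mem_modeBox, mem_modeBox, not_le, ← mem_modeBox] at hk
    have h2 : (n : ℝ) + 1 ≤ ‖k‖ := by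
      rw [EisensteinSeries.norm_eq_max_natAbs] at hk ⊢
      have := hk.2
      exact_mod_cast this
    rw [freeAmplitude_sq hκ]
    gcongr
    exact le_trans (by gcongr) (norm_sq_le_eigenvalue hκ k)
  refine (Finset.sum_le_card_nsmul _ _ _ h1).trans (le_of_eq ?_)
  rw [Finset.card_sdiff_of_subset (modeBox_subset n), card_modeBox, card_modeBox, nsmul_eq_mul,
    show (2 * (n + 1) + 1) ^ 2 - (2 * n + 1) ^ 2 = 8 * (n + 1) by
      apply Nat.sub_eq_of_eq_add; ring]
  push_cast
  field_simp

lemma boxVariance_le_harmonic {κ : ℝ} (hκ : 0 < κ) (n : ℕ) :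
    boxVariance κ n ≤ κ⁻¹ + 8 * (harmonic n : ℝ) := by
  induction n with
  | zero =>
    have h : modeBox 0 = {0} := by
      ext k
      rw [mem_modeBox, Finset.mem_singleton]
      simp
    rw [boxVariance, h, Finset.sum_singleton, freeAmplitude_sq hκ, eigenvalue, toPlane_zero]
    simp
  | succ n ih =>
    refine (boxVariance_succ_le hκ n).trans ?_
    rw [harmonic_succ]
    push_cast
    linarith

lemma boxVariance_le {κ : ℝ} (hκ : 0 < κ) (n : ℕ) :
    boxVariance κ n ≤ (κ⁻¹ + 8) * (1 + Real.log n) := by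
  have h1 := boxVariance_le_harmonic hκ n
  have h2 := harmonic_le_one_add_log n
  have h3 : 0 ≤ Real.log n := Real.log_natCast_nonneg n
  have h4 : 0 < κ⁻¹ := inv_pos.mpr hκ
  nlinarith

lemma boxVariance_nonneg (κ : ℝ) (n : ℕ) : 0 ≤ boxVariance κ n :=
  Finset.sum_nonneg fun _ _ => sq_nonneg _

/-! ### The lower bound for the truncated interaction -/

/-- The summands of the Fourier coefficients of `:|φ|²:`. -/
def density (a : Lattice → ℝ) (X : Sample) (p : Lattice × Lattice) : ℂ :=
  a p.1 * a p.2 * (X p.1 * conj (X p.2) - kron p.1 p.2)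

/-- The Fourier coefficients of `:|φ|²:`. -/
def densityCoeff (S : Finset Lattice) (a : Lattice → ℝ) (X : Sample) (q : Lattice) : ℂ :=
  ∑ p ∈ S ×ˢ S with p.1 - p.2 = q, density a X p

lemma kron_comm (k l : Lattice) : kron k l = kron l k := by
  unfold kron
  simp only [eq_comm]

lemma conj_kron (k l : Lattice) : conj (kron k l) = kron k l := by
  unfold kron
  split_ifs <;> simp

lemma conj_densityCoeff (S : Finset Lattice) (a : Lattice → ℝ) (X : Sample) (q : Lattice) :
    conj (densityCoeff S a X q) = densityCoeff S a X (-q) := by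
  unfold densityCoeff
  rw [map_sum]
  refine Finset.sum_bij' (fun p _ => p.swap) (fun p _ => p.swap) ?_ ?_ (by simp) (by simp) ?_
  · rintro ⟨k, l⟩ h
    simp only [Finset.mem_filter, Finset.mem_product, Prod.fst_swap, Prod.snd_swap] at h ⊢
    exact ⟨⟨h.1.2, h.1.1⟩, by rw [← h.2]; abel⟩
  · rintro ⟨k, l⟩ h
    simp only [Finset.mem_filter, Finset.mem_product, Prod.fst_swap, Prod.snd_swap] at h ⊢
    exact ⟨⟨h.1.2, h.1.1⟩, by rw [← neg_neg q, ← h.2]; abel⟩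
  · rintro ⟨k, l⟩ -
    simp only [density, map_mul, map_sub, Complex.conj_ofReal, Complex.conj_conj, conj_kron,
      Prod.fst_swap, Prod.snd_swap, kron_comm l k]
    ring

lemma densityCoeff_zero (S : Finset Lattice) (a : Lattice → ℝ) (X : Sample) :
    densityCoeff S a X 0 = ((∑ k ∈ S, a k ^ 2 * ‖X k‖ ^ 2 - ∑ k ∈ S, a k ^ 2 : ℝ) : ℂ) := by
  unfold densityCoeff
  rw [← Finset.sum_sub_distrib, Complex.ofReal_sum]
  refine (Finset.sum_bij' (fun k _ => (k, k)) (fun p _ => p.1) ?_ ?_ ?_ ?_ ?_).symm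
  · intro k hk
    simp [hk]
  · rintro ⟨k, l⟩ h
    simp only [Finset.mem_filter, Finset.mem_product] at h
    exact h.1.1
  · simp
  · rintro ⟨k, l⟩ h
    simp only [Finset.mem_filter, Finset.mem_product, sub_eq_zero] at h
    simp [h.2]
  · intro k _
    simp only [density, kron, if_true]
    rw [Complex.mul_conj, Complex.normSq_eq_norm_sq]
    push_cast
    ring

/-- Conservation pairs the transferred momentum `d` with `-d`, and the two density coefficients are
conjugate. -/
lemma sum_conserving_density (S : Finset Lattice) (a w : Lattice → ℝ) (X : Sample) :
    ∑ p ∈ S ×ˢ S, ∑ q ∈ S ×ˢ S, (if p.1 - p.2 + (q.1 - q.2) = 0 then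
        (w (q.1 - q.2) : ℂ) * (density a X p * density a X q) else 0) =
      ((∑ d ∈ (S ×ˢ S).image fun q => q.1 - q.2, w d * ‖densityCoeff S a X d‖ ^ 2 : ℝ) : ℂ) := by
  rw [Finset.sum_comm, ← Finset.sum_fiberwise_of_maps_to
    (g := fun q : Lattice × Lattice => q.1 - q.2) (t := (S ×ˢ S).image fun q => q.1 - q.2)
    (fun q hq => Finset.mem_image_of_mem _ hq), Complex.ofReal_sum]
  refine Finset.sum_congr rfl fun d _ => ?_
  have h1 : ∀ q ∈ (S ×ˢ S).filter (fun q => q.1 - q.2 = d),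
      ∑ p ∈ S ×ˢ S, (if p.1 - p.2 + (q.1 - q.2) = 0 then
        (w (q.1 - q.2) : ℂ) * (density a X p * density a X q) else 0) =
      w d * densityCoeff S a X (-d) * density a X q := by
    intro q hq
    have hq' := (Finset.mem_filter.mp hq).2
    rw [densityCoeff, Finset.mul_sum, Finset.sum_mul, Finset.sum_filter]
    refine Finset.sum_congr rfl fun p _ => ?_
    rw [hq', if_congr (add_eq_zero_iff_eq_neg) rfl rfl]
    split_ifs
    · ring
    · rfl
  rw [Finset.sum_congr rfl h1, ← Finset.mul_sum]
  change w d * densityCoeff S a X (-d) * densityCoeff S a X d = _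
  rw [← conj_densityCoeff, mul_assoc, mul_comm (conj _), Complex.mul_conj,
    Complex.normSq_eq_norm_sq]
  push_cast
  ring

lemma sum_exchange (S : Finset Lattice) (G : Lattice × Lattice → Lattice × Lattice → ℂ) :
    ∑ p ∈ S ×ˢ S, ∑ q ∈ S ×ˢ S, (if p.2 = q.1 ∧ q.2 = p.1 then G p q else 0) =
      ∑ p ∈ S ×ˢ S, G p (p.2, p.1) := by
  refine Finset.sum_congr rfl fun p hp => ?_
  have hp' := Finset.mem_product.mp hp
  rw [Finset.sum_eq_single (p.2, p.1)]
  · simp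
  · rintro ⟨c, d⟩ - hne
    rw [if_neg]
    rintro ⟨h1, h2⟩
    exact hne (by simp only at h1 h2; rw [h1, h2])
  · intro h
    exact absurd (Finset.mem_product.mpr ⟨hp'.2, hp'.1⟩) h

/-- The contractions inside the two pairs are absorbed by the densities. Under conservation either
cross contraction forces the other, so what remains is a single exchange correction supported on `q
= p.swap`. -/
lemma coeff_mul_wickMonomial (a w : Lattice → ℝ) (X : Sample) (p q : Lattice × Lattice) :
    (interactionCoeff w a (p, q) : ℂ) * wickMonomial (p, q) X =
      1 / 2 * (if p.1 - p.2 + (q.1 - q.2) = 0 then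
        (w (q.1 - q.2) : ℂ) * (density a X p * density a X q) else 0) -
      (if p.2 = q.1 ∧ q.2 = p.1 then ((1 / 2 * w (q.1 - q.2) * (a p.1 ^ 2 * a p.2 ^ 2 *
        (‖X p.2‖ ^ 2 + ‖X p.1‖ ^ 2 - 1)) : ℝ) : ℂ) else 0) := by
  obtain ⟨k, l⟩ := p
  obtain ⟨m, n⟩ := q
  by_cases hc : k - l + (m - n) = 0
  · by_cases he : l = m ∧ n = k
    · obtain ⟨rfl, rfl⟩ := he
      simp only [interactionCoeff, wickMonomial, amplitudeProd, density, kron, hc, if_true, and_self]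
      have e1 := Complex.mul_conj (X l)
      have e2 := Complex.mul_conj (X n)
      rw [Complex.normSq_eq_norm_sq] at e1 e2
      push_cast at e1 e2 ⊢
      rw [← e1, ← e2]
      by_cases hn : n = l
      · subst hn
        simp only [if_true]
        ring
      · simp only [hn, Ne.symm hn, if_false]
        ring
    · have h1 : k ≠ n := by
        rintro rfl
        refine he ⟨?_, rfl⟩
        rw [← sub_eq_zero, ← neg_eq_zero, ← hc]
        abel
      have h2 : m ≠ l := by
        rintro rfl
        refine he ⟨rfl, ?_⟩
        rw [← sub_eq_zero, ← neg_eq_zero, ← hc]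
        abel
      simp only [interactionCoeff, wickMonomial, amplitudeProd, density, hc, if_true, he, if_false,
        kron, h1, h2]
      push_cast
      ring
  · have he : ¬ (l = m ∧ n = k) := by
      rintro ⟨rfl, rfl⟩
      exact hc (by abel)
    simp [interactionCoeff, hc, he]

/-- The truncated interaction is bounded below by the square of the variance of the field. -/
lemma le_re_sum_coeff_mul_wickMonomial (S : Finset Lattice) (a : Lattice → ℝ) {w : Lattice → ℝ}
    {B : ℝ} (hw0 : ∀ k, 0 ≤ w k) (hwB : ∀ k, w k ≤ B) (hw1 : w 0 = 1) (X : Sample) :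
    -(B ^ 2 / 2 + B) * (∑ k ∈ S, a k ^ 2) ^ 2 ≤
      (∑ k ∈ (S ×ˢ S) ×ˢ (S ×ˢ S), (interactionCoeff w a k : ℂ) * wickMonomial k X).re := by
  set G := ∑ k ∈ S, a k ^ 2 with hG
  set M := ∑ k ∈ S, a k ^ 2 * ‖X k‖ ^ 2 with hM
  have hG0 : 0 ≤ G := Finset.sum_nonneg fun _ _ => sq_nonneg _
  have hM0 : 0 ≤ M := Finset.sum_nonneg fun _ _ => by positivity
  have hB : 1 ≤ B := hw1 ▸ hwB 0
  have e : ∑ k ∈ (S ×ˢ S) ×ˢ (S ×ˢ S), (interactionCoeff w a k : ℂ) * wickMonomial k X =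
      ((1 / 2 * (∑ d ∈ (S ×ˢ S).image fun q => q.1 - q.2, w d * ‖densityCoeff S a X d‖ ^ 2) -
        ∑ p ∈ S ×ˢ S, 1 / 2 * w (p.2 - p.1) * (a p.1 ^ 2 * a p.2 ^ 2 *
        (‖X p.2‖ ^ 2 + ‖X p.1‖ ^ 2 - 1)) : ℝ) : ℂ) := by
    rw [Finset.sum_product]
    simp_rw [coeff_mul_wickMonomial, Finset.sum_sub_distrib, ← Finset.mul_sum]
    rw [sum_conserving_density, sum_exchange S (fun p q => ((1 / 2 * w (q.1 - q.2) *
      (a p.1 ^ 2 * a p.2 ^ 2 * (‖X p.2‖ ^ 2 + ‖X p.1‖ ^ 2 - 1)) : ℝ) : ℂ))]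
    push_cast
    ring
  rw [e, Complex.ofReal_re]
  -- Since `w ≥ 0`, every mode but `d = 0` can be dropped, and `w 0 = 1`.
  have h1 : (M - G) ^ 2 ≤ ∑ d ∈ (S ×ˢ S).image fun q => q.1 - q.2,
      w d * ‖densityCoeff S a X d‖ ^ 2 := by
    have h0 : ∀ d, 0 ≤ w d * ‖densityCoeff S a X d‖ ^ 2 := fun d =>
      mul_nonneg (hw0 d) (by positivity)
    have e0 : w 0 * ‖densityCoeff S a X 0‖ ^ 2 = (M - G) ^ 2 := by
      rw [hw1, densityCoeff_zero, Complex.norm_real, Real.norm_eq_abs, sq_abs, one_mul]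
    rcases S.eq_empty_or_nonempty with hS | ⟨k, hk⟩
    · subst hS
      simp [hM, hG]
    · rw [← e0]
      refine Finset.single_le_sum (f := fun d => w d * ‖densityCoeff S a X d‖ ^ 2)
        (fun d _ => h0 d) (Finset.mem_image.mpr ⟨(k, k), ?_, sub_self k⟩)
      exact Finset.mem_product.mpr ⟨hk, hk⟩
  -- The `-1` only lowers the exchange term and is discarded.
  have h2 : ∑ p ∈ S ×ˢ S, 1 / 2 * w (p.2 - p.1) * (a p.1 ^ 2 * a p.2 ^ 2 *
      (‖X p.2‖ ^ 2 + ‖X p.1‖ ^ 2 - 1)) ≤ B * (G * M) := by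
    calc _ ≤ ∑ p ∈ S ×ˢ S, (B / 2 * (a p.1 ^ 2 * (a p.2 ^ 2 * ‖X p.2‖ ^ 2)) +
          B / 2 * (a p.1 ^ 2 * ‖X p.1‖ ^ 2 * a p.2 ^ 2)) := by
          refine Finset.sum_le_sum fun p _ => ?_
          have h3 := hw0 (p.2 - p.1)
          have h4 : w (p.2 - p.1) * (a p.1 ^ 2 * a p.2 ^ 2 * (‖X p.2‖ ^ 2 + ‖X p.1‖ ^ 2)) ≤
              B * (a p.1 ^ 2 * a p.2 ^ 2 * (‖X p.2‖ ^ 2 + ‖X p.1‖ ^ 2)) :=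
            mul_le_mul_of_nonneg_right (hwB _) (by positivity)
          have h5 : 0 ≤ w (p.2 - p.1) * (a p.1 ^ 2 * a p.2 ^ 2) := mul_nonneg h3 (by positivity)
          nlinarith
      _ = B * (G * M) := by
          rw [Finset.sum_add_distrib, ← Finset.mul_sum, ← Finset.mul_sum, Finset.sum_product,
            Finset.sum_product]
          simp_rw [← Finset.mul_sum]
          rw [← Finset.sum_mul, ← Finset.sum_mul]
          ring
  -- Completion of the square: `(M - G)²/2 - B G M = (M - G - B G)²/2 - (B²/2 + B) G²`.
  nlinarith [sq_nonneg (M - G - B * G)]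

/-! ### The limiting interaction -/

/-- The interaction with multiplier `w` and amplitudes `a`. -/
def interactionSeries (w a : Lattice → ℝ) : Lp ℂ 2 law :=
  wickSeries fun k => (interactionCoeff w a k : ℂ)

/-- The interaction with multiplier `w`. -/
def interaction (κ : ℝ) (w : Lattice → ℝ) (X : Sample) : ℝ :=
  (interactionSeries w (freeAmplitude κ) X).re

lemma memLp_interaction (κ : ℝ) (w : Lattice → ℝ) : MemLp (interaction κ w) 2 law :=
  (Lp.memLp (interactionSeries w (freeAmplitude κ))).re

lemma norm_sq_ofReal (x : ℝ) : ‖(x : ℂ)‖ ^ 2 = x ^ 2 := by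
  rw [Complex.norm_real, Real.norm_eq_abs, sq_abs]

lemma norm_sq_ofReal_sub (x y : ℝ) : ‖(x : ℂ) - y‖ ^ 2 = (x - y) ^ 2 := by
  rw [← Complex.ofReal_sub, norm_sq_ofReal]

/-- Decay of order zero is boundedness of `θ`; it gives a domination uniform in `N`. -/
lemma IsCutoff.amplitude_le {θ : Plane → ℝ} (hθ : IsCutoff θ) (κ : ℝ) :
    ∃ K, 0 ≤ K ∧ ∀ N k, amplitude κ θ N k ≤ K * freeAmplitude κ k := by
  obtain ⟨C, hC⟩ := hθ.decay 0
  refine ⟨√C, Real.sqrt_nonneg _, fun N k => ?_⟩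
  rw [amplitude, freeAmplitude, div_eq_mul_inv]
  gcongr
  simpa using hC (N⁻¹ • toPlane k)

lemma abs_interactionCoeff_amplitude_le {θ : Plane → ℝ} {κ K : ℝ} (hK0 : 0 ≤ K)
    (hK : ∀ N k, amplitude κ θ N k ≤ K * freeAmplitude κ k) (w : Lattice → ℝ) (N : ℝ) (k : Quad) :
    |interactionCoeff w (amplitude κ θ N) k| ≤ K ^ 4 * |interactionCoeff w (freeAmplitude κ) k| := by
  have hf := freeAmplitude_nonneg κ
  have ha := amplitude_nonneg κ θ N
  unfold interactionCoeff
  split_ifs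
  · rw [abs_mul, abs_mul _ (amplitudeProd (freeAmplitude κ) k), mul_left_comm]
    refine mul_le_mul_of_nonneg_left ?_ (abs_nonneg _)
    unfold amplitudeProd
    rw [abs_of_nonneg (mul_nonneg (mul_nonneg (ha _) (ha _)) (mul_nonneg (ha _) (ha _))),
      abs_of_nonneg (mul_nonneg (mul_nonneg (hf _) (hf _)) (mul_nonneg (hf _) (hf _)))]
    calc _ ≤ K * freeAmplitude κ k.1.1 * (K * freeAmplitude κ k.1.2) *
          (K * freeAmplitude κ k.2.1 * (K * freeAmplitude κ k.2.2)) :=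
          mul_le_mul (mul_le_mul (hK _ _) (hK _ _) (ha _) (mul_nonneg hK0 (hf _)))
            (mul_le_mul (hK _ _) (hK _ _) (ha _) (mul_nonneg hK0 (hf _)))
            (mul_nonneg (ha _) (ha _))
            (mul_nonneg (mul_nonneg hK0 (hf _)) (mul_nonneg hK0 (hf _)))
      _ = _ := by ring
  · simp

lemma sq_interactionCoeff_amplitude_le {θ : Plane → ℝ} {κ K : ℝ} (hK0 : 0 ≤ K)
    (hK : ∀ N k, amplitude κ θ N k ≤ K * freeAmplitude κ k) (w : Lattice → ℝ) (N : ℝ) (k : Quad) :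
    interactionCoeff w (amplitude κ θ N) k ^ 2 ≤
      K ^ 8 * interactionCoeff w (freeAmplitude κ) k ^ 2 := by
  have h := abs_interactionCoeff_amplitude_le hK0 hK w N k
  rw [← sq_abs, ← sq_abs (interactionCoeff w (freeAmplitude κ) k)]
  calc _ ≤ (K ^ 4 * |interactionCoeff w (freeAmplitude κ) k|) ^ 2 := by gcongr
    _ = _ := by ring

lemma tendsto_amplitude {θ : Plane → ℝ} (hθ : IsCutoff θ) (κ : ℝ) (k : Lattice) :
    Tendsto (fun N => amplitude κ θ N k) atTop (𝓝 (freeAmplitude κ k)) := by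
  have h1 : Tendsto (fun N : ℝ => N⁻¹ • toPlane k) atTop (𝓝 0) := by
    simpa using (tendsto_inv_atTop_zero (𝕜 := ℝ)).smul_const (toPlane k)
  have h2 : Tendsto (fun N : ℝ => θ (N⁻¹ • toPlane k)) atTop (𝓝 1) := by
    have := hθ.continuousAt_zero.tendsto.comp h1
    rwa [hθ.at_zero] at this
  have h3 := (h2.sqrt).div_const √(eigenvalue κ k)
  rw [Real.sqrt_one, one_div] at h3
  exact h3

/-- Dominated convergence over the modes: continuity of `θ` at the origin gives the pointwise limit,
boundedness the majorant. -/
lemma tendsto_tsum_interactionCoeff {θ : Plane → ℝ} (hθ : IsCutoff θ) {κ : ℝ} (hκ : 0 < κ)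
    {w : Lattice → ℝ} {B : ℝ} (hw : ∀ k, |w k| ≤ B) :
    Tendsto (fun N => ∑' k, (interactionCoeff w (amplitude κ θ N) k -
      interactionCoeff w (freeAmplitude κ) k) ^ 2) atTop (𝓝 0) := by
  obtain ⟨K, hK0, hK⟩ := hθ.amplitude_le κ
  have h0 : ∑' _ : Quad, (0 : ℝ) = 0 := tsum_zero
  rw [← h0]
  refine tendsto_tsum_of_dominated_convergence
    (bound := fun k => (2 * K ^ 8 + 2) * interactionCoeff w (freeAmplitude κ) k ^ 2)
    ((summable_interactionCoeff_sq hκ hw).mul_left _) (fun k => ?_)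
    (Eventually.of_forall fun N k => ?_)
  · have h1 : Tendsto (fun N => interactionCoeff w (amplitude κ θ N) k) atTop
        (𝓝 (interactionCoeff w (freeAmplitude κ) k)) := by
      unfold interactionCoeff
      split_ifs
      · exact (((tendsto_amplitude hθ κ _).mul (tendsto_amplitude hθ κ _)).mul
          ((tendsto_amplitude hθ κ _).mul (tendsto_amplitude hθ κ _))).const_mul _
      · exact tendsto_const_nhds
    simpa using (h1.sub_const (interactionCoeff w (freeAmplitude κ) k)).pow 2
  · rw [Real.norm_of_nonneg (sq_nonneg _)]
    have h1 := sq_interactionCoeff_amplitude_le hK0 hK w N k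
    nlinarith [sq_nonneg (interactionCoeff w (amplitude κ θ N) k +
      interactionCoeff w (freeAmplitude κ) k)]

lemma eLpNorm_interactionSeries_sub_le {w a a' : Lattice → ℝ}
    (h : Summable fun k => interactionCoeff w a k ^ 2)
    (h' : Summable fun k => interactionCoeff w a' k ^ 2) :
    eLpNorm (fun X => (interactionSeries w a X).re - (interactionSeries w a' X).re) 2 law ≤
      ENNReal.ofReal √(384 * ∑' k, (interactionCoeff w a k - interactionCoeff w a' k) ^ 2) := by
  have hc : Summable fun k => ‖(interactionCoeff w a k : ℂ)‖ ^ 2 := by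
    simpa only [norm_sq_ofReal] using h
  have hc' : Summable fun k => ‖(interactionCoeff w a' k : ℂ)‖ ^ 2 := by
    simpa only [norm_sq_ofReal] using h'
  have h1 := norm_sq_wickSeries_le (summable_norm_sq_sub hc hc')
  rw [wickSeries_sub hc hc'] at h1
  simp only [norm_sq_ofReal_sub] at h1
  calc _ ≤ eLpNorm (interactionSeries w a - interactionSeries w a' : Lp ℂ 2 law) 2 law := by
        refine eLpNorm_mono_ae ?_
        filter_upwards [Lp.coeFn_sub (interactionSeries w a) (interactionSeries w a')] with X hX
        rw [hX, Pi.sub_apply, ← Complex.sub_re]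
        exact Complex.abs_re_le_norm _
    _ = ‖interactionSeries w a - interactionSeries w a'‖ₑ := (Lp.enorm_def _).symm
    _ = ENNReal.ofReal ‖interactionSeries w a - interactionSeries w a'‖ := (ofReal_norm _).symm
    _ ≤ _ := ENNReal.ofReal_le_ofReal (Real.le_sqrt_of_sq_le h1)

/-- At fixed `N` the series converges absolutely for almost every `X`, so its pointwise sum agrees
with its sum in `L²`. -/
lemma re_interactionSeries_ae_eq {κ : ℝ} (hκ : 0 < κ) {θ : Plane → ℝ} (hθ : IsCutoff θ) {N : ℝ}
    (hN : 0 < N) {w : Lattice → ℝ} {B : ℝ} (hw : ∀ k, |w k| ≤ B) {T : Sample → ℝ}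
    (hT : ∀ X : Sample, (Summable fun k => ‖(amplitude κ θ N k : ℂ) * X k‖) →
      T X = (∑' k : Quad,
        (interactionCoeff w (amplitude κ θ N) k : ℂ) * wickMonomial k X).re) :
    (fun X => (interactionSeries w (amplitude κ θ N) X).re) =ᵐ[law] T := by
  obtain ⟨K, hK0, hK⟩ := hθ.amplitude_le κ
  have ha := summable_amplitude hκ hθ hN
  have hc : Summable fun k => ‖(interactionCoeff w (amplitude κ θ N) k : ℂ)‖ ^ 2 := by
    simp only [norm_sq_ofReal]
    exact Summable.of_nonneg_of_le (fun k => sq_nonneg _)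
      (sq_interactionCoeff_amplitude_le hK0 hK w N) ((summable_interactionCoeff_sq hκ hw).mul_left _)
  have hae : ∀ᵐ X ∂law, Summable fun k => ‖(amplitude κ θ N k : ℂ) * X k‖ := by
    refine ae_summable_mul_coord ?_
    simpa only [Complex.norm_real, Real.norm_of_nonneg (amplitude_nonneg κ θ N _)] using ha
  have h1 : wickSeries (fun k => (interactionCoeff w (amplitude κ θ N) k : ℂ)) =ᵐ[law]
      fun X => ∑' k : Quad, (interactionCoeff w (amplitude κ θ N) k : ℂ) * wickMonomial k X := by
    refine wickSeries_ae_eq_of_hasSum hc ?_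
    filter_upwards [hae] with X hX
    exact (summable_interaction ha hX hw).of_norm.hasSum
  filter_upwards [hae, h1] with X hX h2
  rw [hT X hX, ← h2]
  rfl

lemma tendsto_truncated {κ : ℝ} (hκ : 0 < κ) {θ : Plane → ℝ} (hθ : IsCutoff θ)
    {w : Lattice → ℝ} {B : ℝ} (hw : ∀ k, |w k| ≤ B) {T : ℝ → Sample → ℝ}
    (hT : ∀ N, 0 < N → ∀ X : Sample, (Summable fun k => ‖(amplitude κ θ N k : ℂ) * X k‖) →
      T N X = (∑' k : Quad,
        (interactionCoeff w (amplitude κ θ N) k : ℂ) * wickMonomial k X).re) :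
    Tendsto (fun N => eLpNorm (fun X => T N X - interaction κ w X) 2 law) atTop (𝓝 0) := by
  obtain ⟨K, hK0, hK⟩ := hθ.amplitude_le κ
  have h1 : Tendsto (fun N => ENNReal.ofReal √(384 * ∑' k, (interactionCoeff w (amplitude κ θ N) k -
      interactionCoeff w (freeAmplitude κ) k) ^ 2)) atTop (𝓝 0) := by
    have h2 := ((tendsto_tsum_interactionCoeff hθ hκ hw).const_mul 384).sqrt
    rw [mul_zero, Real.sqrt_zero] at h2
    simpa using ENNReal.tendsto_ofReal h2
  refine tendsto_of_tendsto_of_tendsto_of_le_of_le' tendsto_const_nhds h1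
    (Eventually.of_forall fun N => zero_le) ?_
  filter_upwards [eventually_gt_atTop 0] with N hN
  refine le_trans (le_of_eq (eLpNorm_congr_ae ?_)) (eLpNorm_interactionSeries_sub_le
    (Summable.of_nonneg_of_le (fun k => sq_nonneg _) (sq_interactionCoeff_amplitude_le hK0 hK w N)
      ((summable_interactionCoeff_sq hκ hw).mul_left _)) (summable_interactionCoeff_sq hκ hw))
  filter_upwards [re_interactionSeries_ae_eq hκ hθ hN hw (hT N hN)] with X hX
  rw [hX, interaction]

/-! ### Existence and uniqueness -/

/-- Uniqueness of the limits needs at least one cutoff; otherwise their defining property would be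
vacuous. -/
lemma exists_isCutoff : ∃ θ, IsCutoff θ := by
  refine ⟨(Metric.closedBall 0 1).indicator fun _ => 1, ?_, ?_, ?_, ?_⟩
  · intro ξ
    exact Set.indicator_nonneg (fun _ _ => zero_le_one) ξ
  · simp
  · have h : (Metric.closedBall (0 : Plane) 1).indicator (fun _ => (1 : ℝ)) =ᶠ[𝓝 0] fun _ => 1 := by
      filter_upwards [Metric.closedBall_mem_nhds (0 : Plane) one_pos] with ξ hξ
      exact Set.indicator_of_mem hξ _
    exact continuousAt_const.congr h.symm
  · intro m
    refine ⟨1, fun ξ => ?_⟩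
    by_cases hξ : ξ ∈ Metric.closedBall (0 : Plane) 1
    · rw [Set.indicator_of_mem hξ, mul_one]
      exact pow_le_one₀ (norm_nonneg _) (by simpa using hξ)
    · rw [Set.indicator_of_notMem hξ, mul_zero]
      exact zero_le_one

lemma ae_eq_of_tendsto_eLpNorm {T : ℝ → Sample → ℝ}
    (hT : ∀ᶠ N in atTop, AEStronglyMeasurable (T N) law) {V V' : Sample → ℝ} (hV : MemLp V 2 law)
    (hV' : MemLp V' 2 law)
    (h : Tendsto (fun N => eLpNorm (fun X => T N X - V X) 2 law) atTop (𝓝 0))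
    (h' : Tendsto (fun N => eLpNorm (fun X => T N X - V' X) 2 law) atTop (𝓝 0)) :
    V =ᵐ[law] V' := by
  have h0 : eLpNorm (fun X => V X - V' X) 2 law ≤ 0 := by
    have h1 := h'.add h
    rw [add_zero] at h1
    refine ge_of_tendsto h1 ?_
    filter_upwards [hT] with N hN
    have h2 : (fun X => V X - V' X) = (fun X => T N X - V' X) - fun X => T N X - V X := by
      funext X
      simp
    rw [h2]
    exact eLpNorm_sub_le (hN.sub hV'.1) (hN.sub hV.1) (by norm_num)
  have h3 := (eLpNorm_eq_zero_iff (hV.1.sub hV'.1) (by norm_num)).mp (le_antisymm h0 zero_le)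
  filter_upwards [h3] with X hX
  exact sub_eq_zero.mp hX

lemma IsPotential.abs_multiplier_le {v : Plane → ℝ} (hv : IsPotential v) (ε : ℝ) (k : Lattice) :
    |multiplier v ε k| ≤ ∫ x, |v x| := by
  rw [abs_of_nonneg (hv.multiplier_nonneg ε k)]
  exact multiplier_le v ε k

lemma IsPotential.one_le_integral_abs {v : Plane → ℝ} (hv : IsPotential v) : 1 ≤ ∫ x, |v x| := by
  rw [← hv.multiplier_zero 1]
  exact multiplier_le v 1 0

lemma isNonlocalInteraction_interaction {κ : ℝ} (hκ : 0 < κ) {v : Plane → ℝ} (hv : IsPotential v)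
    {ε : ℝ} (hε : 0 < ε) : IsNonlocalInteraction κ v ε (interaction κ (multiplier v ε)) :=
  ⟨memLp_interaction _ _, fun _ hθ => tendsto_truncated hκ hθ (hv.abs_multiplier_le ε)
    fun _ hN _ hX => truncatedNonlocal_eq hv hε (summable_amplitude hκ hθ hN) hX⟩

lemma isLocalInteraction_interaction {κ : ℝ} (hκ : 0 < κ) :
    IsLocalInteraction κ (interaction κ fun _ => 1) :=
  ⟨memLp_interaction _ _, fun _ hθ => tendsto_truncated (B := 1) hκ hθ (by simp)
    fun _ hN _ hX => truncatedLocal_eq (summable_amplitude hκ hθ hN) hX⟩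

lemma IsNonlocalInteraction.ae_eq {κ : ℝ} (hκ : 0 < κ) {v : Plane → ℝ} (hv : IsPotential v)
    {ε : ℝ} (hε : 0 < ε) {V : Sample → ℝ} (hV : IsNonlocalInteraction κ v ε V) :
    V =ᵐ[law] interaction κ (multiplier v ε) := by
  obtain ⟨θ, hθ⟩ := exists_isCutoff
  have h := isNonlocalInteraction_interaction hκ hv hε
  refine ae_eq_of_tendsto_eLpNorm ?_ hV.1 h.1 (hV.2 θ hθ) (h.2 θ hθ)
  filter_upwards [eventually_gt_atTop 0] with N hN
  exact (Complex.continuous_re.comp_aestronglyMeasurable (Lp.aestronglyMeasurable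
    (interactionSeries (multiplier v ε) (amplitude κ θ N)))).congr
    (re_interactionSeries_ae_eq hκ hθ hN (hv.abs_multiplier_le ε)
      fun _ hX => truncatedNonlocal_eq hv hε (summable_amplitude hκ hθ hN) hX)

lemma IsLocalInteraction.ae_eq {κ : ℝ} (hκ : 0 < κ) {V : Sample → ℝ}
    (hV : IsLocalInteraction κ V) : V =ᵐ[law] interaction κ fun _ => 1 := by
  obtain ⟨θ, hθ⟩ := exists_isCutoff
  have h := isLocalInteraction_interaction hκ
  refine ae_eq_of_tendsto_eLpNorm ?_ hV.1 h.1 (hV.2 θ hθ) (h.2 θ hθ)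
  filter_upwards [eventually_gt_atTop 0] with N hN
  exact (Complex.continuous_re.comp_aestronglyMeasurable (Lp.aestronglyMeasurable
    (interactionSeries (fun _ => 1) (amplitude κ θ N)))).congr
    (re_interactionSeries_ae_eq (B := 1) hκ hθ hN (by simp)
    fun _ hX => truncatedLocal_eq (summable_amplitude hκ hθ hN) hX)

/-! ### Nelson's estimate -/

lemma interactionCoeff_box_eq_zero (w : Lattice → ℝ) (κ : ℝ) (n : ℕ) {k : Quad}
    (hk : k ∉ (modeBox n ×ˢ modeBox n) ×ˢ (modeBox n ×ˢ modeBox n)) :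
    interactionCoeff w (boxAmplitude κ n) k = 0 := by
  have : amplitudeProd (boxAmplitude κ n) k = 0 := by
    simp only [Finset.mem_product] at hk
    simp only [amplitudeProd, boxAmplitude, mul_eq_zero, ite_eq_right_iff]
    tauto
  simp [interactionCoeff, this]

lemma summable_interactionCoeff_box_sq (w : Lattice → ℝ) (κ : ℝ) (n : ℕ) :
    Summable fun k => interactionCoeff w (boxAmplitude κ n) k ^ 2 :=
  summable_of_ne_finset_zero (s := (modeBox n ×ˢ modeBox n) ×ˢ (modeBox n ×ˢ modeBox n))
    fun k hk => by rw [interactionCoeff_box_eq_zero w κ n hk, zero_pow two_ne_zero]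

lemma le_re_interactionSeries_box (κ : ℝ) {w : Lattice → ℝ} {B : ℝ} (hw0 : ∀ k, 0 ≤ w k)
    (hwB : ∀ k, w k ≤ B) (hw1 : w 0 = 1) (n : ℕ) :
    ∀ᵐ X ∂law, -(B ^ 2 / 2 + B) * boxVariance κ n ^ 2 ≤
      (interactionSeries w (boxAmplitude κ n) X).re := by
  have hc : Summable fun k => ‖(interactionCoeff w (boxAmplitude κ n) k : ℂ)‖ ^ 2 := by
    simpa only [norm_sq_ofReal] using summable_interactionCoeff_box_sq w κ n
  have h1 := wickSeries_ae_eq_of_hasSum hc (g := fun X =>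
    ∑ k ∈ (modeBox n ×ˢ modeBox n) ×ˢ (modeBox n ×ˢ modeBox n),
      (interactionCoeff w (boxAmplitude κ n) k : ℂ) * wickMonomial k X)
    (ae_of_all _ fun X => hasSum_sum_of_ne_finset_zero fun k hk => by
      rw [interactionCoeff_box_eq_zero w κ n hk, Complex.ofReal_zero, zero_mul])
  filter_upwards [h1] with X hX
  rw [interactionSeries, hX]
  refine le_trans (le_of_eq ?_) (le_re_sum_coeff_mul_wickMonomial (modeBox n) (boxAmplitude κ n)
    hw0 hwB hw1 X)
  congr 2
  refine Finset.sum_congr rfl fun k hk => ?_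
  rw [boxAmplitude, if_pos hk]

/-- The box-truncated interaction is almost surely at least `1 - L`, so `V < -L` makes the
truncation error exceed one. -/
lemma measure_interaction_lt_le {κ : ℝ} (hκ : 0 < κ) {w : Lattice → ℝ} {B : ℝ}
    (hw0 : ∀ k, 0 ≤ w k) (hwB : ∀ k, w k ≤ B) (hw1 : w 0 = 1) {n : ℕ} (hn : 1 ≤ n) (m : ℕ) {L : ℝ}
    (hL : (B ^ 2 / 2 + B) * boxVariance κ n ^ 2 + 1 ≤ L) :
    law.real {X | interaction κ w X < -L} ≤
      16 ^ m * (4 * m).factorial * (rateConst κ B * (n : ℝ) ^ (-(1 / 4) : ℝ)) ^ m := by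
  have hw : ∀ k, |w k| ≤ B := fun k => by
    rw [abs_of_nonneg (hw0 k)]
    exact hwB k
  have hc : Summable fun k => ‖(interactionCoeff w (freeAmplitude κ) k : ℂ)‖ ^ 2 := by
    simpa only [norm_sq_ofReal] using summable_interactionCoeff_sq hκ hw
  have hc' : Summable fun k => ‖(interactionCoeff w (boxAmplitude κ n) k : ℂ)‖ ^ 2 := by
    simpa only [norm_sq_ofReal] using summable_interactionCoeff_box_sq w κ n
  have h1 := measure_one_le_norm_wickSeries_le (summable_norm_sq_sub hc hc') m
  rw [wickSeries_sub hc hc'] at h1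
  simp only [norm_sq_ofReal_sub] at h1
  have h2 := (tsum_coeff_box_sub_sq_le hκ hw hn).2
  have h3 : 0 ≤ ∑' k, (interactionCoeff w (freeAmplitude κ) k -
      interactionCoeff w (boxAmplitude κ n) k) ^ 2 := tsum_nonneg fun k => sq_nonneg _
  refine le_trans ?_ (h1.trans (by gcongr))
  refine ENNReal.toReal_mono (measure_ne_top _ _) (measure_mono_ae ?_)
  filter_upwards [le_re_interactionSeries_box κ hw0 hwB hw1 n,
    Lp.coeFn_sub (interactionSeries w (freeAmplitude κ)) (interactionSeries w (boxAmplitude κ n))]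
    with X hX1 hX2 hX3
  change interaction κ w X < -L at hX3
  change 1 ≤ ‖(interactionSeries w (freeAmplitude κ) - interactionSeries w (boxAmplitude κ n) :
    Lp ℂ 2 law) X‖
  rw [hX2, Pi.sub_apply]
  refine le_trans ?_ (Complex.abs_re_le_norm _)
  rw [Complex.sub_re, le_abs]
  right
  unfold interaction at hX3
  linarith

/-- `(4m)! ≤ (4m) ^ (4m)` and `4096 = 16 * 4 ^ 4`. -/
lemma factorial_moment_le (m : ℕ) {y : ℝ} (hy : 0 ≤ y) :
    16 ^ m * (4 * m).factorial * y ^ m ≤ (4096 * (m : ℝ) ^ 4 * y) ^ m := by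
  have h1 : ((4 * m).factorial : ℝ) ≤ (4 * m : ℝ) ^ (4 * m) := by
    exact_mod_cast Nat.factorial_le_pow (4 * m)
  calc 16 ^ m * (4 * m).factorial * y ^ m ≤ 16 ^ m * (4 * m : ℝ) ^ (4 * m) * y ^ m := by gcongr
    _ = (4096 * (m : ℝ) ^ 4 * y) ^ m := by
      rw [pow_mul, ← mul_pow, ← mul_pow]
      congr 1
      ring

/-- Nelson's double exponential tail estimate. -/
lemma exists_tail_bound {κ : ℝ} (hκ : 0 < κ) {B : ℝ} (hB : 1 ≤ B) :
    ∃ c : ℝ, 0 < c ∧ ∃ C : ℝ, 0 < C ∧ ∀ w : Lattice → ℝ, (∀ k, 0 ≤ w k) → (∀ k, w k ≤ B) →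
      w 0 = 1 → ∀ L : ℝ, 0 ≤ L →
        law.real {X | interaction κ w X < -L} ≤ C * Real.exp (-Real.exp (c * √L)) := by
  set A := (B ^ 2 / 2 + B) * (κ⁻¹ + 8) ^ 2 with hA
  have hA1 : 1 ≤ A := by
    have h1 : 0 < κ⁻¹ := inv_pos.mpr hκ
    have h2 : (1 : ℝ) ≤ B ^ 2 / 2 + B := by nlinarith
    have h3 : (1 : ℝ) ≤ (κ⁻¹ + 8) ^ 2 := by nlinarith
    exact one_le_mul_of_one_le_of_one_le h2 h3
  have hR := rateConst_nonneg hκ B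
  -- `8192 = 2 * 4096`, the `2` coming from the rounding of `n`; the `+ 1` keeps `Q` positive.
  set Q := 8192 * rateConst κ B + 1 with hQ
  have hQ0 : 0 < Q := by positivity
  -- With `m` about `q e^{s/16}`, this `q` makes the base of the `m`-th power at most `e⁻¹`.
  set q := (Real.exp 1 * Q) ^ (-(1 / 4) : ℝ) with hq
  have hq0 : 0 < q := by positivity
  have hq4 : q ^ 4 * (Real.exp 1 * Q) = 1 := by
    rw [hq, ← Real.rpow_natCast, ← Real.rpow_mul (by positivity)]
    norm_num
    rw [Real.rpow_neg_one]
    field_simp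
  -- This `c` gives `c √L = s / 32`. The `4` covers the case `s < 3` and the rounding of `m`; `1 /
  -- q` pays for the inequality `2 e^{s/32} ≤ q e^{s/16} + 1/q`.
  refine ⟨1 / (64 * √A), by positivity, Real.exp (4 + 1 / q), by positivity, ?_⟩
  intro w hw0 hwB hw1 L hL
  -- With `log n ≤ s`, the lower bound costs at most `A (1 + s)²`, and `A (1 + s)² + 1 ≤ 4 A s² = L`
  -- for `s ≥ 3`.
  set s := √(L / (4 * A)) with hs
  have hs0 : 0 ≤ s := Real.sqrt_nonneg _
  have hs2 : 4 * A * s ^ 2 = L := by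
    rw [hs, Real.sq_sqrt (by positivity)]
    field_simp
  have hcs : 1 / (64 * √A) * √L = s / 32 := by
    have h1 : √L = 2 * √A * s := by
      rw [← hs2, show 4 * A * s ^ 2 = (2 * s) ^ 2 * A by ring, Real.sqrt_mul (by positivity),
        Real.sqrt_sq (by positivity)]
      ring
    rw [h1]
    have : √A ≠ 0 := by positivity
    field_simp
    ring
  rw [hcs]
  rcases lt_or_ge s 3 with hs3 | hs3
  · have h1 : Real.exp (s / 32) ≤ 4 := by
      have h2 : Real.exp (s / 32) ≤ Real.exp 1 := Real.exp_le_exp.mpr (by linarith)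
      have := Real.exp_one_lt_d9
      linarith
    refine (measureReal_le_one (μ := law)).trans ?_
    rw [← Real.exp_add]
    refine Real.one_le_exp ?_
    have : 0 < 1 / q := by positivity
    linarith
  · set n := ⌊Real.exp s⌋₊ with hn
    have hes : 1 ≤ Real.exp s := Real.one_le_exp hs0
    have hn1 : 1 ≤ n := Nat.one_le_floor_iff _ |>.mpr hes
    have hnR : (1 : ℝ) ≤ n := by exact_mod_cast hn1
    have hnle : (n : ℝ) ≤ Real.exp s := Nat.floor_le (by positivity)
    have hnge : Real.exp s ≤ 2 * n := by
      have := Nat.lt_floor_add_one (Real.exp s)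
      rw [← hn] at this
      linarith
    have hlog : Real.log n ≤ s := by
      rw [Real.log_le_iff_le_exp (by positivity)]
      exact hnle
    have hlog0 : 0 ≤ Real.log n := Real.log_nonneg hnR
    have hG : (B ^ 2 / 2 + B) * boxVariance κ n ^ 2 ≤ A * (1 + s) ^ 2 := by
      have h1 := boxVariance_le hκ n
      have h2 : (κ⁻¹ + 8) * (1 + Real.log n) ≤ (κ⁻¹ + 8) * (1 + s) := by gcongr
      have h3 : boxVariance κ n ^ 2 ≤ ((κ⁻¹ + 8) * (1 + s)) ^ 2 :=
        pow_le_pow_left₀ (boxVariance_nonneg κ n) (h1.trans h2) 2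
      calc (B ^ 2 / 2 + B) * boxVariance κ n ^ 2 ≤
          (B ^ 2 / 2 + B) * ((κ⁻¹ + 8) * (1 + s)) ^ 2 := by gcongr
        _ = A * (1 + s) ^ 2 := by rw [hA]; ring
    have hL1 : (B ^ 2 / 2 + B) * boxVariance κ n ^ 2 + 1 ≤ L := by
      rw [← hs2]
      have h1 : A * (1 + s) ^ 2 + 1 ≤ 4 * A * s ^ 2 := by
        have h2 : 1 ≤ 4 * s ^ 2 - (1 + s) ^ 2 := by nlinarith
        nlinarith
      linarith
    -- The fourth power of `e^{s/16}` exactly compensates the rate `e^{-s/4}`.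
    set y := q * Real.exp (s / 16) with hy
    have hy0 : 0 < y := by positivity
    set m := ⌊y⌋₊ with hm
    have hmy : (m : ℝ) ≤ y := Nat.floor_le hy0.le
    have hym : y - 1 ≤ m := by
      have := Nat.lt_floor_add_one y
      rw [← hm] at this
      linarith
    have hn4 : (n : ℝ) ^ (-(1 / 4) : ℝ) ≤ 2 * Real.exp (-(s / 4)) := by
      calc (n : ℝ) ^ (-(1 / 4) : ℝ) ≤ (Real.exp s / 2) ^ (-(1 / 4) : ℝ) :=
            Real.rpow_le_rpow_of_nonpos (by positivity) (by linarith) (by norm_num)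
        _ = Real.exp (-(s / 4)) * 2 ^ (1 / 4 : ℝ) := by
            rw [Real.div_rpow (by positivity) (by positivity), ← Real.exp_mul,
              Real.rpow_neg (by positivity : (0 : ℝ) ≤ 2), div_inv_eq_mul]
            congr 2
            ring
        _ ≤ Real.exp (-(s / 4)) * 2 ^ (1 : ℝ) := by
            gcongr
            · norm_num
            · norm_num
        _ = _ := by rw [Real.rpow_one]; ring
    have hbase : 4096 * (m : ℝ) ^ 4 * (rateConst κ B * (n : ℝ) ^ (-(1 / 4) : ℝ)) ≤
        Real.exp (-1) := by
      calc 4096 * (m : ℝ) ^ 4 * (rateConst κ B * (n : ℝ) ^ (-(1 / 4) : ℝ)) ≤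
          4096 * y ^ 4 * (rateConst κ B * (2 * Real.exp (-(s / 4)))) := by gcongr
        _ = y ^ 4 * (8192 * rateConst κ B) * Real.exp (-(s / 4)) := by ring
        _ ≤ y ^ 4 * Q * Real.exp (-(s / 4)) := by
            gcongr
            rw [hQ]
            linarith
        _ = q ^ 4 * (Real.exp 1 * Q) * (Real.exp (s / 16) ^ 4 * Real.exp (-(s / 4))) *
            Real.exp (-1) := by
            have : Real.exp 1 * Real.exp (-1) = 1 := by rw [← Real.exp_add]; simp
            rw [hy]
            linear_combination (-(q ^ 4 * Q * Real.exp (s / 16) ^ 4 * Real.exp (-(s / 4)))) * this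
        _ = Real.exp (-1) := by
            rw [hq4, ← Real.exp_nat_mul, ← Real.exp_add]
            have : ((4 : ℕ) : ℝ) * (s / 16) + -(s / 4) = 0 := by push_cast; ring
            rw [this]
            simp
    have hmain := measure_interaction_lt_le hκ hw0 hwB hw1 hn1 m hL1
    have hR0 : 0 ≤ rateConst κ B * (n : ℝ) ^ (-(1 / 4) : ℝ) := by positivity
    refine hmain.trans ((factorial_moment_le m hR0).trans ?_)
    calc (4096 * (m : ℝ) ^ 4 * (rateConst κ B * (n : ℝ) ^ (-(1 / 4) : ℝ))) ^ m
        ≤ Real.exp (-1) ^ m := by gcongr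
      _ = Real.exp (-m) := by
          rw [← Real.exp_nat_mul]
          congr 1
          ring
      _ ≤ Real.exp (4 + 1 / q + -Real.exp (s / 32)) := by
          rw [Real.exp_le_exp]
          have h1 : Real.exp (s / 16) = Real.exp (s / 32) ^ 2 := by
            rw [← Real.exp_nat_mul]
            congr 1
            push_cast
            ring
          have h2 : 2 * Real.exp (s / 32) ≤ y + 1 / q := by
            rw [hy, h1]
            have h3 : 0 ≤ (q * Real.exp (s / 32) - 1) ^ 2 / q := by positivity
            have h4 : (q * Real.exp (s / 32) - 1) ^ 2 / q =
                q * Real.exp (s / 32) ^ 2 + 1 / q - 2 * Real.exp (s / 32) := by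
              field_simp
              ring
            linarith
          have h5 : 0 < Real.exp (s / 32) := Real.exp_pos _
          linarith
      _ = _ := Real.exp_add _ _

/-! ### Exponential integrability -/

/-- Slicing by unit intervals: where `j < -W ≤ j + 1` the integrand is at most `e^{2(j+1)}`. -/
lemma lintegral_exp_neg_two_mul_le {Ω : Type*} [MeasurableSpace Ω] {μ : Measure Ω}
    [IsProbabilityMeasure μ] {W : Ω → ℝ} (hW : AEMeasurable W μ) :
    ∫⁻ x, ENNReal.ofReal (Real.exp (-(2 * W x))) ∂μ ≤
      1 + ∑' j : ℕ, ENNReal.ofReal (Real.exp (2 * (j + 1))) * μ {x | W x < -j} := by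
  have hset : ∀ j : ℕ, NullMeasurableSet {x | W x < -(j : ℝ)} μ := fun j =>
    nullMeasurableSet_lt hW aemeasurable_const
  have hpt : ∀ x, ENNReal.ofReal (Real.exp (-(2 * W x))) ≤
      1 + ∑' j : ℕ, {x | W x < -(j : ℝ)}.indicator
        (fun _ => ENNReal.ofReal (Real.exp (2 * (j + 1)))) x := by
    intro x
    rcases le_or_gt 0 (W x) with h | h
    · refine le_add_right ?_
      rw [ENNReal.ofReal_le_one, Real.exp_le_one_iff]
      linarith
    · set j := ⌈-W x⌉₊ - 1 with hj
      have hpos : 0 < ⌈-W x⌉₊ := Nat.ceil_pos.mpr (by linarith)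
      have h1 : -W x ≤ j + 1 := by
        have := Nat.le_ceil (-W x)
        rwa [show (j : ℝ) + 1 = ((j + 1 : ℕ) : ℝ) by push_cast; ring,
          show j + 1 = ⌈-W x⌉₊ by omega]
      have h2 : (j : ℝ) < -W x := Nat.lt_ceil.mp (by omega)
      refine le_add_left (le_trans ?_ (ENNReal.le_tsum j))
      rw [Set.indicator_of_mem (show x ∈ {x | W x < -(j : ℝ)} by
        change W x < -(j : ℝ); linarith)]
      exact ENNReal.ofReal_le_ofReal (Real.exp_le_exp.mpr (by linarith))
  refine (lintegral_mono hpt).trans ?_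
  rw [lintegral_add_left measurable_const, lintegral_tsum fun j =>
    (aemeasurable_const.indicator₀ (hset j))]
  simp only [lintegral_const, measure_univ, mul_one]
  gcongr with j
  rw [lintegral_indicator_const₀ (hset j)]

/-- The degree-four term `c⁴ y² / 24` of the exponential series suffices, by completing the square.
The slope `4` beats the growth `e^{2j}` in the second moment and leaves a geometric series of ratio
`e⁻²`. -/
lemma four_mul_sub_le_exp {c : ℝ} (hc : 0 < c) {y : ℝ} (hy : 0 ≤ y) :
    4 * y - 96 / c ^ 4 ≤ Real.exp (c * √y) := by
  have h1 := Real.pow_div_factorial_le_exp (c * √y) (by positivity) 4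
  have h2 : (c * √y) ^ 4 = c ^ 4 * y ^ 2 := by
    rw [mul_pow, show (√y) ^ 4 = (√y ^ 2) ^ 2 by ring, Real.sq_sqrt hy]
  rw [h2] at h1
  refine le_trans ?_ h1
  have h3 : 0 ≤ (c ^ 4 * y - 48) ^ 2 / (24 * c ^ 4) := by positivity
  have h4 : (c ^ 4 * y - 48) ^ 2 / (24 * c ^ 4) =
      c ^ 4 * y ^ 2 / (Nat.factorial 4 : ℕ) - (4 * y - 96 / c ^ 4) := by
    norm_num [Nat.factorial]
    field_simp
    ring
  linarith

/-- A double exponential tail bounds the second exponential moment. -/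
lemma lintegral_exp_neg_two_mul_le_of_tail {Ω : Type*} [MeasurableSpace Ω] {μ : Measure Ω}
    [IsProbabilityMeasure μ] {W : Ω → ℝ} (hW : AEMeasurable W μ) {c C : ℝ} (hc : 0 < c)
    (hC : 0 < C)
    (h : ∀ L : ℝ, 0 ≤ L → μ.real {x | W x < -L} ≤ C * Real.exp (-Real.exp (c * √L))) :
    ∫⁻ x, ENNReal.ofReal (Real.exp (-(2 * W x))) ∂μ ≤
      ENNReal.ofReal (1 + ∑' j : ℕ, C * Real.exp (2 + 96 / c ^ 4) * Real.exp (-2) ^ j) := by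
  have hs : Summable fun j : ℕ => C * Real.exp (2 + 96 / c ^ 4) * Real.exp (-2) ^ j :=
    (summable_geometric_of_lt_one (Real.exp_nonneg _)
      (Real.exp_lt_one_iff.mpr (by norm_num))).mul_left _
  have h0 : ∀ j : ℕ, 0 ≤ C * Real.exp (2 + 96 / c ^ 4) * Real.exp (-2) ^ j := fun j => by
    positivity
  refine (lintegral_exp_neg_two_mul_le hW).trans ?_
  rw [ENNReal.ofReal_add zero_le_one (tsum_nonneg h0), ENNReal.ofReal_one,
    ENNReal.ofReal_tsum_of_nonneg h0 hs]
  gcongr with j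
  rw [← ofReal_measureReal, ← ENNReal.ofReal_mul (Real.exp_nonneg _)]
  refine ENNReal.ofReal_le_ofReal ?_
  calc _ ≤ Real.exp (2 * (j + 1)) * (C * Real.exp (-Real.exp (c * √j))) := by
        gcongr
        exact h j (Nat.cast_nonneg j)
    _ ≤ Real.exp (2 * (j + 1)) * (C * Real.exp (96 / c ^ 4 - 4 * j)) := by
        gcongr
        linarith [four_mul_sub_le_exp hc (Nat.cast_nonneg j)]
    _ = C * Real.exp (2 + 96 / c ^ 4) * Real.exp (-2) ^ j := by
        rw [← Real.exp_nat_mul, mul_left_comm, ← Real.exp_add, mul_assoc, ← Real.exp_add]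
        congr 2
        ring

/-- Where `|f| ≥ M`, one has `|f| ≤ f² / M`; large `M` makes the tails uniformly small. -/
lemma uniformIntegrable_of_lintegral_sq_le {Ω ι : Type*} [MeasurableSpace Ω] {μ : Measure Ω}
    [IsFiniteMeasure μ] {f : ι → Ω → ℝ} (hf : ∀ i, AEStronglyMeasurable (f i) μ) {K : ℝ}
    (hK : ∀ i, ∫⁻ x, ENNReal.ofReal (f i x ^ 2) ∂μ ≤ ENNReal.ofReal K) :
    UniformIntegrable f 1 μ := by
  refine uniformIntegrable_of le_rfl ENNReal.one_ne_top hf fun δ hδ => ?_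
  set M : ℝ := (|K| + 1) / δ with hM
  have hM0 : 0 < M := by positivity
  refine ⟨M.toNNReal, fun i => ?_⟩
  rw [eLpNorm_one_eq_lintegral_enorm]
  have hpt : ∀ x, ‖{x | M.toNNReal ≤ ‖f i x‖₊}.indicator (f i) x‖ₑ ≤
      ENNReal.ofReal M⁻¹ * ENNReal.ofReal (f i x ^ 2) := by
    intro x
    by_cases hx : x ∈ {x | M.toNNReal ≤ ‖f i x‖₊}
    · rw [Set.indicator_of_mem hx, ← ENNReal.ofReal_mul (by positivity), ← ofReal_norm]
      have h1 : M ≤ ‖f i x‖ := Real.toNNReal_le_iff_le_coe.mp hx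
      refine ENNReal.ofReal_le_ofReal ?_
      rw [← sq_abs, ← Real.norm_eq_abs, inv_mul_eq_div, le_div_iff₀ hM0]
      nlinarith [norm_nonneg (f i x)]
    · simp [Set.indicator_of_notMem hx]
  refine (lintegral_mono hpt).trans ?_
  rw [lintegral_const_mul' _ _ ENNReal.ofReal_ne_top]
  refine (mul_le_mul_right (hK i) _).trans ?_
  rw [← ENNReal.ofReal_mul (by positivity)]
  refine ENNReal.ofReal_le_ofReal ?_
  rw [hM, inv_div, div_mul_eq_mul_div, div_le_iff₀ (by positivity)]
  nlinarith [le_abs_self K]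

lemma setOf_lt_exp_neg_eq {Ω : Type*} (V : Ω → ℝ) {t : ℝ} (ht : 1 ≤ t) :
    {x | t < Real.exp (-V x)} = {x | V x < -Real.log t} := by
  ext x
  change t < Real.exp (-V x) ↔ V x < -Real.log t
  rw [← Real.log_lt_iff_lt_exp (by linarith), lt_neg]

lemma measureReal_setOf_lt_congr {Ω : Type*} [MeasurableSpace Ω] {μ : Measure Ω} {V W : Ω → ℝ}
    (h : V =ᵐ[μ] W) (a : ℝ) : μ.real {x | V x < a} = μ.real {x | W x < a} := by
  refine measureReal_congr ?_
  filter_upwards [h] with x hx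
  exact congrArg (· < a) hx

end Phi42

end

/-! ### Existence, tails and uniform integrability of the interactions -/

theorem proposition4p1 (κ : ℝ) (hκ : 0 < κ) (v : Phi42.Plane → ℝ) (hv : Phi42.IsPotential v) :
    -- the random variables `V^ε` and `V` exist
    (∀ ε : ℝ, 0 < ε → ∃ V, Phi42.IsNonlocalInteraction κ v ε V) ∧
    (∃ V, Phi42.IsLocalInteraction κ V) ∧
    -- the tail estimate, with constants that depend only on `κ` and `v`
    (∃ c : ℝ, 0 < c ∧ ∃ C : ℝ, 0 < C ∧
      (∀ ε : ℝ, 0 < ε → ∀ V, Phi42.IsNonlocalInteraction κ v ε V → ∀ t : ℝ, 1 ≤ t →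
        Phi42.law.real {X | t < Real.exp (-V X)} ≤
          C * Real.exp (-Real.exp (c * √(Real.log t)))) ∧
      (∀ V, Phi42.IsLocalInteraction κ V → ∀ t : ℝ, 1 ≤ t →
        Phi42.law.real {X | t < Real.exp (-V X)} ≤
          C * Real.exp (-Real.exp (c * √(Real.log t))))) ∧
    -- uniform integrability
    (∀ V : ℝ → Phi42.Sample → ℝ, (∀ ε : ℝ, 0 < ε → Phi42.IsNonlocalInteraction κ v ε (V ε)) →
      UniformIntegrable (fun (ε : Set.Ioi (0 : ℝ)) (X : Phi42.Sample) => Real.exp (-V ε X))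
        1 Phi42.law) := by
  -- The constants are fixed before `ε`, with `B = ∫ |v|`, a common bound for all the multipliers.
  obtain ⟨c, hc, C, hC, htail⟩ := Phi42.exists_tail_bound hκ hv.one_le_integral_abs
  have hnonlocal : ∀ ε : ℝ, 0 < ε → ∀ V, Phi42.IsNonlocalInteraction κ v ε V →
      ∀ L : ℝ, 0 ≤ L →
        Phi42.law.real {X | V X < -L} ≤ C * Real.exp (-Real.exp (c * √L)) := by
    intro ε hε V hV L hL
    rw [Phi42.measureReal_setOf_lt_congr (hV.ae_eq hκ hv hε)]
    exact htail _ (hv.multiplier_nonneg ε) (Phi42.multiplier_le v ε) (hv.multiplier_zero ε) L hL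
  refine ⟨fun ε hε => ⟨_, Phi42.isNonlocalInteraction_interaction hκ hv hε⟩,
    ⟨_, Phi42.isLocalInteraction_interaction hκ⟩, ⟨c, hc, C, hC, ?_, ?_⟩, ?_⟩
  · intro ε hε V hV t ht
    rw [Phi42.setOf_lt_exp_neg_eq V ht]
    exact hnonlocal ε hε V hV _ (Real.log_nonneg ht)
  · intro V hV t ht
    rw [Phi42.setOf_lt_exp_neg_eq V ht, Phi42.measureReal_setOf_lt_congr (hV.ae_eq hκ)]
    -- The local interaction has multiplier one, which is admissible because `1 ≤ ∫ |v|`.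
    exact htail _ (fun _ => zero_le_one) (fun _ => hv.one_le_integral_abs) rfl _
      (Real.log_nonneg ht)
  · intro V hV
    have hmeas : ∀ ε : Set.Ioi (0 : ℝ), AEStronglyMeasurable (V ε) Phi42.law := fun ε =>
      (hV ε ε.2).1.aestronglyMeasurable
    refine Phi42.uniformIntegrable_of_lintegral_sq_le
      (K := 1 + ∑' j : ℕ, C * Real.exp (2 + 96 / c ^ 4) * Real.exp (-2) ^ j)
      (fun ε => Real.continuous_exp.comp_aestronglyMeasurable (hmeas ε).neg) fun ε => ?_
    have hexp : ∀ X, Real.exp (-V ε X) ^ 2 = Real.exp (-(2 * V ε X)) := fun X => by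
      rw [← Real.exp_nat_mul]
      congr 1
      push_cast
      ring
    simp only [hexp]
    exact Phi42.lintegral_exp_neg_two_mul_le_of_tail (hmeas ε).aemeasurable hc hC
      (hnonlocal ε ε.2 (V ε) (hV ε ε.2))
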